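/- Let $w(x)=\sqrt{1-x^2}$ on $(-1,1)$, let $L^2=L^2(-1,1)$ (real-valued), $\|\psi\|_{w^{-1}}^2=\int_{-1}^1|\psi|^2w^{-1}\,dx$, and $$\mathcal A\phi=\partial_x\Big(\frac{\sqrt{1-x^2}}{\pi}\,\mathrm{P.V.}\!\int_{-1}^1\frac{\phi(\xi)}{\sqrt{1-\xi^2}\,(x-\xi)}\,d\xi\Big),$$ where the derivative and the principal value are taken in the sense of distributions: for $\chi\in C^\infty([-1,1])$, $$\langle\mathcal A\phi,\chi\rangle=-\lim_{\varepsilon\to0^+}\int_{-1}^1\chi'(x)\,\frac{\sqrt{1-x^2}}{\pi}\int_{\xi\in(-1,1),\,|x-\xi|>\varepsilon}\frac{\phi(\xi)}{\sqrt{1-\xi^2}\,(x-\xi)}\,d\xi\,dx .$$ Let $H^{1/2}_{w^{-1}}=\{\psi\in L^2:\ \|\psi\|^2_{H^{1/2}_{w^{-1}}}:=\|\psi\|_{w^{-1}}^2+(\mathcal A\psi,\psi)_{L^2}<\infty\}$, where $(\mathcal A\psi,\psi)_{L^2}\in[0,\infty]$ denotes the closed extension $\sup_{\chi\in C^\infty([-1,1])}\big(2\langle\mathcal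 A\psi,\chi\rangle-\langle\mathcal A\chi,\chi\rangle\big)$ of the nonnegative quadratic form $\langle\mathcal A\chi,\chi\rangle$ on $C^\infty([-1,1])$. **Theorem.** Let $T>0$, $[\phi_0,\phi_1]\in H^{1/2}_{w^{-1}}\times L^2$, and let $f:\mathbb R\to\mathbb R$ be (globally) Lipschitz. Then the problem $$\phi_{tt}+\mathcal A\phi=f(\phi),\qquad \phi(0)=\phi_0,\qquad \phi_t(0)=\phi_1,$$ has a unique solution with $[\phi,\phi_t]\in C([0,T];H^{1/2}_{w^{-1}}\times L^2)$. In the same sense it has a unique solution on the time interval $[0,\infty)$, with $[\phi,\phi_t]\in C([0,\infty);H^{1/2}_{w^{-1}}\times L^2)$. Here $\phi_t$ is the time derivative of $\phi$ as an $L^2$-valued function, and the equation is understood weakly: for every $\chi\in C^\infty([-1,1])$ and every time $t$ of the interval (one-sided derivatives at end points), $\frac{d}{dt}(\phi_t,\chi)_{L^2}+\langle\mathcal A\phi,\chi\rangle=(f(\phi),\chi)_{L^2}$. -/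

import Mathlib

open MeasureTheory Set Filter Topology
open scoped ContDiff ENNReal NNReal

noncomputable section

namespace Sloshing

/-- The real Hilbert space `L²(-1,1)` (Lebesgue measure on the open interval). -/
abbrev L2 : Type := Lp ℝ 2 (volume.restrict (Ioo (-1 : ℝ) 1))

/-- The weight `w(x) = √(1 - x²)`. -/
def w (x : ℝ) : ℝ := √(1 - x ^ 2)

/-- The truncated singular integral
`(w(x) / π) ∫_{ξ ∈ (-1,1), |x - ξ| > ε} φ(ξ) / (w(ξ) (x - ξ)) dξ`.
Its limit as `ε → 0⁺` is the principal value in the definition of `𝒜 φ`. -/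
def truncB (ε : ℝ) (φ : ℝ → ℝ) (x : ℝ) : ℝ :=
  w x / Real.pi * ∫ ξ in {ξ : ℝ | ξ ∈ Ioo (-1 : ℝ) 1 ∧ ε < |x - ξ|}, φ ξ / (w ξ * (x - ξ))

/-- The operator `𝒜 φ = ∂ₓ ( (w(x) / π) P.V. ∫ φ(ξ) / (w(ξ) (x - ξ)) dξ )`, applied to a
function `χ` that is smooth on `[-1,1]`. The derivative is the distributional one (it is moved to
`χ`; no boundary term appears because `w(±1) = 0`), and the principal value is the limit of the
truncated integrals in the sense of distributions:
`⟨𝒜 φ, χ⟩ = - lim_{ε → 0⁺} ∫_{-1}^{1} (truncB ε φ)(x) χ'(x) dx`.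
For `φ / w ∈ L¹(-1,1)`, in particular for `∫ φ² / w < ∞`, and `χ` smooth, the limit exists. -/
def opA (φ χ : ℝ → ℝ) : ℝ :=
  limUnder (𝓝[>] (0 : ℝ)) fun ε => -∫ x in Ioo (-1 : ℝ) 1, truncB ε φ x * deriv χ x

/-- `‖ψ‖²_{w⁻¹} = ∫_{-1}^{1} |ψ|² / w dx`, with values in `[0,∞]`. -/
def weightedNormSq (ψ : ℝ → ℝ) : ℝ≥0∞ :=
  ∫⁻ x in Ioo (-1 : ℝ) 1, ENNReal.ofReal (ψ x ^ 2 / w x)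

/-- The quadratic form `(𝒜 ψ, ψ)_{L²}` with values in `[0,∞]`. For `ψ` smooth on `[-1,1]` it is
`⟨𝒜 ψ, ψ⟩`; for other `ψ`, where `𝒜 ψ` is only a distribution, it is the closed extension
`sup_χ (2 ⟨𝒜 ψ, χ⟩ - ⟨𝒜 χ, χ⟩)`, over all `χ` smooth on `[-1,1]`, of this nonnegative form. -/
def energy (ψ : ℝ → ℝ) : ℝ≥0∞ :=
  ⨆ (χ : ℝ → ℝ) (_ : ContDiff ℝ ∞ χ), ENNReal.ofReal (2 * opA ψ χ - opA χ χ)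

/-- `‖ψ‖²_{H^{1/2}_{w⁻¹}} = ‖ψ‖²_{w⁻¹} + (𝒜 ψ, ψ)_{L²}`, with values in `[0,∞]`. -/
def hNormSq (ψ : L2) : ℝ≥0∞ := weightedNormSq ψ + energy ψ

/-- The space `H^{1/2}_{w⁻¹}(-1,1)`, as a subset of `L²(-1,1)`. -/
def H : Set L2 := {ψ | hNormSq ψ < ⊤}

/-- `(φ, v)` is a solution, on the time interval `I` (with `0 ∈ I`), of
`φ_tt + 𝒜 φ = f(φ)`, `φ(0) = φ₀`, `φ_t(0) = φ₁`, with `v = φ_t` and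
`[φ, φ_t] ∈ C(I; H^{1/2}_{w⁻¹} × L²)`. -/
structure IsSolution (I : Set ℝ) (f : ℝ → ℝ) (φ₀ φ₁ : L2) (φ v : ℝ → L2) : Prop where
  /-- `φ(t) ∈ H^{1/2}_{w⁻¹}` for every `t ∈ I` -/
  mem_H : ∀ t ∈ I, φ t ∈ H
  /-- `φ` is continuous on `I` for the norm of `H^{1/2}_{w⁻¹}` -/
  continuous_H : ∀ t₀ ∈ I, Tendsto (fun t => hNormSq (φ t - φ t₀)) (𝓝[I] t₀) (𝓝 0)
  /-- `v` is continuous on `I` for the norm of `L²` -/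
  continuous_L2 : ContinuousOn v I
  /-- `v` is the time derivative of `φ` (as an `L²`-valued function) -/
  deriv_eq : ∀ t ∈ I, HasDerivWithinAt φ (v t) I t
  /-- `(d/dt) (φ_t, χ)_{L²} + ⟨𝒜 φ, χ⟩ = (f(φ), χ)_{L²}` for all `χ` smooth on `[-1,1]` -/
  equation : ∀ χ : ℝ → ℝ, ContDiff ℝ ∞ χ → ∀ t ∈ I,
    HasDerivWithinAt (fun s => ∫ x in Ioo (-1 : ℝ) 1, v s x * χ x)
      ((∫ x in Ioo (-1 : ℝ) 1, f (φ t x) * χ x) - opA (φ t) χ) I t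
  /-- `φ(0) = φ₀` -/
  init_pos : φ 0 = φ₀
  /-- `φ_t(0) = φ₁` -/
  init_vel : v 0 = φ₁

/-- Existence and uniqueness of the solution on the time interval `I`. -/
def HasUniqueSolution (I : Set ℝ) (f : ℝ → ℝ) (φ₀ φ₁ : L2) : Prop :=
  ∃ φ v : ℝ → L2, IsSolution I f φ₀ φ₁ φ v ∧
    ∀ φ' v' : ℝ → L2, IsSolution I f φ₀ φ₁ φ' v' → EqOn φ' φ I ∧ EqOn v' v I

end Sloshing

end

/-! Chebyshev polynomials diagonalize `𝒜` in a weak sense: the dual operator `opN`, defined by `⟨𝒜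
φ, χ⟩ = ∫ (φ / w) opN χ`, sends `T n` to `n T n` (`opN_T`). With coefficients taken in the
orthonormal Chebyshev basis of `L²(dx / w)`, this gives `⟨𝒜 ψ, χ⟩ = ∑ n ψₙ χₙ` (`hasSum_opA`) and
energy `∑ n ψₙ²` (`energy_eq_tsum`). Hence `H` consists of the `ψ` with `∑ (1 + n) ψₙ² < ∞`.

The equation does not decouple into modes, because its pivot space is `L²(dx)`, where the Chebyshev
polynomials are not orthogonal. It is therefore treated abstractly. Adding `(φ,1)(χ,1)` to the form
of `𝒜` turns it into an inner product, and `H` is parametrized by `ℓ²` through an injection `ι`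
(`coordToL2`) into `L²(-1,1)` with injective adjoint. Compensating on the right with `F(φ) = f(φ) +
(φ,1) 1`, which is still Lipschitz, the problem becomes `(ι u)' = v`, `(ι* v)' = -u + ι* F(ι u)`.

The generator `(u, v) ↦ (v, -A u)` is unbounded, but its inverse `K (u, v) = (-ι* v, ι u)` is
bounded, skew and injective. Stone's theorem is proved in this form (`exists_isometry_group`): `K⁻¹`
generates a group of isometries `S t`, and equations are kept multiplied by `K` so that no domain
has to be discussed. Writing `U t = S t (α t)` turns the semilinear equation into an ODE for `α`
whose right-hand side is Lipschitz uniformly in time. It has a global forward solution. For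
uniqueness, any solution is shown to have this form (`eqOn_of_hasDerivWithinAt_semilinear`), and the
weak formulation is shown to determine the abstract equation because the coordinates of smooth
functions are total (`IsSolution.exists_coord`). -/

noncomputable section
namespace Sloshing

/-! ### Stone's theorem for the inverse of a bounded skew operator. -/

section SkewGenerator

open scoped InnerProductSpace

variable {X : Type*} [NormedAddCommGroup X] [InnerProductSpace ℝ X] [CompleteSpace X]

/-- For skew `K` the operator `-K²` is nonnegative, so `δ² - K²` is coercive and Lax–Milgram
applies. -/
theorem isUnit_sq_sub_sq {K : X →L[ℝ] X} (hK : ∀ x y, ⟪K x, y⟫_ℝ = -⟪x, K y⟫_ℝ)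
    {δ : ℝ} (hδ : 0 < δ) : IsUnit (δ ^ 2 • (1 : X →L[ℝ] X) - K * K) := by
  refine ContinuousLinearMap.isUnit_of_forall_le_norm_inner_map _ (c := ⟨δ ^ 2, by positivity⟩)
    (by change 0 < δ ^ 2; positivity) fun x => ?_
  have h : ⟪(δ ^ 2 • (1 : X →L[ℝ] X) - K * K) x, x⟫_ℝ = δ ^ 2 * ‖x‖ ^ 2 + ‖K x‖ ^ 2 := by
    simp [inner_sub_left, inner_smul_left, hK (K x) x]
  rw [h, Real.norm_of_nonneg (by positivity)]
  change ‖x‖ ^ 2 * δ ^ 2 ≤ _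
  nlinarith [sq_nonneg ‖K x‖]

/-- Bounded skew-adjoint approximations of the inverse of an injective skew-adjoint operator. -/
theorem exists_skew_approx {K : X →L[ℝ] X} (hK : ∀ x y, ⟪K x, y⟫_ℝ = -⟪x, K y⟫_ℝ)
    {δ : ℝ} (hδ : 0 < δ) :
    ∃ L : X →L[ℝ] X, (∀ x y, ⟪L x, y⟫_ℝ = -⟪x, L y⟫_ℝ) ∧
      (∀ B : X →L[ℝ] X, Commute K B → Commute L B) ∧
      ∀ z, ‖L (K (K z)) - K z‖ ≤ δ * ‖z‖ := by
  obtain ⟨A, hA⟩ := isUnit_sq_sub_sq hK hδ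
  set R : X →L[ℝ] X := (↑A⁻¹ : X →L[ℝ] X) with hR
  have hcomm : ∀ B : X →L[ℝ] X, Commute K B → Commute R B := by
    intro B hB
    have : Commute (↑A : X →L[ℝ] X) B := by
      rw [hA]
      exact ((Commute.one_left B).smul_left _).sub_left (hB.mul_left hB)
    exact this.units_inv_left
  have hRK : ∀ x, R (K x) = K (R x) := fun x =>
    congrArg (fun T : X →L[ℝ] X => T x) (hcomm K (Commute.refl K)).eq
  have hAx : ∀ x, δ ^ 2 • R x - K (K (R x)) = x := by
    intro x
    have h1 : (↑A : X →L[ℝ] X) * R = 1 := A.mul_inv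
    rw [hA] at h1
    simpa using congrArg (fun T : X →L[ℝ] X => T x) h1
  have hRsymm : ∀ x y, ⟪R x, y⟫_ℝ = ⟪x, R y⟫_ℝ := by
    intro x y
    -- Each free vector is written as `(δ² - K²) R` of itself; the symmetry of `R` then follows from
    -- that of `δ² - K²`.
    conv_lhs => rw [← hAx y]
    conv_rhs => rw [← hAx x]
    simp only [inner_sub_left, inner_sub_right, inner_smul_left, inner_smul_right, hK]
    simp
  -- The approximation is `L = -K (δ² - K²)⁻¹`. On a spectral value `iκ` of `K` it equals `-iκ / (δ²
  -- + κ²)`, which tends to `1 / (iκ)` as `δ → 0`.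
  refine ⟨-(K * R), fun x y => ?_, fun B hB => ?_, fun z => ?_⟩
  · simp [hK, hRsymm, hRK]
  · exact (hB.mul_left (hcomm B hB)).neg_left
  · have h1 : (-(K * R)) (K (K z)) - K z = -(δ ^ 2 • K (R z)) := by
      have := hAx (K z)
      simp only [hRK] at this
      have h0 : (-(K * R)) (K (K z)) = -K (K (K (R z))) := by simp [hRK]
      rw [h0, ← sub_eq_zero]
      rw [← this]
      abel
    have h2 : δ ^ 2 * ‖R z‖ ^ 2 + ‖K (R z)‖ ^ 2 = ⟪z, R z⟫_ℝ := by
      have h0 := congrArg (fun y => ⟪y, R z⟫_ℝ) (hAx z)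
      simp only [inner_sub_left, inner_smul_left, hK (K (R z)) (R z)] at h0
      simpa using h0
    have h3 : ⟪z, R z⟫_ℝ ≤ ‖z‖ * ‖R z‖ := real_inner_le_norm _ _
    -- With `a = δ² ‖R z‖`, the two previous bounds give `δ² ‖K (R z)‖² ≤ a ‖z‖ - a²`, and the right
    -- side is at most `‖z‖² / 4`.
    have h4 : (δ * ‖K (R z)‖) ^ 2 ≤ ‖z‖ ^ 2 := by
      nlinarith [sq_nonneg (2 * δ ^ 2 * ‖R z‖ - ‖z‖), sq_nonneg ‖z‖, sq_nonneg (‖K (R z)‖)]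
    have h5 : δ * ‖K (R z)‖ ≤ ‖z‖ := abs_le_of_sq_le_sq' h4 (norm_nonneg _) |>.2
    rw [h1, norm_neg, norm_smul, Real.norm_of_nonneg (by positivity)]
    nlinarith

theorem hasDerivAt_exp_smul_apply (L : X →L[ℝ] X) (x : X) (t : ℝ) :
    HasDerivAt (fun s : ℝ => NormedSpace.exp (s • L) x) (NormedSpace.exp (t • L) (L x)) t :=
  ((ContinuousLinearMap.apply ℝ X x).hasFDerivAt.comp_hasDerivAt t
    (hasDerivAt_exp_smul_const (𝕂 := ℝ) L t))

/-- The derivative of the squared norm along the flow is `2 ⟪y, L y⟫`, which vanishes for skew `L`.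
-/
theorem norm_exp_smul_skew {L : X →L[ℝ] X} (hL : ∀ x y, ⟪L x, y⟫_ℝ = -⟪x, L y⟫_ℝ) (t : ℝ)
    (x : X) : ‖NormedSpace.exp (t • L) x‖ = ‖x‖ := by
  have hd : ∀ s : ℝ, HasDerivAt (fun s : ℝ => ‖NormedSpace.exp (s • L) x‖ ^ 2) 0 s := by
    intro s
    have h1 := ((ContinuousLinearMap.apply ℝ X x).hasFDerivAt.comp_hasDerivAt s
      (hasDerivAt_exp_smul_const' (𝕂 := ℝ) L s)).norm_sq
    have h2 : ∀ y : X, ⟪y, L y⟫_ℝ = 0 := fun y => by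
      have := hL y y
      rw [real_inner_comm] at this
      linarith
    simpa [h2] using h1
  have h := is_const_of_deriv_eq_zero (fun s => (hd s).differentiableAt) (fun s => (hd s).deriv) t 0
  simp only [zero_smul, NormedSpace.exp_zero, one_apply_eq_self] at h
  exact (sq_eq_sq₀ (norm_nonneg _) (norm_nonneg _)).1 h

theorem norm_exp_smul_sub_le {L : X →L[ℝ] X} (hL : ∀ x y, ⟪L x, y⟫_ℝ = -⟪x, L y⟫_ℝ) (t : ℝ)
    (x : X) : ‖NormedSpace.exp (t • L) x - x‖ ≤ ‖L x‖ * |t| := by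
  have := convex_univ.norm_image_sub_le_of_norm_hasDerivWithin_le (s := univ) (x := (0 : ℝ))
    (y := t) (fun s _ => (hasDerivAt_exp_smul_apply L x s).hasDerivWithinAt)
    (fun s _ => (norm_exp_smul_skew hL s (L x)).le) (mem_univ _) (mem_univ _)
  simpa using this

/-- By commutation `exp (tL') = exp (tL) exp (t(L' - L))`. The first factor is an isometry and `L' -
L` is again skew, so only the distance of the second factor from the identity matters. -/
theorem norm_exp_smul_sub_exp_smul_le {L L' : X →L[ℝ] X}
    (hL : ∀ x y, ⟪L x, y⟫_ℝ = -⟪x, L y⟫_ℝ) (hL' : ∀ x y, ⟪L' x, y⟫_ℝ = -⟪x, L' y⟫_ℝ)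
    (hc : Commute L L') (t : ℝ) (x : X) :
    ‖NormedSpace.exp (t • L') x - NormedSpace.exp (t • L) x‖ ≤ ‖L' x - L x‖ * |t| := by
  have hD : ∀ x y, ⟪(L' - L) x, y⟫_ℝ = -⟪x, (L' - L) y⟫_ℝ := by
    intro x y
    simp [inner_sub_left, inner_sub_right, hL, hL']
    ring
  let +nondep : NormedAlgebra ℚ (X →L[ℝ] X) := .restrictScalars ℚ ℝ _
  have h1 : NormedSpace.exp (t • L') = NormedSpace.exp (t • L) * NormedSpace.exp (t • (L' - L)) := by
    rw [← NormedSpace.exp_add_of_commute]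
    · congr 1; rw [← smul_add]; simp
    · exact ((hc.sub_right (Commute.refl L)).smul_left t).smul_right t
  rw [h1, mul_apply_eq_comp, ← map_sub, norm_exp_smul_skew hL]
  simpa using norm_exp_smul_sub_le hD t x

/-- A vector `x` orthogonal to the range is orthogonal to `K (K x)`, which by skewness means `‖K x‖²
= 0`. -/
theorem denseRange_of_skew {K : X →L[ℝ] X} (hK : ∀ x y, ⟪K x, y⟫_ℝ = -⟪x, K y⟫_ℝ)
    (hinj : Function.Injective K) : DenseRange K := by
  have h : (K.range)ᗮ = ⊥ := by
    rw [Submodule.eq_bot_iff]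
    intro x hx
    have h1 : ⟪K (K x), x⟫_ℝ = 0 := hx (K (K x)) ⟨K x, rfl⟩
    rw [hK, neg_eq_zero, inner_self_eq_zero] at h1
    exact hinj (by simpa using h1)
  have h2 := (Submodule.topologicalClosure_eq_top_iff (K := K.range)).2 h
  have h3 : Dense (K.range : Set X) := (Submodule.dense_iff_topologicalClosure_eq_top).2 h2
  exact h3

/-- Stone's theorem for the inverse of a bounded injective skew-adjoint operator `K`: the inverse
generates a strongly continuous group of isometries. -/
theorem exists_isometry_group {K : X →L[ℝ] X} (hK : ∀ x y, ⟪K x, y⟫_ℝ = -⟪x, K y⟫_ℝ)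
    (hinj : Function.Injective K) :
    ∃ S : ℝ → X →L[ℝ] X, (∀ t x, ‖S t x‖ = ‖x‖) ∧ (∀ t x, S t (S (-t) x) = x) ∧
      (∀ x, S 0 x = x) ∧
      (∀ x, Continuous fun t => S t x) ∧ (∀ t x, S t (K x) = K (S t x)) ∧
      ∀ t x, HasDerivAt (fun s => S s (K x)) (S t x) t := by
  let +nondep : NormedAlgebra ℚ (X →L[ℝ] X) := .restrictScalars ℚ ℝ _
  have hδ : ∀ n : ℕ, (0 : ℝ) < 1 / ((n : ℝ) + 1) := fun n => by positivity
  choose L hskew hcomm happrox using fun n : ℕ => exists_skew_approx hK (hδ n)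
  have hδlim : Tendsto (fun n : ℕ => 1 / ((n : ℝ) + 1)) atTop (𝓝 0) :=
    tendsto_one_div_add_atTop_nhds_zero_nat
  have hLK : ∀ n, Commute K (L n) := fun n => (hcomm n K (Commute.refl K)).symm
  have hLL : ∀ m n, Commute (L m) (L n) := fun m n => hcomm m _ (hLK n)
  set E : ℕ → ℝ → X →L[ℝ] X := fun n t => NormedSpace.exp (t • L n) with hE
  have hEnorm : ∀ n t x, ‖E n t x‖ = ‖x‖ := fun n t x => norm_exp_smul_skew (hskew n) t x
  have hEsub : ∀ n t x y, ‖E n t x - E n t y‖ = ‖x - y‖ := fun n t x y => by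
    rw [← map_sub, hEnorm]
  have hdense : DenseRange fun z => K (K z) :=
    (denseRange_of_skew hK hinj).comp (denseRange_of_skew hK hinj) K.continuous
  have hEdiff : ∀ m n t z, ‖E m t (K (K z)) - E n t (K (K z))‖ ≤
      (1 / ((m : ℝ) + 1) + 1 / ((n : ℝ) + 1)) * ‖z‖ * |t| := by
    intro m n t z
    refine (norm_exp_smul_sub_exp_smul_le (hskew n) (hskew m) (hLL n m) t _).trans ?_
    gcongr
    have := norm_sub_le (L m (K (K z)) - K z) (L n (K (K z)) - K z)
    rw [sub_sub_sub_cancel_right] at this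
    linarith [happrox m z, happrox n z]
  -- The approximate groups are Cauchy on the dense range of `K²`, by `hEdiff`. Being isometries,
  -- they are then Cauchy at every vector.
  have hlim : ∀ t x, ∃ y, Tendsto (fun n => E n t x) atTop (𝓝 y) := by
    intro t x
    apply cauchySeq_tendsto_of_complete
    rw [Metric.cauchySeq_iff']
    intro ε hε
    obtain ⟨z, hz⟩ := hdense.exists_dist_lt x (show 0 < ε / 4 by positivity)
    have hlim0 : Tendsto (fun n : ℕ => (1 / ((n : ℝ) + 1)) * (2 * ‖z‖ * |t|)) atTop (𝓝 0) := by
      simpa using hδlim.mul_const (2 * ‖z‖ * |t|)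
    obtain ⟨N, hN⟩ := (hlim0.eventually (gt_mem_nhds (show 0 < ε / 4 by positivity))).exists
    refine ⟨N, fun n hn => ?_⟩
    have hle : 1 / ((n : ℝ) + 1) ≤ 1 / ((N : ℝ) + 1) := by
      apply one_div_le_one_div_of_le (by positivity)
      have : (N : ℝ) ≤ n := by exact_mod_cast hn
      linarith
    rw [dist_eq_norm] at hz ⊢
    calc ‖E n t x - E N t x‖
        = ‖(E n t x - E n t (K (K z))) + (E n t (K (K z)) - E N t (K (K z)))
          - (E N t x - E N t (K (K z)))‖ := by congr 1; abel
      _ ≤ ‖x - K (K z)‖ + (1 / ((n : ℝ) + 1) + 1 / ((N : ℝ) + 1)) * ‖z‖ * |t|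
          + ‖x - K (K z)‖ := by
          refine (norm_sub_le _ _).trans ?_
          rw [hEsub N]
          gcongr
          refine (norm_add_le _ _).trans ?_
          rw [hEsub n]
          gcongr
          exact hEdiff n N t z
      _ < ε := by
          have : (1 / ((n : ℝ) + 1) + 1 / ((N : ℝ) + 1)) * ‖z‖ * |t|
              ≤ (1 / ((N : ℝ) + 1)) * (2 * ‖z‖ * |t|) := by
            have := mul_le_mul_of_nonneg_right hle (show 0 ≤ ‖z‖ * |t| by positivity)
            nlinarith
          linarith
  choose S₀ hS₀ using hlim
  let S : ℝ → X →L[ℝ] X := fun t =>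
    continuousLinearMapOfTendsto (fun n => E n t) (tendsto_pi_nhds.2 (hS₀ t))
  have hS : ∀ t x, Tendsto (fun n => E n t x) atTop (𝓝 (S t x)) := hS₀
  have hSnorm : ∀ t x, ‖S t x‖ = ‖x‖ := by
    intro t x
    have := (hS t x).norm
    simp only [hEnorm] at this
    exact (tendsto_nhds_unique this tendsto_const_nhds)
  have hSdiff : ∀ n t z, ‖S t (K (K z)) - E n t (K (K z))‖ ≤
      1 / ((n : ℝ) + 1) * ‖z‖ * |t| := by
    intro n t z
    have h1 : Tendsto (fun m => ‖E m t (K (K z)) - E n t (K (K z))‖) atTop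
        (𝓝 ‖S t (K (K z)) - E n t (K (K z))‖) := ((hS t _).sub_const _).norm
    have h2 : Tendsto (fun m : ℕ => (1 / ((m : ℝ) + 1) + 1 / ((n : ℝ) + 1)) * ‖z‖ * |t|) atTop
        (𝓝 ((0 + 1 / ((n : ℝ) + 1)) * ‖z‖ * |t|)) :=
      ((hδlim.add_const _).mul_const _).mul_const _
    have := le_of_tendsto_of_tendsto' h1 h2 fun m => hEdiff m n t z
    simpa using this
  have hEcont : ∀ n x, Continuous fun t => E n t x := fun n x =>
    continuous_iff_continuousAt.2 fun t => (hasDerivAt_exp_smul_apply (L n) x t).continuousAt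
  have hScont' : ∀ z, Continuous fun t => S t (K (K z)) := by
    intro z
    have : TendstoLocallyUniformly (fun n t => E n t (K (K z))) (fun t => S t (K (K z))) atTop := by
      rw [Metric.tendstoLocallyUniformly_iff]
      intro ε hε t
      refine ⟨Metric.ball t 1, Metric.ball_mem_nhds t one_pos, ?_⟩
      have hlim0 : Tendsto (fun n : ℕ => (1 / ((n : ℝ) + 1)) * (‖z‖ * (|t| + 1))) atTop (𝓝 0) := by
        simpa using hδlim.mul_const (‖z‖ * (|t| + 1))
      filter_upwards [hlim0.eventually (gt_mem_nhds hε)] with n hn s hs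
      rw [dist_eq_norm]
      refine (hSdiff n s z).trans_lt (lt_of_le_of_lt ?_ hn)
      rw [mul_assoc]
      have : |s| ≤ |t| + 1 := by
        have h1 : |s - t| < 1 := hs
        have := abs_sub_abs_le_abs_sub s t
        linarith
      gcongr
    exact this.continuous (Eventually.of_forall fun n => hEcont n _).frequently
  have hScont : ∀ x, Continuous fun t => S t x := by
    intro x
    rw [Metric.continuous_iff]
    intro t ε hε
    obtain ⟨z, hz⟩ := hdense.exists_dist_lt x (show 0 < ε / 3 by positivity)
    obtain ⟨η, hη, h⟩ := Metric.continuous_iff.1 (hScont' z) t (ε / 3) (by positivity)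
    refine ⟨η, hη, fun s hs => ?_⟩
    have h1 : ∀ r, dist (S r x) (S r (K (K z))) = dist x (K (K z)) := fun r => by
      rw [dist_eq_norm, ← map_sub, hSnorm, dist_eq_norm]
    calc dist (S s x) (S t x) ≤ dist (S s x) (S s (K (K z)))
          + dist (S s (K (K z))) (S t (K (K z))) + dist (S t (K (K z))) (S t x) :=
          dist_triangle4 _ _ _ _
      _ < ε := by
          rw [dist_comm (S t (K (K z))), h1, h1]
          linarith [h s hs]
  have hSK : ∀ t x, S t (K x) = K (S t x) := by
    intro t x
    refine tendsto_nhds_unique (hS t (K x)) ?_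
    have h1 : ∀ n, E n t (K x) = K (E n t x) := fun n => by
      have : Commute K (E n t) := ((hLK n).smul_right t).exp_right
      exact (congrArg (fun B : X →L[ℝ] X => B x) this.eq).symm
    simp only [h1]
    exact (K.continuous.tendsto _).comp (hS t x)
  have hSinv : ∀ t x, S t (S (-t) x) = x := by
    intro t x
    have h1 : ∀ n, E n t (E n (-t) x) = x := fun n => by
      have : E n t * E n (-t) = 1 := by
        simp only [hE]
        rw [← NormedSpace.exp_add_of_commute]
        · simp
        · exact ((Commute.refl (L n)).smul_left _).smul_right _
      simpa using congrArg (fun B : X →L[ℝ] X => B x) this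
    have h2 : Tendsto (fun n => E n t (S (-t) x) - E n t (E n (-t) x)) atTop (𝓝 0) := by
      rw [tendsto_zero_iff_norm_tendsto_zero]
      simp only [hEsub]
      have := ((hS (-t) x).const_sub (S (-t) x)).norm
      simpa using this
    have h3 := (hS t (S (-t) x)).sub h2
    simp only [sub_zero, sub_sub_cancel, h1] at h3
    exact (tendsto_nhds_unique h3 tendsto_const_nhds)
  have hS0 : ∀ x, S 0 x = x := by
    intro x
    refine tendsto_nhds_unique (hS 0 x) ?_
    simp [hE]
  -- On vectors `K (K z)` the approximate generators converge, `L n (K (K z)) → K z`, so the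
  -- fundamental theorem of calculus for `E n` passes to the limit by dominated convergence.
  have hint' : ∀ t z, ∫ s in (0 : ℝ)..t, S s (K z) = S t (K (K z)) - K (K z) := by
    intro t z
    have h1 : ∀ n, ∫ s in (0 : ℝ)..t, E n s (L n (K (K z))) = E n t (K (K z)) - K (K z) := by
      intro n
      rw [intervalIntegral.integral_eq_sub_of_hasDerivAt
        (fun s _ => hasDerivAt_exp_smul_apply (L n) (K (K z)) s)
        ((hEcont n _).intervalIntegrable _ _)]
      simp [hE]
    have h2 : Tendsto (fun n => ∫ s in (0 : ℝ)..t, E n s (L n (K (K z)))) atTop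
        (𝓝 (∫ s in (0 : ℝ)..t, S s (K z))) := by
      refine intervalIntegral.tendsto_integral_filter_of_dominated_convergence
        (fun _ => ‖K z‖ + ‖z‖) ?_ ?_ ?_ ?_
      · exact Eventually.of_forall fun n => (hEcont n _).aestronglyMeasurable
      · refine Eventually.of_forall fun n => ae_of_all _ fun s _ => ?_
        rw [hEnorm]
        have h3 := happrox n z
        have h4 : 1 / ((n : ℝ) + 1) ≤ 1 := by
          rw [div_le_one (by positivity)]; linarith [(Nat.cast_nonneg n : (0 : ℝ) ≤ n)]
        have h5 := norm_add_le (K z) (L n (K (K z)) - K z)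
        rw [add_sub_cancel] at h5
        nlinarith [norm_nonneg z]
      · exact intervalIntegrable_const
      · refine ae_of_all _ fun s _ => ?_
        have h3 : Tendsto (fun n => E n s (L n (K (K z))) - E n s (K z)) atTop (𝓝 0) := by
          rw [tendsto_zero_iff_norm_tendsto_zero]
          simp only [hEsub]
          refine squeeze_zero (fun _ => norm_nonneg _) (fun n => happrox n z) ?_
          simpa using hδlim.mul_const ‖z‖
        simpa using h3.add (hS s (K z))
    simp only [h1] at h2
    exact tendsto_nhds_unique h2 ((hS t _).sub_const _)
  -- Both sides are continuous in `x`, so density of the range of `K` extends the integral identity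
  -- to all vectors. Differentiating it in `t` gives the last claim.
  have hint : ∀ t x, ∫ s in (0 : ℝ)..t, S s x = S t (K x) - K x := by
    intro t
    refine fun x => (denseRange_of_skew hK hinj).induction_on
      (p := fun x => ∫ s in (0 : ℝ)..t, S s x = S t (K x) - K x) x ?_ (hint' t)
    refine isClosed_eq ?_ (by fun_prop)
    refine (LipschitzWith.of_dist_le_mul (K := ⟨|t|, abs_nonneg t⟩) fun x y => ?_).continuous
    rw [dist_eq_norm, dist_eq_norm, ← intervalIntegral.integral_sub
      ((hScont x).intervalIntegrable _ _) ((hScont y).intervalIntegrable _ _)]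
    simp only [← map_sub]
    have := intervalIntegral.norm_integral_le_of_norm_le_const (a := 0) (b := t)
      (f := fun s => S s (x - y)) (C := ‖x - y‖) fun s _ => (hSnorm s _).le
    rw [sub_zero, mul_comm] at this
    exact this
  refine ⟨S, hSnorm, hSinv, hS0, hScont, hSK, fun t x => ?_⟩
  have h1 : (fun s => S s (K x)) = fun s => (∫ r in (0 : ℝ)..s, S r x) + K x := by
    funext s; rw [hint]; abel
  rw [h1]
  exact (intervalIntegral.integral_hasDerivAt_right ((hScont x).intervalIntegrable _ _)
    (hScont x).aestronglyMeasurable.stronglyMeasurableAtFilter (hScont x).continuousAt).add_const _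

end SkewGenerator
end Sloshing
end

noncomputable section
namespace Sloshing

/-! ### Global solutions of Lipschitz differential equations. -/

section GlobalODE

variable {E : Type*} [NormedAddCommGroup E] [NormedSpace ℝ E]

/-- Measured against the weight `exp (L t)`, integration in time gains a factor `1 / L` that does
not depend on the length of the interval. This makes the Picard map a contraction on the whole
half-line. -/
theorem exp_neg_mul_norm_integral_le {h : ℝ → E} {B L t : ℝ} (hB : 0 ≤ B) (hL : 0 < L)
    (ht : 0 ≤ t) (hh : ∀ s ∈ Ioc 0 t, ‖h s‖ ≤ B * Real.exp (L * s)) :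
    Real.exp (-(L * t)) * ‖∫ s in (0 : ℝ)..t, h s‖ ≤ B / L := by
  have h1 : ‖∫ s in (0 : ℝ)..t, h s‖ ≤ ∫ s in (0 : ℝ)..t, B * Real.exp (L * s) := by
    refine intervalIntegral.norm_integral_le_of_norm_le ht ?_ ?_
    · filter_upwards with s hs using hh s hs
    · exact (by fun_prop : Continuous fun s => B * Real.exp (L * s)).intervalIntegrable _ _
  have h2 : ∫ s in (0 : ℝ)..t, B * Real.exp (L * s) = B / L * (Real.exp (L * t) - 1) := by
    rw [intervalIntegral.integral_const_mul, intervalIntegral.integral_comp_mul_left (fun s => Real.exp s) hL.ne']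
    simp
    ring
  rw [h2] at h1
  calc Real.exp (-(L * t)) * ‖∫ s in (0 : ℝ)..t, h s‖
      ≤ Real.exp (-(L * t)) * (B / L * (Real.exp (L * t) - 1)) := by gcongr
    _ = B / L * (1 - Real.exp (-(L * t))) := by
      rw [Real.exp_neg]; field_simp
    _ ≤ B / L * 1 := by
      gcongr
      linarith [Real.exp_pos (-(L * t))]
    _ = B / L := mul_one _

/-- Global forward solvability of an ordinary differential equation with a uniformly Lipschitz
right-hand side. -/
theorem exists_forward_solution [CompleteSpace E] {G : ℝ → E → E} {C : ℝ≥0}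
    (hLip : ∀ t, LipschitzWith C (G t)) (hG : Continuous fun p : ℝ × E => G p.1 p.2)
    {M : ℝ} (hM : ∀ t, ‖G t 0‖ ≤ M) (x₀ : E) :
    ∃ α : ℝ → E, α 0 = x₀ ∧ ∀ t, 0 ≤ t → HasDerivAt α (G t (α t)) t := by
  have hM0 : 0 ≤ M := (norm_nonneg _).trans (hM 0)
  -- Any `L > C` would do: the contraction factor is `C / L`.
  set L : ℝ := C + 1 with hLdef
  have hL : 0 < L := by positivity
  have hint : ∀ Y : BoundedContinuousFunction ℝ E,
      Continuous fun s => G s (Real.exp (L * s) • Y s) := fun Y =>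
    hG.comp (continuous_id.prodMk (by fun_prop))
  have hbd : ∀ (Y : BoundedContinuousFunction ℝ E) (s : ℝ), 0 ≤ s →
      ‖G s (Real.exp (L * s) • Y s)‖ ≤ (M + C * ‖Y‖) * Real.exp (L * s) := by
    intro Y s hs
    have h1 := (hLip s).dist_le_mul (Real.exp (L * s) • Y s) 0
    rw [dist_zero_right, norm_smul, Real.norm_of_nonneg (Real.exp_pos _).le, dist_eq_norm] at h1
    have h2 : 1 ≤ Real.exp (L * s) := Real.one_le_exp (by positivity)
    have h3 : ‖G s (Real.exp (L * s) • Y s)‖ ≤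
        ‖G s (Real.exp (L * s) • Y s) - G s 0‖ + ‖G s 0‖ := by
      simpa using norm_add_le (G s (Real.exp (L * s) • Y s) - G s 0) (G s 0)
    have h4 : (C : ℝ) * (Real.exp (L * s) * ‖Y s‖) ≤ C * (Real.exp (L * s) * ‖Y‖) := by
      gcongr
      exact Y.norm_coe_le_norm s
    nlinarith [hM s]
  -- The unknown is `Y t = exp (-L t) • α t`, so that the Picard map acts on bounded functions.
  -- Replacing `t` by `max t 0` freezes the values for negative times and keeps the complete space
  -- of bounded continuous functions on `ℝ`.
  let Φ₀ : BoundedContinuousFunction ℝ E → ℝ → E := fun Y t =>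
    Real.exp (-(L * max t 0)) • (x₀ + ∫ s in (0 : ℝ)..max t 0, G s (Real.exp (L * s) • Y s))
  have hΦc : ∀ Y, Continuous (Φ₀ Y) := by
    intro Y
    have : Continuous fun t : ℝ => ∫ s in (0 : ℝ)..t, G s (Real.exp (L * s) • Y s) :=
      intervalIntegral.continuous_primitive (fun a b => (hint Y).intervalIntegrable a b) 0
    have h2 : Continuous fun t : ℝ => max t 0 := by fun_prop
    have h3 := this.comp h2
    simp only [Function.comp_def] at h3
    exact (by fun_prop : Continuous fun t : ℝ => Real.exp (-(L * max t 0))).smul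
      (continuous_const.add h3)
  have hΦb : ∀ Y t, ‖Φ₀ Y t‖ ≤ ‖x₀‖ + (M + C * ‖Y‖) / L := by
    intro Y t
    have h1 := exp_neg_mul_norm_integral_le (B := M + C * ‖Y‖)
      (add_nonneg hM0 (mul_nonneg C.2 (norm_nonneg Y))) hL (le_max_right t 0)
      (fun s hs => hbd Y s hs.1.le)
    simp only [Φ₀, norm_smul, Real.norm_of_nonneg (Real.exp_pos _).le]
    have h2 : Real.exp (-(L * max t 0)) ≤ 1 :=
      Real.exp_le_one_iff.2 (neg_nonpos.2 (mul_nonneg hL.le (le_max_right _ _)))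
    calc _ ≤ Real.exp (-(L * max t 0)) * (‖x₀‖ + ‖∫ s in (0 : ℝ)..max t 0,
          G s (Real.exp (L * s) • Y s)‖) := by gcongr; exact norm_add_le _ _
      _ ≤ _ := by
        rw [mul_add]
        gcongr
        exact mul_le_of_le_one_left (norm_nonneg _) h2
  let Φ : BoundedContinuousFunction ℝ E → BoundedContinuousFunction ℝ E := fun Y =>
    BoundedContinuousFunction.ofNormedAddCommGroup (Φ₀ Y) (hΦc Y) _ (hΦb Y)
  have hcontr : ContractingWith (⟨C / L, by positivity⟩ : ℝ≥0) Φ := by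
    refine ⟨?_, LipschitzWith.of_dist_le_mul fun Y Z => ?_⟩
    · change (C : ℝ) / L < 1
      rw [div_lt_one hL, hLdef]; linarith
    · change dist (Φ Y) (Φ Z) ≤ C / L * dist Y Z
      rw [BoundedContinuousFunction.dist_le (by positivity)]
      intro t
      change dist (Φ₀ Y t) (Φ₀ Z t) ≤ C / L * dist Y Z
      rw [dist_eq_norm]
      simp only [Φ₀]
      rw [← smul_sub, add_sub_add_left_eq_sub, ← intervalIntegral.integral_sub
        ((hint Y).intervalIntegrable _ _) ((hint Z).intervalIntegrable _ _), norm_smul,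
        Real.norm_of_nonneg (Real.exp_pos _).le, div_mul_eq_mul_div]
      refine exp_neg_mul_norm_integral_le (by positivity) hL (le_max_right t 0) fun s _ => ?_
      rw [← dist_eq_norm]
      refine ((hLip s).dist_le_mul _ _).trans ?_
      rw [dist_eq_norm, ← smul_sub, norm_smul, Real.norm_of_nonneg (Real.exp_pos _).le,
        ← dist_eq_norm, mul_assoc, mul_comm (dist Y Z)]
      gcongr
      exact BoundedContinuousFunction.dist_coe_le_dist s
  set Y := ContractingWith.fixedPoint Φ hcontr with hY
  have hfix : ∀ t, Φ₀ Y t = Y t := fun t => by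
    have : Φ Y = Y := hcontr.fixedPoint_isFixedPt
    exact congrArg (fun Z : BoundedContinuousFunction ℝ E => Z t) this
  set α : ℝ → E := fun t => x₀ + ∫ s in (0 : ℝ)..t, G s (Real.exp (L * s) • Y s) with hα
  have hαY : ∀ t, 0 ≤ t → Real.exp (L * t) • Y t = α t := by
    intro t ht
    rw [← hfix t]
    simp only [Φ₀, max_eq_left ht, smul_smul, ← Real.exp_add]
    simp [hα]
  refine ⟨α, by simp [hα], fun t ht => ?_⟩
  rw [← hαY t ht]
  exact (intervalIntegral.integral_hasDerivAt_right ((hint Y).intervalIntegrable _ _)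
    (hint Y).aestronglyMeasurable.stronglyMeasurableAtFilter (hint Y).continuousAt).const_add _

end GlobalODE

/-! ### Abstract semilinear wave equations by conjugation with the isometry group. -/

section SemilinearWave

open scoped InnerProductSpace

variable {V E : Type*} [NormedAddCommGroup V] [InnerProductSpace ℝ V] [CompleteSpace V]
  [NormedAddCommGroup E] [InnerProductSpace ℝ E] [CompleteSpace E]

/-- Product rule for a strongly continuous family acting on a differentiable curve. -/
theorem hasDerivWithinAt_family_apply {X : Type*} [NormedAddCommGroup X] [NormedSpace ℝ X]
    {S : ℝ → X →L[ℝ] X} (hS : ∀ t x, ‖S t x‖ ≤ ‖x‖)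
    (hcont : ∀ x, Continuous fun t => S t x) {Z : ℝ → X} {Z' y : X} {I : Set ℝ} {t : ℝ}
    (hZ : HasDerivWithinAt Z Z' I t) (hy : HasDerivAt (fun s => S s (Z t)) y t) :
    HasDerivWithinAt (fun s => S s (Z s)) (y + S t Z') I t := by
  rw [hasDerivWithinAt_iff_isLittleO] at hZ ⊢
  have h1 := (hasDerivWithinAt_iff_isLittleO.1 (hy.hasDerivWithinAt (s := I)))
  -- The differentiability remainder of `Z` stays `o(s - t)` under the uniformly bounded `S s`;
  -- strong continuity is then needed only at the fixed vector `Z'`.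
  have h2 : (fun s => S s (Z s - Z t - (s - t) • Z')) =o[𝓝[I] t] fun s => s - t :=
    (Asymptotics.IsBigO.of_norm_le fun s => hS s _).trans_isLittleO hZ.norm_left
  have h3 : (fun s => (s - t) • (S s Z' - S t Z')) =o[𝓝[I] t] fun s => s - t := by
    have h4 : (fun s => S s Z' - S t Z') =o[𝓝[I] t] fun _ => (1 : ℝ) := by
      rw [Asymptotics.isLittleO_one_iff]
      have := ((hcont Z').tendsto t).sub_const (S t Z')
      rw [sub_self] at this
      exact this.mono_left nhdsWithin_le_nhds
    simpa using (Asymptotics.isBigO_refl (fun s => s - t) (𝓝[I] t)).smul_isLittleO h4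
  refine ((h1.add h2).add h3).congr_left fun s => ?_
  simp only [map_sub, map_smul, smul_sub, smul_add]
  abel

section Group

variable {X : Type*} [NormedAddCommGroup X] [InnerProductSpace ℝ X] {K : X →L[ℝ] X}
  {S : ℝ → X →L[ℝ] X} {F : X → X} {C : ℝ≥0}

/-- Since `‖S s (y - x)‖ = ‖y - x‖` for every `s`, strong continuity in time upgrades to joint
continuity. -/
theorem continuous_uncurry_isometry_family (hnorm : ∀ t x, ‖S t x‖ = ‖x‖)
    (hcont : ∀ x, Continuous fun t => S t x) : Continuous fun p : ℝ × X => S p.1 p.2 := by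
  rw [continuous_iff_continuousAt]
  rintro ⟨t, x⟩
  have h1 : Tendsto (fun p : ℝ × X => S p.1 (p.2 - x)) (𝓝 (t, x)) (𝓝 0) := by
    rw [tendsto_zero_iff_norm_tendsto_zero]
    simp only [hnorm]
    have : Continuous fun p : ℝ × X => ‖p.2 - x‖ := by fun_prop
    simpa using this.tendsto (t, x)
  have h2 : Tendsto (fun p : ℝ × X => S p.1 x) (𝓝 (t, x)) (𝓝 (S t x)) :=
    ((hcont x).comp continuous_fst).tendsto (t, x)
  simpa [ContinuousAt] using h1.add h2

theorem lipschitzWith_conj (hnorm : ∀ t x, ‖S t x‖ = ‖x‖) (hF : LipschitzWith C F) (t : ℝ) :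
    LipschitzWith C fun x => S (-t) (F (S t x)) := by
  have h : ∀ r, LipschitzWith 1 (S r) := fun r =>
    LipschitzWith.of_dist_le_mul fun x y => by
      rw [dist_eq_norm, ← map_sub, hnorm, dist_eq_norm]; simp
  have := (h (-t)).comp (hF.comp (h t))
  rw [one_mul, mul_one] at this
  exact this

theorem continuous_uncurry_conj (hnorm : ∀ t x, ‖S t x‖ = ‖x‖)
    (hcont : ∀ x, Continuous fun t => S t x) (hF : LipschitzWith C F) :
    Continuous fun p : ℝ × X => S (-p.1) (F (S p.1 p.2)) := by
  have h := continuous_uncurry_isometry_family hnorm hcont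
  exact h.comp ((continuous_fst.neg).prodMk (hF.continuous.comp h))

variable [CompleteSpace X]

/-- Forward solvability of `U' = K⁻¹ U + F(U)` for bounded injective skew-adjoint `K`, with the
equation multiplied by `K`. -/
theorem exists_semilinear_solution (hK : ∀ x y, ⟪K x, y⟫_ℝ = -⟪x, K y⟫_ℝ)
    (hinj : Function.Injective K) (hF : LipschitzWith C F) (U₀ : X) :
    ∃ U : ℝ → X, U 0 = U₀ ∧ ContinuousOn U (Ici 0) ∧
      ∀ t, 0 ≤ t → HasDerivAt (fun s => K (U s)) (U t + K (F (U t))) t := by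
  obtain ⟨S, hnorm, hinv, hzero, hcont, hcomm, hderiv⟩ := exists_isometry_group hK hinj
  -- Variation of constants: for `U = S t (α t)` the generator drops out and `α' = S (-t) (F (S t
  -- α))` remains.
  obtain ⟨α, hα0, hα⟩ := exists_forward_solution (fun t => lipschitzWith_conj hnorm hF t)
    (continuous_uncurry_conj hnorm hcont hF) (M := ‖F 0‖) (fun t => by simp [hnorm]) U₀
  refine ⟨fun t => S t (α t), by simp [hα0, hzero], fun t ht => ?_, fun t ht => ?_⟩
  · have h1 : ContinuousAt (fun s : ℝ => (s, α s)) t :=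
      continuousAt_id.prodMk (hα t ht).continuousAt
    exact ((continuous_uncurry_isometry_family hnorm hcont).continuousAt.comp
      h1).continuousWithinAt
  · have h1 : HasDerivWithinAt (fun s => K (α s)) (K (S (-t) (F (S t (α t))))) univ t :=
      (K.hasFDerivAt.comp_hasDerivAt t (hα t ht)).hasDerivWithinAt
    -- The product rule is applied to `S t (K (α t))`, since `S` is known to be differentiable only
    -- on the range of `K`.
    have h2 := hasDerivWithinAt_family_apply (fun t x => (hnorm t x).le) hcont h1
      (hderiv t (α t))
    rw [hasDerivWithinAt_univ] at h2
    simpa only [hcomm, hinv] using h2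

/-- A solution is differentiable only after applying `K`, so `S (-t) (U t)` cannot be differentiated
directly. It is compared, through the injective `K`, with the primitive `P` of `S (-t) (F (U t))`.
The two agree, hence `P` solves a Lipschitz ODE, for which uniqueness is classical. -/
theorem eqOn_of_hasDerivWithinAt_semilinear (hK : ∀ x y, ⟪K x, y⟫_ℝ = -⟪x, K y⟫_ℝ)
    (hinj : Function.Injective K) (hF : LipschitzWith C F) {T : ℝ} (hT : 0 ≤ T) {U₁ U₂ : ℝ → X}
    (hc₁ : ContinuousOn U₁ (Icc 0 T)) (hc₂ : ContinuousOn U₂ (Icc 0 T))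
    (h₁ : ∀ t ∈ Icc 0 T,
      HasDerivWithinAt (fun s => K (U₁ s)) (U₁ t + K (F (U₁ t))) (Icc 0 T) t)
    (h₂ : ∀ t ∈ Icc 0 T,
      HasDerivWithinAt (fun s => K (U₂ s)) (U₂ t + K (F (U₂ t))) (Icc 0 T) t)
    (h₀ : U₁ 0 = U₂ 0) : EqOn U₁ U₂ (Icc 0 T) := by
  obtain ⟨S, hnorm, hinv, hzero, hcont, hcomm, hderiv⟩ := exists_isometry_group hK hinj
  have hinv' : ∀ t x, S (-t) (S t x) = x := fun t x => by simpa using hinv (-t) x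
  have key : ∀ U : ℝ → X, ContinuousOn U (Icc 0 T) →
      (∀ t ∈ Icc 0 T, HasDerivWithinAt (fun s => K (U s)) (U t + K (F (U t))) (Icc 0 T) t) →
      ∃ P : ℝ → X, P 0 = U 0 ∧ (∀ t ∈ Icc 0 T, S (-t) (U t) = P t) ∧
        ∀ t ∈ Icc 0 T, HasDerivAt P (S (-t) (F (S t (P t)))) t := by
    intro U hc hU
    -- Projection onto `[0, T]` extends the integrand continuously to `ℝ`, so that `P` is
    -- differentiable everywhere, end points included.
    set g : ℝ → X := fun s => S (-(projIcc 0 T hT s : ℝ)) (F (U (projIcc 0 T hT s))) with hg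
    have hproj : Continuous fun s => (projIcc 0 T hT s : ℝ) :=
      continuous_subtype_val.comp continuous_projIcc
    have hUproj : Continuous fun s => U (projIcc 0 T hT s) :=
      hc.comp_continuous hproj fun s => (projIcc 0 T hT s).2
    have hgc : Continuous g := (continuous_uncurry_isometry_family hnorm hcont).comp
      (hproj.neg.prodMk (hF.continuous.comp hUproj))
    have hgt : ∀ t ∈ Icc 0 T, g t = S (-t) (F (U t)) := fun t ht => by
      simp only [hg, projIcc_of_mem hT ht]
    set P : ℝ → X := fun t => U 0 + ∫ s in (0 : ℝ)..t, g s with hP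
    have hPd : ∀ t, HasDerivAt P (g t) t := fun t =>
      (intervalIntegral.integral_hasDerivAt_right (hgc.intervalIntegrable _ _)
        hgc.aestronglyMeasurable.stronglyMeasurableAtFilter hgc.continuousAt).const_add _
    -- The generator term `-S (-t) (U t)` cancels the `U t` in the equation, and what is left is the
    -- derivative of `K (P t)`.
    have hder : ∀ t ∈ Icc 0 T,
        HasDerivWithinAt (fun s => S (-s) (K (U s)) - K (P s)) 0 (Icc 0 T) t := by
      intro t ht
      have h1 : HasDerivAt (fun s => S (-s) (K (U t))) (-S (-t) (U t)) t := by
        have := (hderiv (-t) (U t)).scomp t (hasDerivAt_neg t)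
        rwa [neg_one_smul] at this
      have h2 := hasDerivWithinAt_family_apply (S := fun s => S (-s))
        (fun t x => (hnorm (-t) x).le) (fun x => (hcont x).comp continuous_neg) (hU t ht) h1
      have h3 := (K.hasFDerivAt.comp_hasDerivAt t (hPd t)).hasDerivWithinAt (s := Icc 0 T)
      convert! h2.sub h3 using 1
      rw [hgt t ht, map_add, hcomm]
      abel
    have hPU : ∀ t ∈ Icc 0 T, S (-t) (U t) = P t := by
      intro t ht
      have h1 := (convex_Icc 0 T).norm_image_sub_le_of_norm_hasDerivWithin_le hder (C := 0)
        (by simp) (left_mem_Icc.2 hT) ht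
      have h2 : S (-0) (K (U 0)) - K (P 0) = 0 := by simp [hP, hzero]
      rw [h2, zero_mul, sub_zero, norm_le_zero_iff, sub_eq_zero, hcomm] at h1
      exact hinj h1
    refine ⟨P, by simp [hP], hPU, fun t ht => ?_⟩
    have := hPd t
    rwa [hgt t ht, ← hinv t (U t), hPU t ht] at this
  obtain ⟨P₁, hP₁0, hP₁U, hP₁⟩ := key U₁ hc₁ h₁
  obtain ⟨P₂, hP₂0, hP₂U, hP₂⟩ := key U₂ hc₂ h₂
  have huniq : EqOn P₁ P₂ (Icc 0 T) :=
    ODE_solution_unique (v := fun t x => S (-t) (F (S t x)))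
      (fun t => lipschitzWith_conj hnorm hF t)
      (fun t ht => (hP₁ t ht).continuousAt.continuousWithinAt)
      (fun t ht => (hP₁ t (Ico_subset_Icc_self ht)).hasDerivWithinAt)
      (fun t ht => (hP₂ t ht).continuousAt.continuousWithinAt)
      (fun t ht => (hP₂ t (Ico_subset_Icc_self ht)).hasDerivWithinAt)
      (by rw [hP₁0, hP₂0, h₀])
  intro t ht
  rw [← hinv t (U₁ t), ← hinv t (U₂ t), hP₁U t ht, hP₂U t ht, huniq ht]

end Group

/-- The inverse of the wave generator `(u, v) ↦ (v, -A u)`, where `A` is the operator of the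
inner product of `V` with respect to the pivot space `E`. -/
def waveInv (ι : V →L[ℝ] E) : WithLp 2 (V × E) →L[ℝ] WithLp 2 (V × E) :=
  (WithLp.prodContinuousLinearEquiv 2 ℝ V E).symm.toContinuousLinearMap ∘L
    (((-(ContinuousLinearMap.adjoint ι)) ∘L ContinuousLinearMap.snd ℝ V E).prod
      (ι ∘L ContinuousLinearMap.fst ℝ V E)) ∘L
    (WithLp.prodContinuousLinearEquiv 2 ℝ V E).toContinuousLinearMap

theorem waveInv_fst (ι : V →L[ℝ] E) (U : WithLp 2 (V × E)) :
    (waveInv ι U).fst = -(ContinuousLinearMap.adjoint ι U.snd) := rfl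

theorem waveInv_snd (ι : V →L[ℝ] E) (U : WithLp 2 (V × E)) : (waveInv ι U).snd = ι U.fst := rfl

/-- The off-diagonal entries `-ι*` and `ι` are negative adjoints of each other. -/
theorem waveInv_skew (ι : V →L[ℝ] E) (x y : WithLp 2 (V × E)) :
    ⟪waveInv ι x, y⟫_ℝ = -⟪x, waveInv ι y⟫_ℝ := by
  rw [WithLp.prod_inner_apply, WithLp.prod_inner_apply]
  simp only [waveInv_fst, waveInv_snd, WithLp.ofLp_fst, WithLp.ofLp_snd]
  simp [ContinuousLinearMap.adjoint_inner_left, ContinuousLinearMap.adjoint_inner_right]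

theorem waveInv_injective {ι : V →L[ℝ] E} (hι : Function.Injective ι)
    (hι' : Function.Injective (ContinuousLinearMap.adjoint ι)) :
    Function.Injective (waveInv ι) := by
  rw [injective_iff_map_eq_zero]
  intro U hU
  have h1 : U.snd = 0 := hι' (by
    have := congrArg WithLp.fst hU
    rw [waveInv_fst] at this
    simpa using this)
  have h2 : U.fst = 0 := hι (by
    have := congrArg WithLp.snd hU
    rw [waveInv_snd] at this
    simpa using this)
  exact WithLp.ofLp_injective 2 (Prod.ext h2 h1)

omit [CompleteSpace V] [CompleteSpace E] in
theorem hasDerivWithinAt_toLp_iff {u : ℝ → V} {v : ℝ → E} {u' : V} {v' : E} {I : Set ℝ} {t : ℝ} :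
    HasDerivWithinAt (fun s => WithLp.toLp 2 (u s, v s)) (WithLp.toLp 2 (u', v')) I t ↔
      HasDerivWithinAt u u' I t ∧ HasDerivWithinAt v v' I t := by
  constructor
  · intro h
    have := (WithLp.prodContinuousLinearEquiv 2 ℝ V E).hasFDerivAt.comp_hasDerivWithinAt t h
    exact ⟨(ContinuousLinearMap.fst ℝ V E).hasFDerivAt.comp_hasDerivWithinAt t this,
      (ContinuousLinearMap.snd ℝ V E).hasFDerivAt.comp_hasDerivWithinAt t this⟩
  · rintro ⟨h1, h2⟩
    exact (WithLp.prodContinuousLinearEquiv 2 ℝ V E).symm.hasFDerivAt.comp_hasDerivWithinAt t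
      (h1.prodMk h2)

omit [CompleteSpace V] [CompleteSpace E] in
theorem lipschitzWith_wave_source (ι : V →L[ℝ] E) {F : E → E} {C : ℝ≥0} (hF : LipschitzWith C F) :
    ∃ C' : ℝ≥0, LipschitzWith C'
      fun U : WithLp 2 (V × E) => WithLp.toLp 2 ((0 : V), F (ι U.fst)) := by
  have h1 : LipschitzWith _ fun U : WithLp 2 (V × E) => ι U.fst :=
    (ι ∘L ContinuousLinearMap.fst ℝ V E ∘L
      (WithLp.prodContinuousLinearEquiv 2 ℝ V E).toContinuousLinearMap).lipschitz
  have h2 : LipschitzWith _ fun v : E => WithLp.toLp 2 ((0 : V), v) :=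
    ((WithLp.prodContinuousLinearEquiv 2 ℝ V E).symm.toContinuousLinearMap ∘L
      ContinuousLinearMap.inr ℝ V E).lipschitz
  exact ⟨_, h2.comp (hF.comp h1)⟩

/-- The abstract semilinear wave equation: existence on `[0, ∞)`. -/
theorem exists_wave_solution {ι : V →L[ℝ] E} (hι : Function.Injective ι)
    (hι' : Function.Injective (ContinuousLinearMap.adjoint ι)) {F : E → E} {C : ℝ≥0}
    (hF : LipschitzWith C F) (u₀ : V) (v₀ : E) :
    ∃ (u : ℝ → V) (v : ℝ → E), u 0 = u₀ ∧ v 0 = v₀ ∧ ContinuousOn u (Ici 0) ∧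
      ContinuousOn v (Ici 0) ∧ ∀ t, 0 ≤ t → HasDerivAt (fun s => ι (u s)) (v t) t ∧
        HasDerivAt (fun s => ContinuousLinearMap.adjoint ι (v s))
          (-u t + ContinuousLinearMap.adjoint ι (F (ι (u t)))) t := by
  obtain ⟨C', hC'⟩ := lipschitzWith_wave_source ι hF
  obtain ⟨U, hU0, hUc, hU⟩ := exists_semilinear_solution (waveInv_skew ι)
    (waveInv_injective hι hι') hC' (WithLp.toLp 2 (u₀, v₀))
  have hUc' := (WithLp.prodContinuousLinearEquiv 2 ℝ V E).continuous.comp_continuousOn hUc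
  refine ⟨fun t => (U t).fst, fun t => (U t).snd, by simp [hU0], by simp [hU0],
    continuous_fst.comp_continuousOn hUc', continuous_snd.comp_continuousOn hUc', fun t ht => ?_⟩
  have h1 := (hU t ht).hasDerivWithinAt (s := univ)
  have h2 : HasDerivWithinAt
      (fun s => WithLp.toLp 2 (-(ContinuousLinearMap.adjoint ι (U s).snd), ι (U s).fst))
      (WithLp.toLp 2 ((U t).fst + -(ContinuousLinearMap.adjoint ι (F (ι (U t).fst))),
        (U t).snd + ι 0)) univ t := h1
  rw [hasDerivWithinAt_toLp_iff, hasDerivWithinAt_univ, hasDerivWithinAt_univ] at h2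
  refine ⟨by simpa using h2.2, ?_⟩
  convert! h2.1.neg using 1
  · funext s; simp
  · abel

/-- The abstract semilinear wave equation: uniqueness on `[0, T]`. -/
theorem wave_solution_unique {ι : V →L[ℝ] E} (hι : Function.Injective ι)
    (hι' : Function.Injective (ContinuousLinearMap.adjoint ι)) {F : E → E} {C : ℝ≥0}
    (hF : LipschitzWith C F) {T : ℝ} (hT : 0 ≤ T) {u₁ u₂ : ℝ → V} {v₁ v₂ : ℝ → E}
    (hu₁ : ContinuousOn u₁ (Icc 0 T)) (hu₂ : ContinuousOn u₂ (Icc 0 T))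
    (hv₁ : ContinuousOn v₁ (Icc 0 T)) (hv₂ : ContinuousOn v₂ (Icc 0 T))
    (h₁ : ∀ t ∈ Icc 0 T, HasDerivWithinAt (fun s => ι (u₁ s)) (v₁ t) (Icc 0 T) t)
    (h₂ : ∀ t ∈ Icc 0 T, HasDerivWithinAt (fun s => ι (u₂ s)) (v₂ t) (Icc 0 T) t)
    (h₁' : ∀ t ∈ Icc 0 T, HasDerivWithinAt (fun s => ContinuousLinearMap.adjoint ι (v₁ s))
      (-u₁ t + ContinuousLinearMap.adjoint ι (F (ι (u₁ t)))) (Icc 0 T) t)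
    (h₂' : ∀ t ∈ Icc 0 T, HasDerivWithinAt (fun s => ContinuousLinearMap.adjoint ι (v₂ s))
      (-u₂ t + ContinuousLinearMap.adjoint ι (F (ι (u₂ t)))) (Icc 0 T) t)
    (hu : u₁ 0 = u₂ 0) (hv : v₁ 0 = v₂ 0) : EqOn u₁ u₂ (Icc 0 T) ∧ EqOn v₁ v₂ (Icc 0 T) := by
  obtain ⟨C', hC'⟩ := lipschitzWith_wave_source ι hF
  have key : ∀ (u : ℝ → V) (v : ℝ → E),
      (∀ t ∈ Icc 0 T, HasDerivWithinAt (fun s => ι (u s)) (v t) (Icc 0 T) t) →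
      (∀ t ∈ Icc 0 T, HasDerivWithinAt (fun s => ContinuousLinearMap.adjoint ι (v s))
        (-u t + ContinuousLinearMap.adjoint ι (F (ι (u t)))) (Icc 0 T) t) →
      ∀ t ∈ Icc 0 T, HasDerivWithinAt (fun s => waveInv ι (WithLp.toLp 2 (u s, v s)))
        (WithLp.toLp 2 (u t, v t) + waveInv ι (WithLp.toLp 2 ((0 : V), F (ι (u t)))))
        (Icc 0 T) t := by
    intro u v h h' t ht
    have h3 : HasDerivWithinAt
        (fun s => WithLp.toLp 2 (-(ContinuousLinearMap.adjoint ι (v s)), ι (u s)))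
        (WithLp.toLp 2 (u t + -(ContinuousLinearMap.adjoint ι (F (ι (u t)))), v t + ι 0))
        (Icc 0 T) t := by
      rw [hasDerivWithinAt_toLp_iff]
      refine ⟨?_, by simpa using h t ht⟩
      convert! (h' t ht).neg using 1
      abel
    exact h3
  have hcont : ∀ (u : ℝ → V) (v : ℝ → E), ContinuousOn u (Icc 0 T) → ContinuousOn v (Icc 0 T) →
      ContinuousOn (fun s => WithLp.toLp 2 (u s, v s)) (Icc 0 T) := fun u v hu hv =>
    (WithLp.prodContinuousLinearEquiv 2 ℝ V E).symm.continuous.comp_continuousOn (hu.prodMk hv)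
  have := eqOn_of_hasDerivWithinAt_semilinear (waveInv_skew ι) (waveInv_injective hι hι') hC' hT
    (hcont u₁ v₁ hu₁ hv₁) (hcont u₂ v₂ hu₂ hv₂) (key u₁ v₁ h₁ h₁') (key u₂ v₂ h₂ h₂')
    (by rw [hu, hv])
  exact ⟨fun t ht => congrArg WithLp.fst (this ht), fun t ht => congrArg WithLp.snd (this ht)⟩

end SemilinearWave
end Sloshing
end

noncomputable section
namespace Sloshing

/-! ### The finite Hilbert transform of the weight. -/

section TruncatedWeight

theorem abs_sqrt_sub_sqrt_le (a b : ℝ) : |√a - √b| ≤ √|a - b| := by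
  have h : ∀ a b : ℝ, √a - √b ≤ √|a - b| := by
    intro a b
    rw [sub_le_iff_le_add, Real.sqrt_le_left (by positivity)]
    have h1 := Real.sq_sqrt (abs_nonneg (a - b))
    have h2 : b ≤ √b ^ 2 := by
      rcases le_total 0 b with hb | hb
      · rw [Real.sq_sqrt hb]
      · exact hb.trans (sq_nonneg _)
    nlinarith [le_abs_self (a - b), Real.sqrt_nonneg |a - b|, Real.sqrt_nonneg b,
      mul_nonneg (Real.sqrt_nonneg |a - b|) (Real.sqrt_nonneg b)]
  rw [abs_le]
  constructor
  · have := h b a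
    rw [abs_sub_comm] at this
    linarith
  · exact h a b

theorem continuous_w : Continuous w := by unfold w; fun_prop

theorem w_nonneg (x : ℝ) : 0 ≤ w x := Real.sqrt_nonneg _

theorem w_pos {x : ℝ} (hx : x ∈ Ioo (-1 : ℝ) 1) : 0 < w x :=
  Real.sqrt_pos.2 (by nlinarith [hx.1, hx.2])

theorem w_sq {x : ℝ} (hx : x ∈ Icc (-1 : ℝ) 1) : w x ^ 2 = 1 - x ^ 2 :=
  Real.sq_sqrt (by nlinarith [hx.1, hx.2])

theorem w_le_one (x : ℝ) : w x ≤ 1 := by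
  unfold w
  rw [Real.sqrt_le_left zero_le_one]
  nlinarith [sq_nonneg x]

theorem w_eq_zero {x : ℝ} (hx : x ∉ Ioo (-1 : ℝ) 1) : w x = 0 := by
  refine Real.sqrt_eq_zero_of_nonpos ?_
  rw [mem_Ioo, not_and_or, not_lt, not_lt] at hx
  rcases hx with h | h <;> nlinarith

/-- The points of `(-1,1)` at distance greater than `ε` from `ξ`. -/
def truncSet (ε ξ : ℝ) : Set ℝ := {x | x ∈ Ioo (-1 : ℝ) 1 ∧ ε < |x - ξ|}

theorem measurableSet_truncSet (ε ξ : ℝ) : MeasurableSet (truncSet ε ξ) :=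
  measurableSet_Ioo.inter (measurableSet_lt measurable_const
    (by fun_prop : Measurable fun x : ℝ => |x - ξ|))

theorem integrable_abs_rpow_indicator :
    Integrable ((Ioo (-2 : ℝ) 2).indicator fun u => |u| ^ (-(1 / 2) : ℝ)) := by
  rw [integrable_indicator_iff measurableSet_Ioo]
  have h1 : IntegrableOn (fun u : ℝ => |u| ^ (-(1 / 2) : ℝ)) (Ioo 0 2) := by
    have := (intervalIntegral.intervalIntegrable_rpow' (a := 0) (b := 2)
      (r := (-(1 / 2) : ℝ)) (by norm_num))
    rw [intervalIntegrable_iff_integrableOn_Ioo_of_le (by norm_num)] at this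
    exact this.congr_fun (fun u hu => by simp only [abs_of_pos hu.1]) measurableSet_Ioo
  have h2 : IntegrableOn (fun u : ℝ => |u| ^ (-(1 / 2) : ℝ)) (Ioo (-2) 0) := by
    have := h1.comp_neg
    simpa using this
  have h3 : IntegrableOn (fun u : ℝ => |u| ^ (-(1 / 2) : ℝ)) (Ioo (-2) 2) := by
    have h4 : Ioo (-2 : ℝ) 2 ⊆ (Ioo (-2) 0 ∪ Ioo 0 2) ∪ {0} := by
      intro x hx
      rcases lt_trichotomy x 0 with h | h | h
      · exact Or.inl (Or.inl ⟨hx.1, h⟩)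
      · exact Or.inr h
      · exact Or.inl (Or.inr ⟨h, hx.2⟩)
    exact ((h2.union h1).union (integrableOn_singleton (hx := by simp))).mono_set h4
  exact h3

/-- The radicands differ by `4 ξ u` in absolute value and the square root is Hölder of exponent
`1/2`, which leaves an integrable singularity `|u| ^ (-1/2)`. The majorant does not depend on `ξ`.
-/
theorem abs_w_sub_w_div_le {ξ u : ℝ} (hξ : ξ ∈ Ioo (-1 : ℝ) 1) :
    |(w (ξ + u) - w (ξ - u)) / u| ≤
      2 * (Ioo (-2 : ℝ) 2).indicator (fun u => |u| ^ (-(1 / 2) : ℝ)) u := by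
  by_cases hu : u ∈ Ioo (-2 : ℝ) 2
  · rw [indicator_of_mem hu]
    rcases eq_or_ne u 0 with rfl | hu0
    · simp
    have h1 : |w (ξ + u) - w (ξ - u)| ≤ 2 * √|u| := by
      refine (abs_sqrt_sub_sqrt_le _ _).trans ?_
      have h2 : (1 - (ξ + u) ^ 2) - (1 - (ξ - u) ^ 2) = -(4 * ξ * u) := by ring
      rw [h2, abs_neg, Real.sqrt_le_left (by positivity), mul_pow, Real.sq_sqrt (abs_nonneg _),
        abs_mul, abs_mul]
      have h3 : |ξ| ≤ 1 := abs_le.2 ⟨hξ.1.le, hξ.2.le⟩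
      norm_num
      nlinarith [abs_nonneg u]
    have h4 : |u| ^ (-(1 / 2) : ℝ) = √|u| / |u| := by
      have h5 : 0 < |u| := abs_pos.2 hu0
      rw [Real.rpow_neg h5.le, ← Real.sqrt_eq_rpow, Real.sqrt_div_self']
      simp
    rw [abs_div, h4, ← mul_div_assoc]
    gcongr
  · rw [indicator_of_notMem hu]
    rw [mem_Ioo, not_and_or, not_lt, not_lt] at hu
    have h1 : w (ξ + u) = 0 := w_eq_zero fun h => by
      rcases hu with hu | hu <;> linarith [h.1, h.2, hξ.1, hξ.2]
    have h2 : w (ξ - u) = 0 := w_eq_zero fun h => by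
      rcases hu with hu | hu <;> linarith [h.1, h.2, hξ.1, hξ.2]
    simp [h1, h2]

theorem integrableOn_w_mul_div {ε : ℝ} (hε : 0 < ε) (ξ : ℝ) {g : ℝ → ℝ} {C : ℝ}
    (hg : Measurable g) (hC : ∀ x ∈ Ioo (-1 : ℝ) 1, |g x| ≤ C) :
    IntegrableOn (fun x => w x * g x / (x - ξ)) (truncSet ε ξ) := by
  have hsub : truncSet ε ξ ⊆ Ioo (-1) 1 := fun x hx => hx.1
  refine IntegrableOn.of_bound (C := C / ε) ?_ ?_ ?_
  · exact (measure_mono hsub).trans_lt (by simp)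
  · have := continuous_w.measurable
    exact (by fun_prop : Measurable fun x => w x * g x / (x - ξ)).aestronglyMeasurable
  · refine (ae_restrict_iff' (measurableSet_truncSet ε ξ)).2 (ae_of_all _ fun x hx => ?_)
    rw [Real.norm_eq_abs, abs_div, abs_mul, abs_of_nonneg (w_nonneg x)]
    have h1 := hC x hx.1
    have h2 := w_le_one x
    have h3 := w_nonneg x
    gcongr
    · exact (abs_nonneg _).trans h1
    · nlinarith [abs_nonneg (g x)]
    · exact hx.2.le

/-- The truncation is symmetric about `ξ`, so averaging over `u` and `-u` replaces the kernel `w /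
u` by `(w (ξ + u) - w (ξ - u)) / u`. Extending `w` by zero outside `(-1,1)` lets this cover points
near the end points too. -/
theorem exists_bound_truncated_weight : ∃ B : ℝ, ∀ ε > 0, ∀ ξ ∈ Ioo (-1 : ℝ) 1,
    |∫ x in truncSet ε ξ, w x / (x - ξ)| ≤ B := by
  set k : ℝ → ℝ := (Ioo (-2 : ℝ) 2).indicator (fun u => |u| ^ (-(1 / 2) : ℝ)) with hk
  refine ⟨∫ u, k u, fun ε hε ξ hξ => ?_⟩
  set h : ℝ → ℝ := fun u => (truncSet ε ξ).indicator (fun x => w x / (x - ξ)) (u + ξ) with hh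
  have h1 : ∫ x in truncSet ε ξ, w x / (x - ξ) = ∫ u, h u := by
    rw [← integral_indicator (measurableSet_truncSet ε ξ), hh, integral_add_right_eq_self]
  have hint : Integrable h := by
    have := (integrable_indicator_iff (measurableSet_truncSet ε ξ)).2
      (integrableOn_w_mul_div hε ξ (g := fun _ => 1) (C := 1) (by fun_prop) (by simp))
    simpa using this.comp_add_right ξ
  have h2 : ∫ u, h (-u) = ∫ u, h u := integral_neg_eq_self h volume
  have h3 : ∀ u, h u = if ε < |u| then w (ξ + u) / u else 0 := by
    intro u
    simp only [hh, indicator_apply, truncSet, mem_ofPred_eq, add_sub_cancel_right, add_comm ξ u]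
    by_cases hu : u + ξ ∈ Ioo (-1 : ℝ) 1
    · simp [hu]
    · simp [hu, w_eq_zero hu]
  have h4 : ∀ u, |h u + h (-u)| ≤ 2 * k u := by
    intro u
    rw [h3, h3, abs_neg]
    split_ifs with hu
    · refine le_trans (le_of_eq ?_) (abs_w_sub_w_div_le hξ)
      rw [← sub_eq_add_neg]
      congr 1
      rw [div_neg, sub_div]
      ring
    · simp only [add_zero, abs_zero]
      exact mul_nonneg two_pos.le (indicator_nonneg (fun _ _ => by positivity) _)
  have h5 : 2 * ∫ u, h u = ∫ u, (h u + h (-u)) := by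
    rw [integral_add hint hint.comp_neg, h2, two_mul]
  rw [h1]
  have h6 : |2 * ∫ u, h u| ≤ ∫ u, 2 * k u := by
    rw [h5]
    exact norm_integral_le_of_norm_le (integrable_abs_rpow_indicator.const_mul 2)
      (ae_of_all _ fun u => by rw [Real.norm_eq_abs]; exact h4 u)
  rw [integral_const_mul, abs_mul, abs_two] at h6
  linarith

theorem hasDerivAt_w {x : ℝ} (hx : x ∈ Ioo (-1 : ℝ) 1) : HasDerivAt w (-x / w x) x := by
  have h : HasDerivAt (fun x : ℝ => 1 - x ^ 2) (-(2 * x)) x := by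
    simpa using ((hasDerivAt_id x).pow 2).const_sub 1
  have := h.sqrt (by nlinarith [hx.1, hx.2])
  convert! this using 1
  have := w_pos hx
  unfold w at this ⊢
  field_simp

/-- Explicit antiderivative of `w x / (x - ξ)`. -/
def weightPrimitive (ξ x : ℝ) : ℝ :=
  w ξ * (Real.log (x - ξ) - Real.log (1 - x * ξ + w x * w ξ)) + w x - ξ * Real.arcsin x

theorem weightPrimitive_denom_pos {ξ x : ℝ} (hξ : ξ ∈ Ioo (-1 : ℝ) 1) (hx : x ∈ Icc (-1 : ℝ) 1) :
    0 < 1 - x * ξ + w x * w ξ := by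
  have h1 : x * ξ < 1 := by
    have h2 : |ξ| < 1 := abs_lt.2 hξ
    have h3 : |x| ≤ 1 := abs_le.2 hx
    have h4 : |x * ξ| < 1 := by
      rw [abs_mul]
      nlinarith [abs_nonneg x, abs_nonneg ξ]
    exact (le_abs_self _).trans_lt h4
  have := mul_nonneg (w_nonneg x) (w_nonneg ξ)
  linarith

theorem hasDerivAt_weightPrimitive {ξ x : ℝ} (hξ : ξ ∈ Ioo (-1 : ℝ) 1) (hx : x ∈ Ioo (-1 : ℝ) 1)
    (hne : x ≠ ξ) : HasDerivAt (weightPrimitive ξ) (w x / (x - ξ)) x := by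
  have hD := weightPrimitive_denom_pos hξ (Ioo_subset_Icc_self hx)
  have hne' : x - ξ ≠ 0 := sub_ne_zero.2 hne
  have h1 : HasDerivAt (fun x => Real.log (x - ξ)) (1 / (x - ξ)) x :=
    ((hasDerivAt_id x).sub_const ξ).log hne'
  have h2 : HasDerivAt (fun x => 1 - x * ξ + w x * w ξ) (-ξ + -x / w x * w ξ) x := by
    have := (((hasDerivAt_id x).mul_const ξ).const_sub 1).add ((hasDerivAt_w hx).mul_const (w ξ))
    rw [one_mul] at this
    exact this
  have h3 := h2.log hD.ne'
  have h4 : HasDerivAt Real.arcsin (1 / w x) x :=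
    Real.hasDerivAt_arcsin (by linarith [hx.1]) (by linarith [hx.2])
  have h5 := (((h1.sub h3).const_mul (w ξ)).add (hasDerivAt_w hx)).sub (h4.const_mul ξ)
  convert! h5 using 1
  have hwx := w_pos hx
  have hx2 := w_sq (Ioo_subset_Icc_self hx)
  have hξ2 := w_sq (Ioo_subset_Icc_self hξ)
  -- The two logarithmic derivatives combine into one fraction, by `w² = 1 - x²` at both points. The
  -- remaining identity is `(1 - ξ²) - (x + ξ)(x - ξ) = 1 - x²`.
  have key : w ξ * (1 / (x - ξ) - (-ξ + -x / w x * w ξ) / (1 - x * ξ + w x * w ξ)) =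
      w ξ ^ 2 / (w x * (x - ξ)) := by
    have h6 : 1 - x * ξ + w x * w ξ - (x - ξ) * (-ξ + -x / w x * w ξ) =
        w ξ / w x * (1 - x * ξ + w x * w ξ) := by
      field_simp
      linear_combination -w x * hξ2 + w ξ * hx2
    rw [div_sub_div _ _ hne' hD.ne', one_mul, h6]
    generalize 1 - x * ξ + w x * w ξ = D at hD
    field_simp
  rw [key]
  field_simp
  rw [hx2, hξ2]
  ring

theorem continuousOn_weightPrimitive {ξ : ℝ} (hξ : ξ ∈ Ioo (-1 : ℝ) 1) :
    ContinuousOn (weightPrimitive ξ) (Icc (-1) 1 \ {ξ}) := by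
  unfold weightPrimitive
  have := continuous_w
  refine ContinuousOn.sub (ContinuousOn.add (continuousOn_const.mul (ContinuousOn.sub ?_ ?_))
    this.continuousOn) (by fun_prop)
  · exact ContinuousOn.log (by fun_prop) fun x hx => sub_ne_zero.2 hx.2
  · exact ContinuousOn.log (by fun_prop) fun x hx => (weightPrimitive_denom_pos hξ hx.1).ne'

theorem integral_Ioo_weight {ξ a b : ℝ} (hξ : ξ ∈ Ioo (-1 : ℝ) 1) (hab : a ≤ b)
    (h : Icc a b ⊆ Icc (-1) 1 \ {ξ}) :
    IntegrableOn (fun x => w x / (x - ξ)) (Ioo a b) ∧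
    ∫ x in Ioo a b, w x / (x - ξ) = weightPrimitive ξ b - weightPrimitive ξ a := by
  have hc : ContinuousOn (fun x => w x / (x - ξ)) (Icc a b) :=
    continuous_w.continuousOn.div (by fun_prop) fun x hx => sub_ne_zero.2 (h hx).2
  refine ⟨hc.integrableOn_Icc.mono_set Ioo_subset_Icc_self, ?_⟩
  rw [← integral_Ioc_eq_integral_Ioo, ← intervalIntegral.integral_of_le hab]
  refine intervalIntegral.integral_eq_sub_of_hasDerivAt_of_le hab
    ((continuousOn_weightPrimitive hξ).mono h) (fun x hx => ?_)
    (ContinuousOn.intervalIntegrable (by rwa [uIcc_of_le hab]))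
  have h1 := h (Ioo_subset_Icc_self hx)
  have h2 := (h (left_mem_Icc.2 hab)).1.1
  have h3 := (h (right_mem_Icc.2 hab)).1.2
  exact hasDerivAt_weightPrimitive hξ ⟨h2.trans_lt hx.1, hx.2.trans_le h3⟩ h1.2

/-- With the explicit antiderivative, the singular terms `w ξ * log |x - ξ|` at `ξ - ε` and `ξ + ε`
are equal and cancel. The regular part is continuous at `ξ`, so only the end points contribute: the
logarithms cancel there, and the arcsine terms add up to `-π ξ`. -/
theorem tendsto_truncated_weight {ξ : ℝ} (hξ : ξ ∈ Ioo (-1 : ℝ) 1) :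
    Tendsto (fun ε => ∫ x in truncSet ε ξ, w x / (x - ξ)) (𝓝[>] 0) (𝓝 (-(Real.pi * ξ))) := by
  have hw1 : w 1 = 0 := w_eq_zero (by simp)
  have hw1' : w (-1) = 0 := w_eq_zero (by simp)
  have hone : weightPrimitive ξ 1 = -(ξ * (Real.pi / 2)) := by
    simp [weightPrimitive, hw1]
  have hone' : weightPrimitive ξ (-1) = ξ * (Real.pi / 2) := by
    have h2 : (-1 - ξ : ℝ) = -(1 + ξ) := by ring
    simp only [weightPrimitive, hw1', h2, Real.log_neg_eq_log, Real.arcsin_neg_one]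
    norm_num
  set r : ℝ → ℝ := fun x => -(w ξ * Real.log (1 - x * ξ + w x * w ξ)) + w x - ξ * Real.arcsin x
    with hr
  have hrc : ContinuousAt r ξ := by
    have hD := weightPrimitive_denom_pos hξ (Ioo_subset_Icc_self hξ)
    have := continuous_w
    have h2 : ContinuousAt (fun x => Real.log (1 - x * ξ + w x * w ξ)) ξ :=
      ContinuousAt.log (by fun_prop) hD.ne'
    have h3 : ContinuousAt (fun x => w x - ξ * Real.arcsin x) ξ := by fun_prop
    have := (((continuousAt_const (y := w ξ)).mul h2).neg).add h3
    simp only [hr, add_sub_assoc]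
    exact this
  have hlim : Tendsto (fun ε => (r (ξ - ε) - r (ξ + ε)) - Real.pi * ξ) (𝓝[>] 0)
      (𝓝 (-(Real.pi * ξ))) := by
    have h1 : Tendsto (fun ε : ℝ => ξ - ε) (𝓝[>] 0) (𝓝 ξ) := by
      have : Continuous fun ε : ℝ => ξ - ε := by fun_prop
      simpa using (this.tendsto 0).mono_left nhdsWithin_le_nhds
    have h2 : Tendsto (fun ε : ℝ => ξ + ε) (𝓝[>] 0) (𝓝 ξ) := by
      have : Continuous fun ε : ℝ => ξ + ε := by fun_prop
      simpa using (this.tendsto 0).mono_left nhdsWithin_le_nhds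
    simpa using ((hrc.tendsto.comp h1).sub (hrc.tendsto.comp h2)).sub_const (Real.pi * ξ)
  refine hlim.congr' ?_
  have hpos : 0 < min (1 - ξ) (1 + ξ) := lt_min (by linarith [hξ.2]) (by linarith [hξ.1])
  filter_upwards [Ioo_mem_nhdsGT hpos] with ε hε
  have he1 : ε < 1 - ξ := hε.2.trans_le (min_le_left _ _)
  have he2 : ε < 1 + ξ := hε.2.trans_le (min_le_right _ _)
  have he0 : 0 < ε := hε.1
  have hset : truncSet ε ξ = Ioo (-1) (ξ - ε) ∪ Ioo (ξ + ε) 1 := by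
    ext x
    simp only [truncSet, mem_ofPred_eq, mem_union, mem_Ioo, lt_abs]
    constructor
    · rintro ⟨⟨h1, h2⟩, h3 | h3⟩
      · right; constructor <;> linarith
      · left; constructor <;> linarith
    · rintro (⟨h1, h2⟩ | ⟨h1, h2⟩)
      · exact ⟨⟨h1, by linarith⟩, Or.inr (by linarith)⟩
      · exact ⟨⟨by linarith, h2⟩, Or.inl (by linarith)⟩
  obtain ⟨i1, e1⟩ := integral_Ioo_weight (a := -1) (b := ξ - ε) hξ (by linarith) fun x hx =>
    ⟨⟨hx.1, by linarith [hx.2]⟩, fun h => by rw [mem_singleton_iff] at h; linarith [hx.2]⟩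
  obtain ⟨i2, e2⟩ := integral_Ioo_weight (a := ξ + ε) (b := 1) hξ (by linarith) fun x hx =>
    ⟨⟨by linarith [hx.1], hx.2⟩, fun h => by rw [mem_singleton_iff] at h; linarith [hx.1]⟩
  rw [hset, setIntegral_union ?_ measurableSet_Ioo i1 i2, e1, e2, hone, hone']
  · simp only [weightPrimitive, hr, sub_sub_cancel_left, add_sub_cancel_left, Real.log_neg_eq_log]
    ring
  · rw [Set.disjoint_left]
    rintro x ⟨_, h1⟩ ⟨h2, _⟩
    linarith

end TruncatedWeight
end Sloshing
end

noncomputable section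
namespace Sloshing

/-! ### The principal value and the dual operator. -/

section DualOperator

/-- On `[-1,1]` the derivative of `χ` is bounded by `C₁` and Lipschitz with constant `C₂`. -/
structure DerivBound (χ : ℝ → ℝ) (C₁ C₂ : ℝ) : Prop where
  cont : Continuous (deriv χ)
  bound : ∀ x ∈ Icc (-1 : ℝ) 1, |deriv χ x| ≤ C₁
  lip : ∀ x ∈ Icc (-1 : ℝ) 1, ∀ y ∈ Icc (-1 : ℝ) 1, |deriv χ x - deriv χ y| ≤ C₂ * |x - y|

theorem contDiff_deriv {χ : ℝ → ℝ} (hχ : ContDiff ℝ ∞ χ) : ContDiff ℝ ∞ (deriv χ) :=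
  (contDiff_infty_iff_deriv.1 hχ).2

theorem derivBound_of_deriv2_le {χ : ℝ → ℝ} (hχ : ContDiff ℝ ∞ χ) {C₁ C₂ : ℝ}
    (h₁ : ∀ x ∈ Icc (-1 : ℝ) 1, |deriv χ x| ≤ C₁)
    (h₂ : ∀ x ∈ Icc (-1 : ℝ) 1, |deriv (deriv χ) x| ≤ C₂) : DerivBound χ C₁ C₂ := by
  have h := contDiff_deriv hχ
  refine ⟨h.continuous, h₁, fun x hx y hy => ?_⟩
  have := (convex_Icc (-1 : ℝ) 1).norm_image_sub_le_of_norm_deriv_le (f := deriv χ) (C := C₂)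
    (fun z _ => (h.differentiable (by simp)).differentiableAt) h₂ hy hx
  simpa using this

theorem exists_derivBound {χ : ℝ → ℝ} (hχ : ContDiff ℝ ∞ χ) : ∃ C₁ C₂, DerivBound χ C₁ C₂ := by
  have h := contDiff_deriv hχ
  obtain ⟨C₁, h₁⟩ := isCompact_Icc.exists_bound_of_continuousOn
    (s := Icc (-1 : ℝ) 1) h.continuous.continuousOn
  obtain ⟨C₂, h₂⟩ := isCompact_Icc.exists_bound_of_continuousOn
    (s := Icc (-1 : ℝ) 1) (contDiff_deriv h).continuous.continuousOn
  exact ⟨C₁, C₂, derivBound_of_deriv2_le hχ h₁ h₂⟩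

/-- The formal adjoint: `⟨𝒜 φ, χ⟩ = ∫ φ / w * opN χ`. -/
def opN (χ : ℝ → ℝ) (ξ : ℝ) : ℝ :=
  ξ * deriv χ ξ -
    (∫ x in Ioo (-1 : ℝ) 1, w x * ((deriv χ x - deriv χ ξ) / (x - ξ))) / Real.pi

variable {χ : ℝ → ℝ} {C₁ C₂ : ℝ}

theorem DerivBound.abs_quotient_le (h : DerivBound χ C₁ C₂) {x ξ : ℝ} (hx : x ∈ Ioo (-1 : ℝ) 1)
    (hξ : ξ ∈ Ioo (-1 : ℝ) 1) : |w x * ((deriv χ x - deriv χ ξ) / (x - ξ))| ≤ C₂ := by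
  have hC : 0 ≤ C₂ := by
    have := (abs_nonneg _).trans (h.lip 1 (by simp) 0 (by simp))
    simpa using this
  rw [abs_mul, abs_div, abs_of_nonneg (w_nonneg x)]
  have h1 : |deriv χ x - deriv χ ξ| / |x - ξ| ≤ C₂ :=
    div_le_of_le_mul₀ (abs_nonneg _) hC
      (h.lip x (Ioo_subset_Icc_self hx) ξ (Ioo_subset_Icc_self hξ))
  have h2 : 0 ≤ |deriv χ x - deriv χ ξ| / |x - ξ| := by positivity
  nlinarith [w_le_one x, w_nonneg x]

theorem DerivBound.measurable_quotient (h : DerivBound χ C₁ C₂) :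
    Measurable fun p : ℝ × ℝ => w p.2 * ((deriv χ p.2 - deriv χ p.1) / (p.2 - p.1)) := by
  have h1 := h.cont.measurable
  have h2 := continuous_w.measurable
  fun_prop

theorem DerivBound.integrableOn_quotient (h : DerivBound χ C₁ C₂) {ξ : ℝ}
    (hξ : ξ ∈ Ioo (-1 : ℝ) 1) :
    IntegrableOn (fun x => w x * ((deriv χ x - deriv χ ξ) / (x - ξ))) (Ioo (-1) 1) := by
  refine IntegrableOn.of_bound (C := C₂) (by simp) ?_ ?_
  · exact (h.measurable_quotient.comp measurable_prodMk_left).aestronglyMeasurable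
  · exact (ae_restrict_iff' measurableSet_Ioo).2 (ae_of_all _ fun x hx => h.abs_quotient_le hx hξ)

theorem DerivBound.measurable_opN (h : DerivBound χ C₁ C₂) : Measurable (opN χ) := by
  have h1 := h.cont.measurable
  have h2 : StronglyMeasurable fun ξ : ℝ =>
      ∫ x in Ioo (-1 : ℝ) 1, w x * ((deriv χ x - deriv χ ξ) / (x - ξ)) :=
    StronglyMeasurable.integral_prod_right' (ν := volume.restrict (Ioo (-1 : ℝ) 1))
      h.measurable_quotient.stronglyMeasurable
  have h3 := h2.measurable
  unfold opN
  fun_prop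

theorem DerivBound.abs_opN_le (h : DerivBound χ C₁ C₂) {ξ : ℝ} (hξ : ξ ∈ Ioo (-1 : ℝ) 1) :
    |opN χ ξ| ≤ C₁ + C₂ := by
  have hC : 0 ≤ C₂ := (abs_nonneg _).trans (h.abs_quotient_le hξ hξ)
  have h1 : |∫ x in Ioo (-1 : ℝ) 1, w x * ((deriv χ x - deriv χ ξ) / (x - ξ))| ≤ C₂ * 2 := by
    have := norm_setIntegral_le_of_norm_le_const (μ := volume) (s := Ioo (-1 : ℝ) 1) (C := C₂)
      (f := fun x => w x * ((deriv χ x - deriv χ ξ) / (x - ξ))) (by simp)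
      (fun x hx => h.abs_quotient_le hx hξ)
    refine this.trans (le_of_eq ?_)
    rw [Real.volume_real_Ioo_of_le (by norm_num)]
    norm_num
  have h2 : |ξ * deriv χ ξ| ≤ C₁ := by
    rw [abs_mul]
    have h3 : |ξ| ≤ 1 := abs_le.2 ⟨hξ.1.le, hξ.2.le⟩
    have h4 := h.bound ξ (Ioo_subset_Icc_self hξ)
    nlinarith [abs_nonneg (deriv χ ξ)]
  have h5 : |(∫ x in Ioo (-1 : ℝ) 1, w x * ((deriv χ x - deriv χ ξ) / (x - ξ))) / Real.pi| ≤ C₂ := by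
    rw [abs_div, abs_of_pos Real.pi_pos, div_le_iff₀ Real.pi_pos]
    nlinarith [Real.two_le_pi]
  exact (abs_sub _ _).trans (add_le_add h2 h5)

/-- Subtracting `deriv χ ξ` leaves a bounded difference quotient and isolates the singular part in
the explicit transform of the weight. -/
theorem DerivBound.integral_truncSet_split (h : DerivBound χ C₁ C₂) {ε ξ : ℝ} (hε : 0 < ε)
    (hξ : ξ ∈ Ioo (-1 : ℝ) 1) :
    ∫ x in truncSet ε ξ, w x * deriv χ x / (x - ξ) =
      deriv χ ξ * (∫ x in truncSet ε ξ, w x / (x - ξ)) +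
        ∫ x in truncSet ε ξ, w x * ((deriv χ x - deriv χ ξ) / (x - ξ)) := by
  have h1 : IntegrableOn (fun x => w x / (x - ξ)) (truncSet ε ξ) := by
    simpa using integrableOn_w_mul_div hε ξ (g := fun _ => 1) (C := 1) (by fun_prop) (by simp)
  rw [← integral_const_mul, ← integral_add (h1.const_mul _)
    ((h.integrableOn_quotient hξ).mono_set fun x hx => hx.1)]
  congr 1
  funext x
  ring

/-- Uniformity in both `ε` and `ξ` supplies the dominating function for the limit in
`opA_eq_integral`, where `ψ / w` is merely integrable. -/
theorem exists_bound_integral_truncSet (h : DerivBound χ C₁ C₂) :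
    ∃ B, ∀ ε > 0, ∀ ξ ∈ Ioo (-1 : ℝ) 1,
      |∫ x in truncSet ε ξ, w x * deriv χ x / (x - ξ)| ≤ B := by
  obtain ⟨B, hB⟩ := exists_bound_truncated_weight
  refine ⟨C₁ * B + C₂ * 2, fun ε hε ξ hξ => ?_⟩
  have hC : 0 ≤ C₂ := (abs_nonneg _).trans (h.abs_quotient_le hξ hξ)
  rw [h.integral_truncSet_split hε hξ]
  refine (abs_add_le _ _).trans (add_le_add ?_ ?_)
  · rw [abs_mul]
    have h1 := h.bound ξ (Ioo_subset_Icc_self hξ)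
    exact mul_le_mul h1 (hB ε hε ξ hξ) (abs_nonneg _) ((abs_nonneg _).trans h1)
  · have hsub : truncSet ε ξ ⊆ Ioo (-1) 1 := fun x hx => hx.1
    have h2 := norm_setIntegral_le_of_norm_le_const (μ := volume) (s := truncSet ε ξ) (C := C₂)
      (f := fun x => w x * ((deriv χ x - deriv χ ξ) / (x - ξ)))
      ((measure_mono hsub).trans_lt (by simp)) (fun x hx => h.abs_quotient_le hx.1 hξ)
    refine h2.trans ?_
    gcongr
    refine (measureReal_mono hsub (by simp)).trans (le_of_eq ?_)
    rw [Real.volume_real_Ioo_of_le (by norm_num)]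
    norm_num

theorem DerivBound.tendsto_integral_truncSet (h : DerivBound χ C₁ C₂) {ξ : ℝ}
    (hξ : ξ ∈ Ioo (-1 : ℝ) 1) :
    Tendsto (fun ε => ∫ x in truncSet ε ξ, w x * deriv χ x / (x - ξ)) (𝓝[>] 0)
      (𝓝 (-(Real.pi * opN χ ξ))) := by
  set q : ℝ → ℝ := fun x => w x * ((deriv χ x - deriv χ ξ) / (x - ξ)) with hq
  have h1 : Tendsto (fun ε => ∫ x in truncSet ε ξ, q x) (𝓝[>] 0)
      (𝓝 (∫ x in Ioo (-1 : ℝ) 1, q x)) := by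
    have h2 : ∀ ε, ∫ x in truncSet ε ξ, q x =
        ∫ x in Ioo (-1 : ℝ) 1, {x | ε < |x - ξ|}.indicator q x := fun ε => by
      rw [setIntegral_indicator (measurableSet_lt measurable_const
        (by fun_prop : Measurable fun x : ℝ => |x - ξ|))]
      rfl
    simp only [h2]
    refine tendsto_integral_filter_of_dominated_convergence (fun x => |q x|) ?_ ?_ ?_ ?_
    · refine Eventually.of_forall fun ε => ?_
      exact (h.integrableOn_quotient hξ).aestronglyMeasurable.indicator
        (measurableSet_lt measurable_const (by fun_prop : Measurable fun x : ℝ => |x - ξ|))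
    · refine Eventually.of_forall fun ε => ae_of_all _ fun x => ?_
      exact norm_indicator_le_norm_self _ _
    · exact (h.integrableOn_quotient hξ).abs
    · refine ae_of_all _ fun x => ?_
      rcases eq_or_ne x ξ with rfl | hx
      · simp [hq, indicator_apply]
      · refine tendsto_const_nhds.congr' ?_
        filter_upwards [Ioo_mem_nhdsGT (abs_pos.2 (sub_ne_zero.2 hx))] with ε hε
        rw [indicator_of_mem]
        exact hε.2
  have h3 := ((tendsto_truncated_weight hξ).const_mul (deriv χ ξ)).add h1
  have h4 : deriv χ ξ * -(Real.pi * ξ) + ∫ x in Ioo (-1 : ℝ) 1, q x = -(Real.pi * opN χ ξ) := by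
    simp only [opN]
    rw [← hq]
    field_simp
    ring
  rw [h4] at h3
  refine h3.congr' ?_
  filter_upwards [self_mem_nhdsWithin] with ε hε
  rw [h.integral_truncSet_split hε hξ]

/-- For fixed `ε` the truncated kernel is bounded by `C₁ / ε`, so Fubini applies and moves the
singular integral onto `χ`. -/
theorem DerivBound.integral_truncB_mul (h : DerivBound χ C₁ C₂) {ψ : ℝ → ℝ}
    (hψ : IntegrableOn (fun x => ψ x / w x) (Ioo (-1) 1)) {ε : ℝ} (hε : 0 < ε) :
    ∫ x in Ioo (-1 : ℝ) 1, truncB ε ψ x * deriv χ x =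
      (∫ ξ in Ioo (-1 : ℝ) 1, ψ ξ / w ξ * ∫ x in truncSet ε ξ, w x * deriv χ x / (x - ξ)) /
        Real.pi := by
  set k : ℝ × ℝ → ℝ := {p : ℝ × ℝ | ε < |p.1 - p.2|}.indicator
    (fun p => w p.1 * deriv χ p.1 / (p.1 - p.2)) with hk
  have hset : MeasurableSet {p : ℝ × ℝ | ε < |p.1 - p.2|} :=
    measurableSet_lt measurable_const (by fun_prop : Measurable fun p : ℝ × ℝ => |p.1 - p.2|)
  have hkm : Measurable k := by
    have h1 := h.cont.measurable
    have h2 := continuous_w.measurable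
    exact (by fun_prop : Measurable fun p : ℝ × ℝ => w p.1 * deriv χ p.1 / (p.1 - p.2)).indicator
      hset
  have hC : 0 ≤ C₁ := (abs_nonneg _).trans (h.bound 0 (by simp))
  have hkb : ∀ p, ‖k p‖ ≤ C₁ / ε := by
    intro p
    rw [hk, indicator_apply]
    split_ifs with hp
    · have h3 : |w p.1 * deriv χ p.1| ≤ C₁ := by
        by_cases hp1 : p.1 ∈ Ioo (-1 : ℝ) 1
        · rw [abs_mul, abs_of_nonneg (w_nonneg _)]
          have := h.bound p.1 (Ioo_subset_Icc_self hp1)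
          nlinarith [w_le_one p.1, w_nonneg p.1, abs_nonneg (deriv χ p.1)]
        · simpa [w_eq_zero hp1] using hC
      rw [Real.norm_eq_abs, abs_div]
      exact div_le_div₀ hC h3 hε (le_of_lt hp)
    · simp only [norm_zero]; positivity
  have hint : Integrable (fun p : ℝ × ℝ => k p * (ψ p.2 / w p.2))
      ((volume.restrict (Ioo (-1 : ℝ) 1)).prod (volume.restrict (Ioo (-1 : ℝ) 1))) :=
    Integrable.bdd_mul (Integrable.comp_snd hψ _) hkm.aestronglyMeasurable (ae_of_all _ hkb)
  have h1 : ∀ x, truncB ε ψ x * deriv χ x =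
      (∫ ξ in Ioo (-1 : ℝ) 1, k (x, ξ) * (ψ ξ / w ξ)) / Real.pi := by
    intro x
    have h2 : ∀ ξ, k (x, ξ) * (ψ ξ / w ξ) =
        {ξ | ε < |x - ξ|}.indicator
          (fun ξ => (w x * deriv χ x) * (ψ ξ / (w ξ * (x - ξ)))) ξ := by
      intro ξ
      simp only [hk, indicator_apply, mem_ofPred_eq]
      split_ifs
      · simp only [div_eq_mul_inv, mul_inv]; ring
      · simp
    simp only [h2]
    rw [setIntegral_indicator (measurableSet_lt measurable_const
      (by fun_prop : Measurable fun ξ : ℝ => |x - ξ|)), integral_const_mul]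
    unfold truncB
    have h3 : {ξ : ℝ | ξ ∈ Ioo (-1 : ℝ) 1 ∧ ε < |x - ξ|} =
      Ioo (-1 : ℝ) 1 ∩ {ξ | ε < |x - ξ|} := rfl
    rw [h3]
    ring
  simp only [h1]
  rw [integral_div, integral_integral_swap hint]
  congr 2
  funext ξ
  rw [integral_mul_const, mul_comm]
  congr 1
  have h4 : ∀ x, k (x, ξ) = {x | ε < |x - ξ|}.indicator
      (fun x => w x * deriv χ x / (x - ξ)) x := fun x => by
    simp only [hk, indicator_apply, mem_ofPred_eq]
  simp only [h4]
  rw [setIntegral_indicator (measurableSet_lt measurable_const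
      (by fun_prop : Measurable fun x : ℝ => |x - ξ|))]
  rfl

/-- The principal value in the definition of `𝒜` exists, and `𝒜` is dual to `opN`. -/
theorem opA_eq_integral {ψ χ : ℝ → ℝ} (hψ : IntegrableOn (fun x => ψ x / w x) (Ioo (-1) 1))
    (hχ : ContDiff ℝ ∞ χ) :
    opA ψ χ = ∫ ξ in Ioo (-1 : ℝ) 1, ψ ξ / w ξ * opN χ ξ := by
  obtain ⟨C₁, C₂, h⟩ := exists_derivBound hχ
  obtain ⟨B, hB⟩ := exists_bound_integral_truncSet h
  have h1 : Tendsto (fun ε => ∫ ξ in Ioo (-1 : ℝ) 1,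
      ψ ξ / w ξ * ∫ x in truncSet ε ξ, w x * deriv χ x / (x - ξ)) (𝓝[>] 0)
      (𝓝 (∫ ξ in Ioo (-1 : ℝ) 1, ψ ξ / w ξ * -(Real.pi * opN χ ξ))) := by
    refine tendsto_integral_filter_of_dominated_convergence (fun ξ => |ψ ξ / w ξ| * B) ?_ ?_ ?_ ?_
    · refine Eventually.of_forall fun ε => hψ.aestronglyMeasurable.mul ?_
      have h2 : ∀ ξ, ∫ x in truncSet ε ξ, w x * deriv χ x / (x - ξ) =
          ∫ x in Ioo (-1 : ℝ) 1, {p : ℝ × ℝ | ε < |p.2 - p.1|}.indicator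
            (fun p => w p.2 * deriv χ p.2 / (p.2 - p.1)) (ξ, x) := by
        intro ξ
        have h4 : ∀ x, {p : ℝ × ℝ | ε < |p.2 - p.1|}.indicator
            (fun p => w p.2 * deriv χ p.2 / (p.2 - p.1)) (ξ, x) =
            {x | ε < |x - ξ|}.indicator (fun x => w x * deriv χ x / (x - ξ)) x := fun x => by
          simp only [indicator_apply, mem_ofPred_eq]
        simp only [h4]
        rw [setIntegral_indicator (measurableSet_lt measurable_const
          (by fun_prop : Measurable fun x : ℝ => |x - ξ|))]
        rfl
      simp only [h2]
      have h5 := h.cont.measurable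
      have h6 := continuous_w.measurable
      have h7 : Measurable ({p : ℝ × ℝ | ε < |p.2 - p.1|}.indicator
          (fun p => w p.2 * deriv χ p.2 / (p.2 - p.1))) :=
        (by fun_prop : Measurable fun p : ℝ × ℝ => w p.2 * deriv χ p.2 / (p.2 - p.1)).indicator
          (measurableSet_lt measurable_const
            (by fun_prop : Measurable fun p : ℝ × ℝ => |p.2 - p.1|))
      exact (StronglyMeasurable.integral_prod_right'
        (ν := volume.restrict (Ioo (-1 : ℝ) 1)) h7.stronglyMeasurable).aestronglyMeasurable
    · filter_upwards [self_mem_nhdsWithin] with ε hε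
      refine (ae_restrict_iff' measurableSet_Ioo).2 (ae_of_all _ fun ξ hξ => ?_)
      rw [norm_mul]
      exact mul_le_mul_of_nonneg_left (hB ε hε ξ hξ) (norm_nonneg _)
    · exact hψ.abs.mul_const B
    · refine (ae_restrict_iff' measurableSet_Ioo).2 (ae_of_all _ fun ξ hξ => ?_)
      exact (h.tendsto_integral_truncSet hξ).const_mul _
  have h2 : Tendsto (fun ε => -∫ x in Ioo (-1 : ℝ) 1, truncB ε ψ x * deriv χ x) (𝓝[>] 0)
      (𝓝 (-((∫ ξ in Ioo (-1 : ℝ) 1, ψ ξ / w ξ * -(Real.pi * opN χ ξ)) / Real.pi))) := by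
    refine (h1.div_const Real.pi).neg.congr' ?_
    filter_upwards [self_mem_nhdsWithin] with ε hε
    rw [h.integral_truncB_mul hψ hε]
  have h3 : -((∫ ξ in Ioo (-1 : ℝ) 1, ψ ξ / w ξ * -(Real.pi * opN χ ξ)) / Real.pi) =
      ∫ ξ in Ioo (-1 : ℝ) 1, ψ ξ / w ξ * opN χ ξ := by
    rw [← integral_div, ← integral_neg]
    congr 1
    funext ξ
    field_simp
  rw [h3] at h2
  exact h2.limUnder_eq

end DualOperator
end Sloshing
end

noncomputable section
namespace Sloshing

/-! ### Action of the dual operator on Chebyshev polynomials. -/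

section ChebyshevMeasure

open Polynomial Polynomial.Chebyshev

theorem measureT_eq_withDensity : measureT =
    (volume.restrict (Ioo (-1 : ℝ) 1)).withDensity fun x => ENNReal.ofReal (w x)⁻¹ := by
  have hm : MeasurableSet (Ioc (-1 : ℝ) 1) := measurableSet_Ioc
  rw [measureT, restrict_withDensity hm, ← restrict_Ioo_eq_restrict_Ioc]
  congr 1
  funext x
  rw [ENNReal.ofReal]
  congr 1
  ext
  rw [Real.coe_toNNReal _ (inv_nonneg.2 (w_nonneg x))]
  simp [w, Real.sqrt_inv]

theorem measurable_ofReal_inv_w : Measurable fun x => ENNReal.ofReal (w x)⁻¹ := by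
  have := continuous_w.measurable
  fun_prop

theorem measureT_absolutelyContinuous : measureT ≪ volume.restrict (Ioo (-1 : ℝ) 1) := by
  rw [measureT_eq_withDensity]
  exact withDensity_absolutelyContinuous _ _

theorem absolutelyContinuous_measureT : volume.restrict (Ioo (-1 : ℝ) 1) ≪ measureT := by
  rw [measureT_eq_withDensity]
  refine withDensity_absolutelyContinuous' measurable_ofReal_inv_w.aemeasurable ?_
  refine (ae_restrict_iff' measurableSet_Ioo).2 (ae_of_all _ fun x hx => ?_)
  simpa using w_pos hx

theorem restrict_le_measureT : volume.restrict (Ioo (-1 : ℝ) 1) ≤ measureT := by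
  rw [measureT_eq_withDensity]
  conv_lhs => rw [← withDensity_one (μ := volume.restrict (Ioo (-1 : ℝ) 1))]
  refine withDensity_mono ((ae_restrict_iff' measurableSet_Ioo).2 (ae_of_all _ fun x hx => ?_))
  simp only [Pi.one_apply, ENNReal.one_le_ofReal]
  exact (one_le_inv₀ (w_pos hx)).2 (w_le_one x)

theorem ae_mem_Ioo_measureT : ∀ᵐ x ∂measureT, x ∈ Ioo (-1 : ℝ) 1 :=
  measureT_absolutelyContinuous.ae_le (ae_restrict_mem measurableSet_Ioo)

instance isFiniteMeasure_measureT : IsFiniteMeasure measureT := by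
  have := integrable_measureT (f := fun _ => (1 : ℝ)) continuousOn_const
  rw [integrable_const_iff] at this
  simpa using this

theorem integral_measureT_eq (f : ℝ → ℝ) :
    ∫ x, f x ∂measureT = ∫ x in Ioo (-1 : ℝ) 1, f x / w x := by
  rw [integral_measureT, intervalIntegral.integral_of_le (by norm_num),
    integral_Ioc_eq_integral_Ioo]
  simp [w, div_eq_mul_inv, Real.sqrt_inv]

theorem integrable_measureT_iff (f : ℝ → ℝ) :
    Integrable f measureT ↔ IntegrableOn (fun x => f x / w x) (Ioo (-1) 1) := by
  rw [measureT_eq_withDensity, integrable_withDensity_iff measurable_ofReal_inv_w (by simp)]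
  unfold IntegrableOn
  simp only [ENNReal.toReal_ofReal (inv_nonneg.2 (w_nonneg _)), div_eq_mul_inv]

theorem lintegral_measureT {f : ℝ → ℝ≥0∞} :
    ∫⁻ x, f x ∂measureT = ∫⁻ x in Ioo (-1 : ℝ) 1, ENNReal.ofReal (w x)⁻¹ * f x := by
  rw [measureT_eq_withDensity, lintegral_withDensity_eq_lintegral_mul_non_measurable _
    measurable_ofReal_inv_w (by simp)]
  rfl

theorem integrable_measureT_of_bound {f : ℝ → ℝ} (hf : Measurable f) {C : ℝ}
    (hC : ∀ x ∈ Ioo (-1 : ℝ) 1, |f x| ≤ C) : Integrable f measureT :=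
  Integrable.of_bound hf.aestronglyMeasurable C
    (by filter_upwards [ae_mem_Ioo_measureT] with x hx using hC x hx)

theorem abs_eval_T_le {x : ℝ} (hx : x ∈ Ioo (-1 : ℝ) 1) (n : ℤ) : |(T ℝ n).eval x| ≤ 1 :=
  abs_eval_T_real_le_one n (abs_le.2 ⟨hx.1.le, hx.2.le⟩)

/-- From `(1 - x²) U n = (T n - T (n + 2)) / 2`, the integrand is a difference of Chebyshev
polynomials over `w`, and only `T 0` has nonzero integral against `dx / w`. -/
theorem integral_w_mul_U (n : ℕ) :
    ∫ x in Ioo (-1 : ℝ) 1, w x * (U ℝ n).eval x = if n = 0 then Real.pi / 2 else 0 := by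
  have h1 : ∫ x in Ioo (-1 : ℝ) 1, w x * (U ℝ n).eval x =
      ∫ x, (((T ℝ n).eval x - (T ℝ (n + 2 : ℕ)).eval x) / 2) ∂measureT := by
    rw [integral_measureT_eq]
    refine setIntegral_congr_fun measurableSet_Ioo fun x hx => ?_
    have h2 := congrArg (Polynomial.eval x) (one_sub_X_sq_mul_U_eq_pol_in_T ℝ (n : ℤ))
    have h3 := congrArg (Polynomial.eval x) (T_add_two ℝ (n : ℤ))
    simp only [eval_mul, eval_sub, eval_one, eval_pow, eval_X, eval_ofNat] at h2 h3
    have hw := w_sq (Ioo_subset_Icc_self hx)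
    have hw0 := (w_pos hx).ne'
    push_cast
    field_simp
    rw [hw]
    linear_combination 2 * h2 - h3
  rw [h1, integral_div, integral_sub (integrable_measureT (by fun_prop))
    (integrable_measureT (by fun_prop)), integral_eval_T_real_measureT_of_ne_zero
    (n := ((n + 2 : ℕ) : ℤ)) (by positivity), sub_zero]
  split_ifs with hn
  · subst hn
    rw [Nat.cast_zero, integral_eval_T_real_measureT_zero]
  · rw [integral_eval_T_real_measureT_of_ne_zero (by exact_mod_cast hn), zero_div]

theorem integrableOn_w_mul_poly (p : ℝ[X]) :
    IntegrableOn (fun x => w x * p.eval x) (Ioo (-1) 1) := by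
  have := continuous_w
  exact (by fun_prop : Continuous fun x => w x * p.eval x).continuousOn.integrableOn_Icc.mono_set
    Ioo_subset_Icc_self

/-- The difference quotient of `U n` at `ξ` integrates against `w` to `π U (n - 1)`. -/
theorem exists_quotient_U (ξ : ℝ) (n : ℕ) :
    ∃ R : ℝ[X], (X - Polynomial.C ξ) * R = U ℝ n - Polynomial.C ((U ℝ n).eval ξ) ∧
      ∫ x in Ioo (-1 : ℝ) 1, w x * R.eval x = Real.pi * (U ℝ ((n : ℤ) - 1)).eval ξ := by
  -- The recurrence for `U` has two steps, so the induction carries `n` and `n + 1` together.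
  suffices h : (∃ R : ℝ[X], (X - Polynomial.C ξ) * R = U ℝ n - Polynomial.C ((U ℝ n).eval ξ) ∧
      ∫ x in Ioo (-1 : ℝ) 1, w x * R.eval x = Real.pi * (U ℝ ((n : ℤ) - 1)).eval ξ) ∧
      (∃ R : ℝ[X], (X - Polynomial.C ξ) * R = U ℝ (n + 1 : ℕ) - Polynomial.C ((U ℝ (n + 1 : ℕ)).eval ξ) ∧
      ∫ x in Ioo (-1 : ℝ) 1, w x * R.eval x = Real.pi * (U ℝ n).eval ξ) from h.1
  induction n with
  | zero =>
    refine ⟨⟨0, by simp, by simp⟩, ⟨2, ?_, ?_⟩⟩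
    · simp only [zero_add, Nat.cast_one, U_one, eval_mul, eval_ofNat, eval_X, Polynomial.C_mul, map_ofNat]
      ring
    · have := integral_w_mul_U 0
      simp only [Nat.cast_zero, U_zero, eval_one, mul_one, if_true] at this
      simp only [eval_ofNat, Nat.cast_zero, U_zero, eval_one, mul_one]
      rw [integral_mul_const, this]
      ring
  | succ n ih =>
    obtain ⟨⟨R₀, h₀, e₀⟩, ⟨R₁, h₁, e₁⟩⟩ := ih
    -- The quotient comes from `2 X U(X) - 2 ξ U(ξ) = 2 ξ (U(X) - U(ξ)) + 2 (X - ξ) U(X)` with `U =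
    -- U (n + 1)`. The extra term integrates to zero against `w`, its index being positive.
    refine ⟨⟨R₁, h₁, by simpa using e₁⟩, ⟨Polynomial.C (2 * ξ) * R₁ - R₀ + 2 * U ℝ (n + 1 : ℕ), ?_, ?_⟩⟩
    · have h2 : U ℝ (n + 1 + 1 : ℕ) = 2 * X * U ℝ (n + 1 : ℕ) - U ℝ n := by
        have := U_add_two ℝ (n : ℤ)
        push_cast
        rw [add_assoc]
        exact_mod_cast this
      rw [h2]
      simp only [eval_sub, eval_mul, eval_ofNat, eval_X, Polynomial.C_sub, Polynomial.C_mul, map_ofNat]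
      linear_combination 2 * Polynomial.C ξ * h₁ - h₀
    · have h3 : ∀ x, w x * (Polynomial.C (2 * ξ) * R₁ - R₀ + 2 * U ℝ (n + 1 : ℕ)).eval x =
          2 * ξ * (w x * R₁.eval x) - w x * R₀.eval x + 2 * (w x * (U ℝ (n + 1 : ℕ)).eval x) := by
        intro x
        simp only [eval_add, eval_sub, eval_mul, eval_ofNat, eval_C]
        ring
      simp only [h3]
      have i₁ : IntegrableOn (fun x => 2 * ξ * (w x * R₁.eval x) - w x * R₀.eval x)
          (Ioo (-1) 1) :=
        ((integrableOn_w_mul_poly R₁).const_mul _).sub (integrableOn_w_mul_poly R₀)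
      rw [integral_add i₁ ((integrableOn_w_mul_poly _).const_mul _),
        integral_sub ((integrableOn_w_mul_poly R₁).const_mul _) (integrableOn_w_mul_poly R₀),
        integral_const_mul, integral_const_mul, e₀, e₁, integral_w_mul_U]
      have h4 := congrArg (Polynomial.eval ξ) (U_add_one ℝ (n : ℤ))
      simp only [eval_sub, eval_mul, eval_ofNat, eval_X] at h4
      push_cast
      rw [h4]
      simp
      ring

theorem deriv_eval (p : ℝ[X]) : deriv (fun x => p.eval x) = fun x => p.derivative.eval x := by
  funext x
  exact p.deriv

theorem contDiff_eval (p : ℝ[X]) : ContDiff ℝ ∞ fun x => p.eval x := by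
  simpa using p.contDiff_aeval (𝕜 := ℝ) ∞

/-- Since `T (n + 1)' = (n + 1) U n` and the weighted difference quotient of `U n` integrates to `π
U (n - 1)`, the value is `(n + 1) (ξ U n - U (n - 1))`, which is `(n + 1) T (n + 1)`. -/
theorem opN_T (n : ℕ) (ξ : ℝ) : opN (fun x => (T ℝ n).eval x) ξ = n * (T ℝ n).eval ξ := by
  rcases n with _ | n
  · simp [opN]
  obtain ⟨R, hR, hint⟩ := exists_quotient_U ξ n
  have hd : deriv (fun x => (T ℝ (n + 1 : ℕ)).eval x) =
      fun x => ((n + 1 : ℕ) : ℝ) * (U ℝ n).eval x := by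
    rw [deriv_eval, T_derivative_eq_U]
    simp
  have hae : ∫ x in Ioo (-1 : ℝ) 1, w x * ((((n + 1 : ℕ) : ℝ) * (U ℝ n).eval x -
      ((n + 1 : ℕ) : ℝ) * (U ℝ n).eval ξ) / (x - ξ)) =
      ∫ x in Ioo (-1 : ℝ) 1, ((n + 1 : ℕ) : ℝ) * (w x * R.eval x) := by
    refine integral_congr_ae ?_
    have hne : ∀ᵐ x ∂volume.restrict (Ioo (-1 : ℝ) 1), x ≠ ξ :=
      ae_restrict_of_ae (Measure.ae_ne volume ξ)
    filter_upwards [hne] with x hx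
    have h1 := congrArg (Polynomial.eval x) hR
    simp only [eval_mul, eval_sub, eval_X, eval_C] at h1
    have h2 : x - ξ ≠ 0 := sub_ne_zero.2 hx
    rw [← mul_sub, ← h1]
    field_simp
  simp only [opN, hd]
  rw [hae, integral_const_mul, hint]
  have h3 := congrArg (Polynomial.eval ξ) (T_eq_X_mul_U_sub_U ℝ ((n : ℤ) - 1))
  simp only [eval_sub, eval_mul, eval_X] at h3
  have h4 : (n : ℤ) - 1 + 2 = ((n + 1 : ℕ) : ℤ) := by push_cast; ring
  have h5 : (n : ℤ) - 1 + 1 = n := by ring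
  rw [h4, h5] at h3
  rw [h3]
  have := Real.pi_ne_zero
  field_simp

theorem opN_add {χ₁ χ₂ : ℝ → ℝ} (h₁ : ContDiff ℝ ∞ χ₁) (h₂ : ContDiff ℝ ∞ χ₂) {ξ : ℝ}
    (hξ : ξ ∈ Ioo (-1 : ℝ) 1) : opN (fun x => χ₁ x + χ₂ x) ξ = opN χ₁ ξ + opN χ₂ ξ := by
  obtain ⟨_, _, b₁⟩ := exists_derivBound h₁
  obtain ⟨_, _, b₂⟩ := exists_derivBound h₂
  have hd : deriv (fun x => χ₁ x + χ₂ x) = fun x => deriv χ₁ x + deriv χ₂ x := by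
    funext x
    exact deriv_fun_add (h₁.differentiable (by simp)).differentiableAt
      (h₂.differentiable (by simp)).differentiableAt
  simp only [opN, hd]
  have : ∀ x, w x * ((deriv χ₁ x + deriv χ₂ x - (deriv χ₁ ξ + deriv χ₂ ξ)) / (x - ξ)) =
      w x * ((deriv χ₁ x - deriv χ₁ ξ) / (x - ξ)) +
        w x * ((deriv χ₂ x - deriv χ₂ ξ) / (x - ξ)) := fun x => by ring
  simp only [this]
  rw [integral_add (b₁.integrableOn_quotient hξ) (b₂.integrableOn_quotient hξ)]
  ring

theorem opN_const_mul (c : ℝ) (χ : ℝ → ℝ) (ξ : ℝ) :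
    opN (fun x => c * χ x) ξ = c * opN χ ξ := by
  have hd : deriv (fun x => c * χ x) = fun x => c * deriv χ x := by
    funext x
    exact deriv_const_mul_field c
  simp only [opN, hd]
  have : ∀ x, w x * ((c * deriv χ x - c * deriv χ ξ) / (x - ξ)) =
      c * (w x * ((deriv χ x - deriv χ ξ) / (x - ξ))) := fun x => by ring
  simp only [this]
  rw [integral_const_mul]
  ring

theorem integrable_opN {χ : ℝ → ℝ} (hχ : ContDiff ℝ ∞ χ) : Integrable (opN χ) measureT := by
  obtain ⟨_, _, b⟩ := exists_derivBound hχ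
  exact integrable_measureT_of_bound b.measurable_opN fun x hx => b.abs_opN_le hx

theorem integrable_mul_T {f : ℝ → ℝ} (hf : Integrable f measureT) (m : ℤ) :
    Integrable (fun x => f x * (T ℝ m).eval x) measureT :=
  hf.mul_bdd (c := 1) (by fun_prop)
    (by filter_upwards [ae_mem_Ioo_measureT] with x hx using abs_eval_T_le hx m)

theorem integrable_smooth {χ : ℝ → ℝ} (hχ : ContDiff ℝ ∞ χ) : Integrable χ measureT :=
  integrable_measureT hχ.continuous.continuousOn

theorem span_range_T : Submodule.span ℝ (Set.range fun n : ℕ => T ℝ n) = ⊤ := by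
  have := (chebyshevTsequence ℝ).span fun i => by
    rw [isUnit_iff_ne_zero, leadingCoeff_ne_zero]
    exact (chebyshevTsequence ℝ).ne_zero i
  exact this

/-- By linearity it suffices to test `T n`: orthogonality kills all `n ≠ m`, and for `n = m` the
eigenvalue is `m`. -/
theorem integral_opN_poly_mul_T (p : ℝ[X]) (m : ℕ) :
    ∫ x, opN (fun x => p.eval x) x * (T ℝ m).eval x ∂measureT =
      m * ∫ x, p.eval x * (T ℝ m).eval x ∂measureT := by
  have hp : p ∈ Submodule.span ℝ (Set.range fun n : ℕ => T ℝ n) := by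
    rw [span_range_T]; trivial
  induction hp using Submodule.span_induction with
  | mem p hp =>
    obtain ⟨n, rfl⟩ := hp
    simp only [opN_T, mul_assoc, integral_const_mul]
    rcases eq_or_ne n m with rfl | hnm
    · rfl
    · rw [integral_eval_T_real_mul_eval_T_real_measureT_of_ne hnm]; simp
  | zero => simp [opN]
  | add p q _ _ hp hq =>
    simp only [eval_add, add_mul]
    have h1 : ∫ x, opN (fun x => p.eval x + q.eval x) x * (T ℝ m).eval x ∂measureT =
        ∫ x, (opN (fun x => p.eval x) x * (T ℝ m).eval x +
          opN (fun x => q.eval x) x * (T ℝ m).eval x) ∂measureT := by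
      refine integral_congr_ae ?_
      filter_upwards [ae_mem_Ioo_measureT] with x hx
      rw [opN_add (contDiff_eval p) (contDiff_eval q) hx, add_mul]
    rw [h1, integral_add (integrable_mul_T (integrable_opN (contDiff_eval p)) _)
      (integrable_mul_T (integrable_opN (contDiff_eval q)) _),
      integral_add (integrable_mul_T (integrable_smooth (contDiff_eval p)) _)
      (integrable_mul_T (integrable_smooth (contDiff_eval q)) _), hp, hq]
    ring
  | smul c p _ hp =>
    simp only [eval_smul, smul_eq_mul, opN_const_mul, mul_assoc, integral_const_mul, hp]
    ring

/-- Polynomials are dense among smooth functions for the `C²([-1,1])` norm. -/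
theorem exists_poly_approx_C2 {χ : ℝ → ℝ} (hχ : ContDiff ℝ ∞ χ) {δ : ℝ} (hδ : 0 < δ) :
    ∃ p : ℝ[X], (∀ x ∈ Icc (-1 : ℝ) 1, |χ x - p.eval x| ≤ δ) ∧
      DerivBound (fun x => χ x + (-1) * p.eval x) δ δ := by
  have h1 := contDiff_deriv hχ
  have h2 := contDiff_deriv h1
  obtain ⟨q, hq⟩ := exists_polynomial_near_of_continuousOn (-1) 1 (deriv (deriv χ))
    h2.continuous.continuousOn δ hδ
  have hprim : ∀ (q : ℝ[X]) (c : ℝ), ∃ P : ℝ[X], P.derivative = q ∧ P.eval 0 = c := by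
    intro q c
    obtain ⟨P, hP⟩ : ∃ P : ℝ[X], P.derivative = q := by
      induction q using Polynomial.induction_on' with
      | add p q hp hq =>
        obtain ⟨P, rfl⟩ := hp
        obtain ⟨Q, rfl⟩ := hq
        exact ⟨P + Q, by simp⟩
      | monomial n a =>
        refine ⟨monomial (n + 1) (a / (n + 1)), ?_⟩
        rw [derivative_monomial]
        congr 1
        push_cast
        field_simp
    exact ⟨P + Polynomial.C (c - P.eval 0), by simp [hP], by simp⟩
  -- The Weierstrass approximant of `χ''` is integrated twice, with constants matching `χ'` and `χ`
  -- at `0`. Points of `[-1,1]` lie within distance `1` of `0`, so the error stays at most `δ` at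
  -- each integration.
  obtain ⟨p₁, hp₁, e₁⟩ := hprim q (deriv χ 0)
  obtain ⟨p, hp, e⟩ := hprim p₁ (χ 0)
  have hs : ContDiff ℝ ∞ fun x => χ x + (-1) * p.eval x :=
    hχ.add (contDiff_const.mul (contDiff_eval p))
  have hder : ∀ x, HasDerivAt (fun x => χ x + (-1) * p.eval x) (deriv χ x - p₁.eval x) x := by
    intro x
    have := (hχ.differentiable (by simp)).differentiableAt.hasDerivAt (x := x) |>.add
      ((p.hasDerivAt x).const_mul (-1))
    rw [hp] at this
    convert! this using 1
    ring
  have hder' : ∀ x, HasDerivAt (fun x => deriv χ x - p₁.eval x)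
      (deriv (deriv χ) x - q.eval x) x := by
    intro x
    have := (h1.differentiable (by simp)).differentiableAt.hasDerivAt (x := x) |>.sub
      (p₁.hasDerivAt x)
    rwa [hp₁] at this
  have hd : deriv (fun x => χ x + (-1) * p.eval x) = fun x => deriv χ x - p₁.eval x :=
    funext fun x => (hder x).deriv
  have hd' : deriv (deriv fun x => χ x + (-1) * p.eval x) =
      fun x => deriv (deriv χ) x - q.eval x := by
    rw [hd]
    exact funext fun x => (hder' x).deriv
  have hbd : ∀ x ∈ Icc (-1 : ℝ) 1, |deriv (deriv χ) x - q.eval x| ≤ δ := fun x hx => by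
    rw [abs_sub_comm]; exact (hq x hx).le
  have step : ∀ f f' : ℝ → ℝ, (∀ x, HasDerivAt f (f' x) x) → f 0 = 0 →
      (∀ x ∈ Icc (-1 : ℝ) 1, |f' x| ≤ δ) → ∀ x ∈ Icc (-1 : ℝ) 1, |f x| ≤ δ := by
    intro f f' hf h0 hb x hx
    have := (convex_Icc (-1 : ℝ) 1).norm_image_sub_le_of_norm_hasDerivWithin_le
      (fun x _ => (hf x).hasDerivWithinAt) hb (show (0 : ℝ) ∈ Icc (-1 : ℝ) 1 by simp) hx
    rw [h0, sub_zero, sub_zero, Real.norm_eq_abs, Real.norm_eq_abs] at this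
    have h3 : |x| ≤ 1 := abs_le.2 hx
    nlinarith
  have hb1 := step _ _ hder' (by simp [e₁]) hbd
  have hb0 := step _ _ hder (by simp [e]) hb1
  refine ⟨p, fun x hx => ?_, derivBound_of_deriv2_le hs ?_ ?_⟩
  · have := hb0 x hx
    rwa [neg_one_mul, ← sub_eq_add_neg] at this
  · rw [hd]; exact hb1
  · rw [hd']; exact hbd

/-- The Chebyshev coefficients of `opN χ`. -/
theorem integral_opN_mul_T {χ : ℝ → ℝ} (hχ : ContDiff ℝ ∞ χ) (m : ℕ) :
    ∫ x, opN χ x * (T ℝ m).eval x ∂measureT = m * ∫ x, χ x * (T ℝ m).eval x ∂measureT := by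
  -- The identity is known for polynomials, and both sides are controlled by the error `δ` in
  -- `C²([-1,1])`, so `δ → 0` concludes.
  have key : ∀ δ > 0, |∫ x, opN χ x * (T ℝ m).eval x ∂measureT -
      m * ∫ x, χ x * (T ℝ m).eval x ∂measureT| ≤ δ * ((2 + m) * measureT.real univ) := by
    intro δ hδ
    obtain ⟨p, hp, hb⟩ := exists_poly_approx_C2 hχ hδ
    have i1 := integrable_mul_T (integrable_opN hχ) m
    have i2 := integrable_mul_T (integrable_opN (contDiff_eval p)) m
    have i3 := integrable_mul_T (integrable_smooth hχ) m
    have i4 := integrable_mul_T (integrable_smooth (contDiff_eval p)) m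
    have h1 : ∫ x, opN χ x * (T ℝ m).eval x ∂measureT -
        m * ∫ x, χ x * (T ℝ m).eval x ∂measureT =
        (∫ x, (opN χ x * (T ℝ m).eval x - opN (fun x => p.eval x) x * (T ℝ m).eval x) ∂measureT) -
        m * ∫ x, (χ x * (T ℝ m).eval x - p.eval x * (T ℝ m).eval x) ∂measureT := by
      rw [integral_sub i1 i2, integral_sub i3 i4, integral_opN_poly_mul_T]
      ring
    have h2 : |∫ x, (opN χ x * (T ℝ m).eval x -
        opN (fun x => p.eval x) x * (T ℝ m).eval x) ∂measureT| ≤ (δ + δ) * measureT.real univ := by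
      rw [← Real.norm_eq_abs]
      refine norm_integral_le_of_norm_le_const (μ := measureT) ?_
      filter_upwards [ae_mem_Ioo_measureT] with x hx
      have h3 := hb.abs_opN_le hx
      rw [opN_add hχ (contDiff_const.mul (contDiff_eval p)) hx, opN_const_mul, neg_one_mul,
        ← sub_eq_add_neg] at h3
      rw [← sub_mul, norm_mul]
      exact (mul_le_of_le_one_right (norm_nonneg _) (abs_eval_T_le hx m)).trans h3
    have h4 : |∫ x, (χ x * (T ℝ m).eval x - p.eval x * (T ℝ m).eval x) ∂measureT| ≤
        δ * measureT.real univ := by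
      rw [← Real.norm_eq_abs]
      refine norm_integral_le_of_norm_le_const (μ := measureT) ?_
      filter_upwards [ae_mem_Ioo_measureT] with x hx
      rw [← sub_mul, norm_mul]
      exact (mul_le_of_le_one_right (norm_nonneg _) (abs_eval_T_le hx m)).trans
        (hp x (Ioo_subset_Icc_self hx))
    rw [h1]
    refine (abs_sub _ _).trans ?_
    rw [abs_mul, Nat.abs_cast]
    have h5 := mul_le_mul_of_nonneg_left h4 (Nat.cast_nonneg m : (0 : ℝ) ≤ m)
    linarith
  have h0 : |∫ x, opN χ x * (T ℝ m).eval x ∂measureT -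
      m * ∫ x, χ x * (T ℝ m).eval x ∂measureT| ≤ 0 := by
    have hlim : Tendsto (fun n : ℕ => 1 / ((n : ℝ) + 1) * ((2 + m) * measureT.real univ)) atTop
        (𝓝 0) := by
      simpa using tendsto_one_div_add_atTop_nhds_zero_nat.mul_const ((2 + m) * measureT.real univ)
    exact ge_of_tendsto' hlim fun n => key _ (by positivity)
  exact sub_eq_zero.1 (abs_nonpos_iff.1 h0)

end ChebyshevMeasure
end Sloshing
end

noncomputable section
namespace Sloshing

/-! ### Chebyshev expansions of the form and the energy. -/

section ChebyshevBasis

open Polynomial Polynomial.Chebyshev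
open scoped InnerProductSpace

theorem inner_eq_integral_mul {ρ : Measure ℝ} (f g : Lp ℝ 2 ρ) :
    ⟪f, g⟫_ℝ = ∫ x, f x * g x ∂ρ := by
  rw [L2.inner_def]
  congr 1
  funext x
  simp [mul_comm]

theorem inner_toLp_eq {ρ : Measure ℝ} {f g : ℝ → ℝ} (hf : MemLp f 2 ρ) (hg : MemLp g 2 ρ) :
    ⟪hf.toLp f, hg.toLp g⟫_ℝ = ∫ x, f x * g x ∂ρ := by
  rw [inner_eq_integral_mul]
  refine integral_congr_ae ?_
  filter_upwards [hf.coeFn_toLp, hg.coeFn_toLp] with x h1 h2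
  rw [h1, h2]

/-- Polynomials are total in `L²` of a finite measure on `[-1,1]`. -/
theorem eq_zero_of_integral_mul_poly {ρ : Measure ℝ} [IsFiniteMeasure ρ]
    (hρ : ∀ᵐ x ∂ρ, x ∈ Icc (-1 : ℝ) 1) {g : Lp ℝ 2 ρ}
    (h : ∀ p : ℝ[X], ∫ x, g x * p.eval x ∂ρ = 0) : g = 0 := by
  have hg : Integrable g ρ := (Lp.memLp g).integrable one_le_two
  -- Weierstrass on `[-1,1]` passes from polynomials to bounded continuous functions, which are
  -- dense in `L²`.
  have key : ∀ F : BoundedContinuousFunction ℝ ℝ, ∫ x, g x * F x ∂ρ = 0 := by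
    intro F
    have h1 : ∀ δ > 0, |∫ x, g x * F x ∂ρ| ≤ δ * ∫ x, |g x| ∂ρ := by
      intro δ hδ
      obtain ⟨p, hp⟩ := exists_polynomial_near_of_continuousOn (-1) 1 F F.continuous.continuousOn
        δ hδ
      have i1 : Integrable (fun x => g x * F x) ρ :=
        hg.mul_bdd (c := ‖F‖) F.continuous.aestronglyMeasurable
          (ae_of_all _ fun x => F.norm_coe_le_norm x)
      have i2 : Integrable (fun x => g x * (F x - p.eval x)) ρ := by
        refine hg.mul_bdd (c := δ) (by fun_prop) ?_
        filter_upwards [hρ] with x hx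
        rw [Real.norm_eq_abs, abs_sub_comm]
        exact (hp x hx).le
      have i3 : Integrable (fun x => g x * p.eval x) ρ := by
        have := i1.sub i2
        refine this.congr (ae_of_all _ fun x => ?_)
        simp only [Pi.sub_apply]
        ring
      have h2 : ∫ x, g x * F x ∂ρ = ∫ x, g x * (F x - p.eval x) ∂ρ := by
        have : ∀ x, g x * F x = g x * (F x - p.eval x) + g x * p.eval x := fun x => by ring
        simp only [this]
        rw [integral_add i2 i3, h p, add_zero]
      rw [h2, ← integral_const_mul, ← Real.norm_eq_abs]
      refine norm_integral_le_of_norm_le (hg.abs.const_mul δ) ?_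
      filter_upwards [hρ] with x hx
      rw [norm_mul, mul_comm, Real.norm_eq_abs, Real.norm_eq_abs, abs_sub_comm]
      exact mul_le_mul_of_nonneg_right (hp x hx).le (abs_nonneg _)
    have hlim : Tendsto (fun n : ℕ => 1 / ((n : ℝ) + 1) * ∫ x, |g x| ∂ρ) atTop (𝓝 0) := by
      simpa using tendsto_one_div_add_atTop_nhds_zero_nat.mul_const (∫ x, |g x| ∂ρ)
    exact abs_nonpos_iff.1 (ge_of_tendsto' hlim fun n => h1 _ (by positivity))
  have hd := BoundedContinuousFunction.toLp_denseRange (p := 2) ℝ ρ ℝ (by simp)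
  refine hd.eq_zero_of_inner_right ℝ (x := g) ?_
  intro F
  rw [inner_eq_integral_mul, ← key F]
  refine integral_congr_ae ?_
  filter_upwards [BoundedContinuousFunction.coeFn_toLp (p := 2) ρ ℝ F] with x hx
  rw [hx, mul_comm]

/-- Normalizing constants of the Chebyshev polynomials in `L²(measureT)`. -/
def chebNorm (n : ℕ) : ℝ := if n = 0 then (√Real.pi)⁻¹ else (√(Real.pi / 2))⁻¹

/-- The orthonormal Chebyshev polynomials. -/
def chebPoly (n : ℕ) : ℝ[X] := Polynomial.C (chebNorm n) * T ℝ n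

theorem chebNorm_pos (n : ℕ) : 0 < chebNorm n := by
  unfold chebNorm
  have := Real.pi_pos
  split_ifs <;> positivity

theorem eval_chebPoly (n : ℕ) (x : ℝ) : (chebPoly n).eval x = chebNorm n * (T ℝ n).eval x := by
  simp [chebPoly]

theorem integral_chebPoly_mul (m n : ℕ) :
    ∫ x, (chebPoly m).eval x * (chebPoly n).eval x ∂measureT = if m = n then 1 else 0 := by
  have h : ∀ x, (chebPoly m).eval x * (chebPoly n).eval x =
      (chebNorm m * chebNorm n) * ((T ℝ m).eval x * (T ℝ n).eval x) := fun x => by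
    rw [eval_chebPoly, eval_chebPoly]; ring
  simp only [h]
  rw [integral_const_mul]
  split_ifs with hmn
  · subst hmn
    have hπ := Real.pi_pos
    rcases eq_or_ne m 0 with rfl | hm
    · have h0 := integral_eval_T_real_mul_self_measureT_zero
      simp only [Nat.cast_zero, h0, chebNorm, if_true]
      rw [← mul_inv, Real.mul_self_sqrt hπ.le, inv_mul_cancel₀ hπ.ne']
    · rw [integral_T_real_mul_self_measureT_of_ne_zero hm]
      simp only [chebNorm, if_neg hm]
      rw [← mul_inv, Real.mul_self_sqrt (by positivity), inv_mul_cancel₀ (by positivity)]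
  · rw [integral_eval_T_real_mul_eval_T_real_measureT_of_ne hmn, mul_zero]

theorem memLp_of_bound {f : ℝ → ℝ} (hf : Measurable f) {C : ℝ}
    (hC : ∀ x ∈ Ioo (-1 : ℝ) 1, |f x| ≤ C) : MemLp f 2 measureT :=
  MemLp.of_bound hf.aestronglyMeasurable C
    (by filter_upwards [ae_mem_Ioo_measureT] with x hx using hC x hx)

theorem memLp_smooth {χ : ℝ → ℝ} (hχ : ContDiff ℝ ∞ χ) : MemLp χ 2 measureT := by
  obtain ⟨C, hC⟩ := isCompact_Icc.exists_bound_of_continuousOn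
    (s := Icc (-1 : ℝ) 1) hχ.continuous.continuousOn
  exact memLp_of_bound hχ.continuous.measurable fun x hx => hC x (Ioo_subset_Icc_self hx)

theorem memLp_poly (p : ℝ[X]) : MemLp (fun x => p.eval x) 2 measureT :=
  memLp_smooth (contDiff_eval p)

theorem memLp_opN {χ : ℝ → ℝ} (hχ : ContDiff ℝ ∞ χ) : MemLp (opN χ) 2 measureT := by
  obtain ⟨_, _, b⟩ := exists_derivBound hχ
  exact memLp_of_bound b.measurable_opN fun x hx => b.abs_opN_le hx

theorem span_range_chebPoly : Submodule.span ℝ (Set.range chebPoly) = ⊤ := by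
  rw [eq_top_iff, ← span_range_T, Submodule.span_le]
  rintro _ ⟨n, rfl⟩
  have h : T ℝ n = (chebNorm n)⁻¹ • chebPoly n := by
    rw [chebPoly, ← smul_eq_C_mul, smul_smul, inv_mul_cancel₀ (chebNorm_pos n).ne', one_smul]
  simp only [SetLike.mem_coe]
  rw [h]
  exact Submodule.smul_mem _ _ (Submodule.subset_span ⟨n, rfl⟩)

theorem orthonormal_chebPoly :
    Orthonormal ℝ fun n => (memLp_poly (chebPoly n)).toLp fun x => (chebPoly n).eval x := by
  classical
  rw [orthonormal_iff_ite]
  intro m n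
  rw [inner_toLp_eq, integral_chebPoly_mul]

/-- The Hilbert basis of `L²(measureT)` given by the Chebyshev polynomials. -/
def chebBasis : HilbertBasis ℕ ℝ (Lp ℝ 2 measureT) :=
  HilbertBasis.mkOfOrthogonalEqBot orthonormal_chebPoly <| by
    rw [Submodule.eq_bot_iff]
    intro g hg
    refine eq_zero_of_integral_mul_poly
      (by filter_upwards [ae_mem_Ioo_measureT] with x hx using Ioo_subset_Icc_self hx) fun p => ?_
    have hg' : Integrable g measureT := (Lp.memLp g).integrable one_le_two
    have hp : p ∈ Submodule.span ℝ (Set.range chebPoly) := by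
      rw [span_range_chebPoly]; trivial
    have hint : ∀ p : ℝ[X], Integrable (fun x => g x * p.eval x) measureT := fun p =>
      (Lp.memLp g).integrable_mul (memLp_poly p)
    induction hp using Submodule.span_induction with
    | mem p hp =>
      obtain ⟨n, rfl⟩ := hp
      have h1 := hg _ (Submodule.subset_span ⟨n, rfl⟩)
      rw [inner_eq_integral_mul] at h1
      rw [← h1]
      refine integral_congr_ae ?_
      filter_upwards [(memLp_poly (chebPoly n)).coeFn_toLp] with x hx
      rw [hx, mul_comm]
    | zero => simp
    | add p q _ _ hp hq =>
      simp only [eval_add, mul_add]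
      rw [integral_add (hint p) (hint q), hp, hq, add_zero]
    | smul c p _ hp =>
      simp only [eval_smul, smul_eq_mul, mul_left_comm _ c]
      rw [integral_const_mul, hp, mul_zero]

theorem chebBasis_apply (n : ℕ) :
    chebBasis n = (memLp_poly (chebPoly n)).toLp fun x => (chebPoly n).eval x := by
  rw [chebBasis, HilbertBasis.coe_mkOfOrthogonalEqBot]

/-- The Chebyshev coefficients of a function on `(-1,1)`. -/
def coef (f : ℝ → ℝ) (n : ℕ) : ℝ := ∫ x, f x * (chebPoly n).eval x ∂measureT

theorem coef_congr {f g : ℝ → ℝ} (h : f =ᵐ[measureT] g) (n : ℕ) : coef f n = coef g n :=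
  integral_congr_ae (by filter_upwards [h] with x hx; rw [hx])

theorem inner_chebBasis_toLp {f : ℝ → ℝ} (hf : MemLp f 2 measureT) (n : ℕ) :
    ⟪chebBasis n, hf.toLp f⟫_ℝ = coef f n := by
  rw [chebBasis_apply, inner_toLp_eq]
  simp only [coef, mul_comm]

theorem inner_chebBasis (g : Lp ℝ 2 measureT) (n : ℕ) : ⟪chebBasis n, g⟫_ℝ = coef g n := by
  conv_lhs => rw [← Lp.toLp_coeFn g (Lp.memLp g)]
  exact inner_chebBasis_toLp _ n

theorem hasSum_coef_mul_coef {f g : ℝ → ℝ} (hf : MemLp f 2 measureT) (hg : MemLp g 2 measureT) :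
    HasSum (fun n => coef f n * coef g n) (∫ x, f x * g x ∂measureT) := by
  have := chebBasis.hasSum_inner_mul_inner (hf.toLp f) (hg.toLp g)
  rw [inner_toLp_eq] at this
  have h : ∀ n, ⟪hf.toLp f, chebBasis n⟫_ℝ = coef f n := fun n => by
    rw [real_inner_comm, inner_chebBasis_toLp]
  simpa only [h, inner_chebBasis_toLp] using this

theorem coef_chebPoly (m n : ℕ) :
    coef (fun x => (chebPoly m).eval x) n = if m = n then 1 else 0 := integral_chebPoly_mul m n

theorem coef_opN {χ : ℝ → ℝ} (hχ : ContDiff ℝ ∞ χ) (n : ℕ) : coef (opN χ) n = n * coef χ n := by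
  have h : ∀ f : ℝ → ℝ, coef f n = chebNorm n * ∫ x, f x * (T ℝ n).eval x ∂measureT := by
    intro f
    rw [coef, ← integral_const_mul]
    congr 1
    funext x
    rw [eval_chebPoly]; ring
  rw [h, h, integral_opN_mul_T hχ]
  ring

theorem coef_const_mul (c : ℝ) (f : ℝ → ℝ) (n : ℕ) :
    coef (fun x => c * f x) n = c * coef f n := by
  simp only [coef, mul_assoc, integral_const_mul]

/-- `𝒜` is diagonal in the Chebyshev basis. -/
theorem hasSum_opA {ψ χ : ℝ → ℝ} (hψ : MemLp ψ 2 measureT) (hχ : ContDiff ℝ ∞ χ) :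
    HasSum (fun n : ℕ => n * (coef ψ n * coef χ n)) (opA ψ χ) := by
  have h1 : opA ψ χ = ∫ x, ψ x * opN χ x ∂measureT := by
    rw [opA_eq_integral ((integrable_measureT_iff ψ).1 (hψ.integrable one_le_two)) hχ,
      integral_measureT_eq]
    congr 1
    funext x
    ring
  rw [h1]
  have := hasSum_coef_mul_coef hψ (memLp_opN hχ)
  simp only [coef_opN hχ] at this
  convert! this using 2
  ring

theorem weightedNormSq_eq_lintegral (ψ : ℝ → ℝ) :
    weightedNormSq ψ = ∫⁻ x, ENNReal.ofReal (ψ x ^ 2) ∂measureT := by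
  rw [lintegral_measureT, weightedNormSq]
  refine setLIntegral_congr_fun measurableSet_Ioo fun x hx => ?_
  rw [← ENNReal.ofReal_mul (inv_nonneg.2 (w_nonneg x)), div_eq_mul_inv, mul_comm]

theorem weightedNormSq_eq {ψ : ℝ → ℝ} (hψ : MemLp ψ 2 measureT) :
    weightedNormSq ψ = ENNReal.ofReal (∫ x, ψ x ^ 2 ∂measureT) := by
  rw [weightedNormSq_eq_lintegral, ofReal_integral_eq_lintegral_ofReal hψ.integrable_sq
    (ae_of_all _ fun x => sq_nonneg _)]

theorem memLp_of_weightedNormSq_lt_top {ψ : ℝ → ℝ}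
    (hm : AEStronglyMeasurable ψ (volume.restrict (Ioo (-1 : ℝ) 1)))
    (h : weightedNormSq ψ < ⊤) : MemLp ψ 2 measureT := by
  have hm' : AEStronglyMeasurable ψ measureT := hm.mono_ac measureT_absolutelyContinuous
  rw [memLp_two_iff_integrable_sq hm']
  refine ⟨hm'.pow 2, ?_⟩
  rw [weightedNormSq_eq_lintegral] at h
  rw [hasFiniteIntegral_iff_ofReal (ae_of_all _ fun x => sq_nonneg _)]
  exact h

/-- Mode by mode `2ab - b² ≤ a²`, with equality at `b = a`. The upper bound is this inequality
summed with weights `n`; the lower bound tests with the partial Chebyshev sums of `ψ`, which are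
polynomials and hence admissible. -/
theorem energy_eq_tsum {ψ : ℝ → ℝ} (hψ : MemLp ψ 2 measureT) :
    energy ψ = ∑' n : ℕ, ENNReal.ofReal (n * coef ψ n ^ 2) := by
  apply le_antisymm
  · refine iSup₂_le fun χ hχ => ?_
    by_cases hs : Summable fun n : ℕ => (n : ℝ) * coef ψ n ^ 2
    · rw [← ENNReal.ofReal_tsum_of_nonneg (fun n => by positivity) hs]
      refine ENNReal.ofReal_le_ofReal ?_
      have h1 := ((hasSum_opA hψ hχ).mul_left 2).sub (hasSum_opA (memLp_smooth hχ) hχ)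
      refine hasSum_le (fun n => ?_) h1 hs.hasSum
      nlinarith [mul_nonneg (Nat.cast_nonneg n : (0 : ℝ) ≤ n) (sq_nonneg (coef ψ n - coef χ n))]
    · have : ∑' n : ℕ, ENNReal.ofReal (n * coef ψ n ^ 2) = ⊤ := by
        by_contra hne
        refine hs ?_
        have := ENNReal.summable_toReal hne
        simpa only [ENNReal.toReal_ofReal
          (mul_nonneg (Nat.cast_nonneg _) (sq_nonneg _))] using this
      rw [this]
      exact le_top
  · rw [ENNReal.tsum_eq_iSup_nat]
    refine iSup_le fun N => ?_
    set p : ℝ[X] := ∑ n ∈ Finset.range N, Polynomial.C (coef ψ n) * chebPoly n with hp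
    have hcoef : ∀ m, coef (fun x => p.eval x) m = if m < N then coef ψ m else 0 := by
      intro m
      have h1 : ∀ x, p.eval x * (chebPoly m).eval x = ∑ n ∈ Finset.range N,
          coef ψ n * ((chebPoly n).eval x * (chebPoly m).eval x) := by
        intro x
        simp only [hp, eval_finsetSum, eval_mul, eval_C, Finset.sum_mul, mul_assoc]
      have h2 : ∀ n ∈ Finset.range N, Integrable (fun x =>
          coef ψ n * ((chebPoly n).eval x * (chebPoly m).eval x)) measureT := fun n _ =>
        ((memLp_poly (chebPoly n)).integrable_mul (memLp_poly (chebPoly m))).const_mul _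
      rw [coef]
      simp only [h1]
      rw [integral_finsetSum _ h2]
      simp only [integral_const_mul, integral_chebPoly_mul]
      simp
    refine le_trans ?_ (le_iSup₂ (f := fun (χ : ℝ → ℝ) (_ : ContDiff ℝ ∞ χ) =>
      ENNReal.ofReal (2 * opA ψ χ - opA χ χ)) (fun x => p.eval x) (contDiff_eval p))
    rw [← ENNReal.ofReal_sum_of_nonneg fun n _ => by positivity]
    refine ENNReal.ofReal_le_ofReal (le_of_eq ?_)
    have h1 := ((hasSum_opA hψ (contDiff_eval p)).mul_left 2).sub
      (hasSum_opA (memLp_poly p) (contDiff_eval p))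
    have h2 : HasSum (fun n : ℕ => 2 * ((n : ℝ) * (coef ψ n * coef (fun x => p.eval x) n)) -
        n * (coef (fun x => p.eval x) n * coef (fun x => p.eval x) n)) (∑ n ∈ Finset.range N,
        (2 * ((n : ℝ) * (coef ψ n * coef (fun x => p.eval x) n)) -
        n * (coef (fun x => p.eval x) n * coef (fun x => p.eval x) n))) :=
      hasSum_sum_of_ne_finset_zero fun n hn => by
        rw [Finset.mem_range] at hn
        simp [hcoef, hn]
    rw [h1.unique h2]
    refine Finset.sum_congr rfl fun n hn => ?_
    rw [Finset.mem_range] at hn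
    rw [hcoef, if_pos hn]
    ring

end ChebyshevBasis
end Sloshing
end

noncomputable section
namespace Sloshing

/-! ### Coordinates on the energy space and the embedding into `L²(-1,1)`. -/

section EnergySpace

open Polynomial Polynomial.Chebyshev
open scoped InnerProductSpace lp

/-- The coordinate space of `H^{1/2}_{w⁻¹}`. -/
abbrev Coord : Type := lp (fun _ : ℕ => ℝ) 2

theorem Coord.inner_eq (c d : Coord) : HasSum (fun n => c n * d n) ⟪c, d⟫_ℝ := by
  simpa [mul_comm] using lp.hasSum_inner (𝕜 := ℝ) c d

theorem Coord.norm_sq (c : Coord) : HasSum (fun n => c n ^ 2) (‖c‖ ^ 2) := by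
  rw [← real_inner_self_eq_norm_sq]
  simpa only [sq] using Coord.inner_eq c c

theorem memlp_two_of_summable {f : ℕ → ℝ} (h : Summable fun n => f n ^ 2) :
    Memℓp f 2 := by
  refine memℓp_gen ?_
  simpa using h

/-- Multiplier inverting `√n` on the nonconstant modes. -/
def invSqrt (n : ℕ) : ℝ := if n = 0 then 0 else (√n)⁻¹

theorem invSqrt_sq_le (n : ℕ) : invSqrt n ^ 2 ≤ 1 := by
  unfold invSqrt
  split_ifs with h
  · norm_num
  · rw [inv_pow, Real.sq_sqrt (Nat.cast_nonneg _)]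
    exact inv_le_one_of_one_le₀ (by exact_mod_cast Nat.one_le_iff_ne_zero.2 h)

theorem summable_invSqrt_mul (c : Coord) : Summable fun n => (invSqrt n * c n) ^ 2 := by
  refine Summable.of_nonneg_of_le (fun n => sq_nonneg _) (fun n => ?_) (Coord.norm_sq c).summable
  rw [mul_pow]
  exact mul_le_of_le_one_left (sq_nonneg _) (invSqrt_sq_le n)

/-- The diagonal operator with entries `invSqrt n`. -/
def diagInvSqrt : Coord →L[ℝ] Coord :=
  LinearMap.mkContinuous
    { toFun := fun c => ⟨fun n => invSqrt n * c n, memlp_two_of_summable (summable_invSqrt_mul c)⟩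
      map_add' := fun c d => by
        ext n
        change invSqrt n * (c n + d n) = invSqrt n * c n + invSqrt n * d n
        ring
      map_smul' := fun a c => by ext n; simp; ring } 1 fun c => by
    rw [one_mul]
    refine (sq_le_sq₀ (norm_nonneg _) (norm_nonneg _)).1 (hasSum_le (fun n => ?_)
      (Coord.norm_sq _) (Coord.norm_sq c))
    change (invSqrt n * c n) ^ 2 ≤ c n ^ 2
    rw [mul_pow]
    exact mul_le_of_le_one_left (sq_nonneg _) (invSqrt_sq_le n)

theorem memLp_restrict {f : ℝ → ℝ} (hf : MemLp f 2 measureT) :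
    MemLp f 2 (volume.restrict (Ioo (-1 : ℝ) 1)) := hf.mono_measure restrict_le_measureT

/-- The inclusion of the weighted space `L²(w⁻¹ dx)` in `L²(-1,1)`. -/
def weightedToL2 : Lp ℝ 2 measureT →L[ℝ] L2 :=
  LinearMap.mkContinuous
    { toFun := fun g => (memLp_restrict (Lp.memLp g)).toLp g
      map_add' := fun g h => by
        refine Lp.ext ?_
        filter_upwards [(memLp_restrict (Lp.memLp (g + h))).coeFn_toLp,
          (memLp_restrict (Lp.memLp g)).coeFn_toLp, (memLp_restrict (Lp.memLp h)).coeFn_toLp,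
          absolutelyContinuous_measureT.ae_le (Lp.coeFn_add g h),
          Lp.coeFn_add ((memLp_restrict (Lp.memLp g)).toLp g)
            ((memLp_restrict (Lp.memLp h)).toLp h)] with x h1 h2 h3 h4 h5
        rw [h1, h5, h4, Pi.add_apply, Pi.add_apply, h2, h3]
      map_smul' := fun a g => by
        refine Lp.ext ?_
        filter_upwards [(memLp_restrict (Lp.memLp (a • g))).coeFn_toLp,
          (memLp_restrict (Lp.memLp g)).coeFn_toLp,
          absolutelyContinuous_measureT.ae_le (Lp.coeFn_smul a g),
          Lp.coeFn_smul a ((memLp_restrict (Lp.memLp g)).toLp g)] with x h1 h2 h4 h5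
        rw [h1, RingHom.id_apply, h5, h4, Pi.smul_apply, Pi.smul_apply, h2] } 1 fun g => by
    rw [one_mul]
    change ‖(memLp_restrict (Lp.memLp g)).toLp g‖ ≤ ‖g‖
    rw [Lp.norm_toLp, Lp.norm_def]
    exact ENNReal.toReal_mono (Lp.eLpNorm_ne_top g) (eLpNorm_mono_measure _ restrict_le_measureT)

theorem coeFn_weightedToL2_restrict (g : Lp ℝ 2 measureT) :
    weightedToL2 g =ᵐ[volume.restrict (Ioo (-1 : ℝ) 1)] g :=
  (memLp_restrict (Lp.memLp g)).coeFn_toLp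

theorem coeFn_weightedToL2 (g : Lp ℝ 2 measureT) : weightedToL2 g =ᵐ[measureT] g :=
  measureT_absolutelyContinuous.ae_le (coeFn_weightedToL2_restrict g)

theorem weightedToL2_toLp {f : ℝ → ℝ} (hf : MemLp f 2 measureT) :
    weightedToL2 (hf.toLp f) = (memLp_restrict hf).toLp f := by
  refine Lp.ext ?_
  filter_upwards [coeFn_weightedToL2_restrict (hf.toLp f), (memLp_restrict hf).coeFn_toLp,
    absolutelyContinuous_measureT.ae_le hf.coeFn_toLp] with x h1 h2 h3
  rw [h1, h2, h3]

theorem weightedToL2_injective : Function.Injective weightedToL2 := by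
  intro g h hgh
  refine Lp.ext ?_
  filter_upwards [coeFn_weightedToL2 g, coeFn_weightedToL2 h] with x h1 h2
  rw [← h1, ← h2, hgh]

/-- The class in `L²(-1,1)` of a smooth function. -/
def smoothL2 {χ : ℝ → ℝ} (hχ : ContDiff ℝ ∞ χ) : L2 := (memLp_restrict (memLp_smooth hχ)).toLp χ

theorem inner_smoothL2 (v : L2) {χ : ℝ → ℝ} (hχ : ContDiff ℝ ∞ χ) :
    ⟪v, smoothL2 hχ⟫_ℝ = ∫ x in Ioo (-1 : ℝ) 1, v x * χ x := by
  rw [inner_eq_integral_mul]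
  refine integral_congr_ae ?_
  filter_upwards [(memLp_restrict (memLp_smooth hχ)).coeFn_toLp] with x hx
  rw [smoothL2, hx]

/-- The constant function `1` in `L²(-1,1)`. -/
def oneL2 : L2 := smoothL2 (χ := fun _ => 1) contDiff_const

/-- The constant function `1` in `L²(w⁻¹ dx)`. -/
def oneW : Lp ℝ 2 measureT := (memLp_smooth (χ := fun _ => 1) contDiff_const).toLp fun _ => 1

theorem weightedToL2_oneW : weightedToL2 oneW = oneL2 := weightedToL2_toLp _

theorem inner_oneL2_self : ⟪oneL2, oneL2⟫_ℝ = 2 := by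
  rw [oneL2, smoothL2, inner_toLp_eq]
  simp
  norm_num

theorem coef_one {n : ℕ} (hn : n ≠ 0) : coef (fun _ => 1) n = 0 := by
  have h : (fun _ : ℝ => (1 : ℝ)) = fun x => (chebNorm 0)⁻¹ * (chebPoly 0).eval x := by
    funext x
    rw [eval_chebPoly]
    simp [(chebNorm_pos 0).ne']
  rw [h, coef_const_mul, coef_chebPoly, if_neg hn.symm, mul_zero]

/-- The parametrization of `H^{1/2}_{w⁻¹}` by coordinates, valued in `L²(w⁻¹ dx)`: the `0`-th
coordinate is the integral and the `n`-th coordinate is `√n` times the Chebyshev coefficient. -/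
def coordToWeighted : Coord →L[ℝ] Lp ℝ 2 measureT :=
  chebBasis.repr.symm.toContinuousLinearEquiv.toContinuousLinearMap ∘L diagInvSqrt +
    -- The first summand fixes the nonconstant modes. The multiple of the constant function then
    -- adjusts the `L²(dx)` product with `1` to the `0`-th coordinate; the factor is `1 / (1,1) =
    -- 1/2`.
    ((1 / 2 : ℝ) • (innerSL ℝ (lp.single 2 0 (1 : ℝ) : Coord) -
      innerSL ℝ oneL2 ∘L weightedToL2 ∘L
        chebBasis.repr.symm.toContinuousLinearEquiv.toContinuousLinearMap ∘L
          diagInvSqrt)).smulRight oneW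

/-- The parametrization of `H^{1/2}_{w⁻¹}` by coordinates. -/
def coordToL2 : Coord →L[ℝ] L2 := weightedToL2 ∘L coordToWeighted

theorem coordToWeighted_apply (c : Coord) : coordToWeighted c =
    chebBasis.repr.symm (diagInvSqrt c) + ((1 / 2 : ℝ) * (c 0 -
      ⟪oneL2, weightedToL2 (chebBasis.repr.symm (diagInvSqrt c))⟫_ℝ)) • oneW := by
  have h : ⟪(lp.single 2 0 (1 : ℝ) : Coord), c⟫_ℝ = c 0 := by
    rw [lp.inner_single_left]; simp
  rw [← h]
  rfl

theorem inner_oneL2_coordToL2 (c : Coord) : ⟪oneL2, coordToL2 c⟫_ℝ = c 0 := by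
  rw [coordToL2, ContinuousLinearMap.comp_apply, coordToWeighted_apply, map_add, map_smul,
    weightedToL2_oneW, inner_add_right, inner_smul_right, inner_oneL2_self]
  ring

theorem coef_Lp_eq_repr (g : Lp ℝ 2 measureT) (n : ℕ) : coef g n = chebBasis.repr g n := by
  rw [HilbertBasis.repr_apply_apply, inner_chebBasis]

theorem coef_oneW {n : ℕ} (hn : n ≠ 0) : coef oneW n = 0 := by
  rw [← coef_one hn]
  exact coef_congr (MemLp.coeFn_toLp _) n

theorem sqrt_mul_coef_coordToWeighted (c : Coord) {n : ℕ} (hn : n ≠ 0) :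
    √n * coef (coordToWeighted c) n = c n := by
  have h0 : coef oneW n = 0 := coef_oneW hn
  rw [coef_Lp_eq_repr] at h0 ⊢
  have hs : √(n : ℝ) ≠ 0 := by positivity
  rw [coordToWeighted_apply, map_add, map_smul, LinearIsometryEquiv.apply_symm_apply]
  change √n * (invSqrt n * c n + _ * chebBasis.repr oneW n) = c n
  rw [h0, invSqrt, if_neg hn]
  field_simp
  ring

theorem n_mul_coef_sq_coordToWeighted (c : Coord) (n : ℕ) :
    n * coef (coordToWeighted c) n ^ 2 = if n = 0 then 0 else c n ^ 2 := by
  split_ifs with hn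
  · simp [hn]
  · rw [← sqrt_mul_coef_coordToWeighted c hn, mul_pow, Real.sq_sqrt (Nat.cast_nonneg _)]

theorem coordToL2_injective : Function.Injective coordToL2 := by
  rw [injective_iff_map_eq_zero]
  intro c hc
  have h1 : coordToWeighted c = 0 := weightedToL2_injective (by rw [map_zero]; exact hc)
  ext n
  rcases eq_or_ne n 0 with rfl | hn
  · rw [← inner_oneL2_coordToL2 c, hc, inner_zero_right]; rfl
  · rw [← sqrt_mul_coef_coordToWeighted c hn, h1, coef_Lp_eq_repr]
    simp

/-- The only candidate for `c` is read off from `g`. The resulting function has the same nonconstant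
coefficients as `g`, so the difference is a multiple of `1`; it is also orthogonal to `1` in
`L²(dx)`, hence zero. -/
theorem exists_coord {g : Lp ℝ 2 measureT} (hg : Summable fun n : ℕ => n * coef g n ^ 2) :
    ∃ c, coordToWeighted c = g := by
  set f : ℕ → ℝ := fun n => if n = 0 then ⟪oneL2, weightedToL2 g⟫_ℝ else √n * coef g n with hf
  have hfs : Summable fun n => f n ^ 2 := by
    rw [← summable_nat_add_iff 1] at hg ⊢
    refine hg.congr fun n => ?_
    simp only [hf, Nat.add_eq_zero_iff, one_ne_zero, and_false, if_false, mul_pow]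
    rw [Real.sq_sqrt (Nat.cast_nonneg _)]
  set c : Coord := ⟨f, memlp_two_of_summable hfs⟩ with hc
  have hcn : ∀ n, c n = f n := fun n => rfl
  refine ⟨c, ?_⟩
  have h1 : ∀ n, n ≠ 0 → coef (coordToWeighted c) n = coef g n := by
    intro n hn
    have h2 := sqrt_mul_coef_coordToWeighted c hn
    rw [hcn] at h2
    simp only [hf, if_neg hn] at h2
    exact mul_left_cancel₀ (by positivity) h2
  set d : Lp ℝ 2 measureT := coordToWeighted c - g with hd
  have hd0 : ∀ n, n ≠ 0 → chebBasis.repr d n = 0 := by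
    intro n hn
    have := h1 n hn
    rw [coef_Lp_eq_repr, coef_Lp_eq_repr] at this
    rw [hd, map_sub]
    change chebBasis.repr (coordToWeighted c) n - chebBasis.repr g n = 0
    rw [this, sub_self]
  obtain ⟨a, ha⟩ : ∃ a : ℝ, d = a • oneW := by
    have h3 : chebBasis.repr oneW 0 ≠ 0 := by
      intro h4
      have h5 : oneW = 0 := by
        apply chebBasis.repr.injective
        ext n
        rcases eq_or_ne n 0 with rfl | hn
        · rw [h4]; simp
        · rw [← coef_Lp_eq_repr, coef_oneW hn]; simp
      have h6 := inner_oneL2_self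
      rw [← weightedToL2_oneW, h5] at h6
      simp at h6
    refine ⟨chebBasis.repr d 0 / chebBasis.repr oneW 0, ?_⟩
    apply chebBasis.repr.injective
    ext n
    have h5 : n ≠ 0 → chebBasis.repr oneW n = 0 := fun hn => by rw [← coef_Lp_eq_repr, coef_oneW hn]
    rw [map_smul]
    change chebBasis.repr d n = _ * chebBasis.repr oneW n
    rcases eq_or_ne n 0 with rfl | hn
    · field_simp
    · rw [hd0 n hn, h5 hn, mul_zero]
  have h7 : ⟪oneL2, weightedToL2 d⟫_ℝ = 0 := by
    rw [hd, map_sub, inner_sub_right]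
    have := inner_oneL2_coordToL2 c
    rw [coordToL2, ContinuousLinearMap.comp_apply] at this
    rw [this, hcn]
    simp [hf]
  rw [ha, map_smul, weightedToL2_oneW, inner_smul_right, inner_oneL2_self] at h7
  have h8 : a = 0 := by linarith
  rw [h8, zero_smul] at ha
  exact sub_eq_zero.1 ha

theorem coeFn_coordToL2 (c : Coord) : coordToL2 c =ᵐ[measureT] coordToWeighted c :=
  coeFn_weightedToL2 _

theorem memLp_coordToL2 (c : Coord) : MemLp (coordToL2 c) 2 measureT :=
  (memLp_congr_ae (coeFn_coordToL2 c)).2 (Lp.memLp _)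

theorem weightedNormSq_coordToL2 (c : Coord) :
    weightedNormSq (coordToL2 c) = ENNReal.ofReal (‖coordToWeighted c‖ ^ 2) := by
  rw [weightedNormSq_eq (memLp_coordToL2 c), ← real_inner_self_eq_norm_sq, inner_eq_integral_mul]
  congr 1
  refine integral_congr_ae ?_
  filter_upwards [coeFn_coordToL2 c] with x hx
  rw [hx, sq]

theorem hasSum_n_mul_coef_sq (c : Coord) :
    HasSum (fun n : ℕ => n * coef (coordToL2 c) n ^ 2) (‖c‖ ^ 2 - c 0 ^ 2) := by
  have h := (Coord.norm_sq c).sub (hasSum_ite_eq 0 (c 0 ^ 2))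
  refine h.congr_fun fun n => ?_
  rw [coef_congr (coeFn_coordToL2 c), n_mul_coef_sq_coordToWeighted]
  split_ifs with hn
  · simp [hn]
  · simp

theorem energy_coordToL2 (c : Coord) :
    energy (coordToL2 c) = ENNReal.ofReal (‖c‖ ^ 2 - c 0 ^ 2) := by
  have h := hasSum_n_mul_coef_sq c
  rw [energy_eq_tsum (memLp_coordToL2 c), ← ENNReal.ofReal_tsum_of_nonneg
    (fun n => by positivity) h.summable, h.tsum_eq]

theorem hNormSq_coordToL2 (c : Coord) : hNormSq (coordToL2 c) =
    ENNReal.ofReal (‖coordToWeighted c‖ ^ 2) + ENNReal.ofReal (‖c‖ ^ 2 - c 0 ^ 2) := by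
  rw [hNormSq, weightedNormSq_coordToL2, energy_coordToL2]

theorem hNormSq_coordToL2_le (c : Coord) :
    hNormSq (coordToL2 c) ≤ ENNReal.ofReal ((‖coordToWeighted‖ ^ 2 + 1) * ‖c‖ ^ 2) := by
  rw [hNormSq_coordToL2, add_mul, ENNReal.ofReal_add (by positivity) (by positivity)]
  refine add_le_add (ENNReal.ofReal_le_ofReal ?_) (ENNReal.ofReal_le_ofReal ?_)
  · rw [← mul_pow]
    gcongr
    exact coordToWeighted.le_opNorm c
  · nlinarith [sq_nonneg (c 0)]

/-- The energy controls all coordinates but the `0`-th, which is the `L²(dx)` product with `1`.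
Cauchy–Schwarz with `‖1‖² = 2` and `w ≤ 1` bounds its square by twice the weighted norm squared. -/
theorem norm_sq_le_hNormSq (c : Coord) :
    ENNReal.ofReal (‖c‖ ^ 2) ≤ 2 * hNormSq (coordToL2 c) := by
  have h0 : 0 ≤ ‖c‖ ^ 2 - c 0 ^ 2 :=
    (hasSum_n_mul_coef_sq c).nonneg fun n => by positivity
  have h1 : c 0 ^ 2 ≤ 2 * ‖coordToWeighted c‖ ^ 2 := by
    have h2 := abs_real_inner_le_norm oneL2 (coordToL2 c)
    rw [inner_oneL2_coordToL2] at h2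
    have h3 : ‖oneL2‖ ^ 2 = 2 := by rw [← real_inner_self_eq_norm_sq, inner_oneL2_self]
    have h4 : ‖coordToL2 c‖ ≤ ‖coordToWeighted c‖ := by
      have := LinearMap.mkContinuous_norm_le _ zero_le_one _ |> fun h =>
        weightedToL2.le_of_opNorm_le h (coordToWeighted c)
      rwa [one_mul] at this
    have h5 : c 0 ^ 2 ≤ (‖oneL2‖ * ‖coordToL2 c‖) ^ 2 := by
      rw [← sq_abs (c 0)]
      gcongr
    rw [mul_pow, h3] at h5
    refine h5.trans ?_
    gcongr
  have h2 : (2 : ℝ≥0∞) * ENNReal.ofReal (‖coordToWeighted c‖ ^ 2 + (‖c‖ ^ 2 - c 0 ^ 2)) =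
      ENNReal.ofReal (2 * (‖coordToWeighted c‖ ^ 2 + (‖c‖ ^ 2 - c 0 ^ 2))) := by
    rw [ENNReal.ofReal_mul (by norm_num), ENNReal.ofReal_ofNat]
  rw [hNormSq_coordToL2, ← ENNReal.ofReal_add (by positivity) h0, h2]
  refine ENNReal.ofReal_le_ofReal ?_
  linarith

theorem mem_H_iff (ψ : L2) : ψ ∈ H ↔ ∃ c, coordToL2 c = ψ := by
  constructor
  · intro h
    have h1 : weightedNormSq ψ < ⊤ := lt_of_le_of_lt le_self_add h
    have h2 : energy ψ < ⊤ := lt_of_le_of_lt le_add_self h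
    have hψ := memLp_of_weightedNormSq_lt_top (Lp.aestronglyMeasurable ψ) h1
    rw [energy_eq_tsum hψ] at h2
    have h3 := ENNReal.summable_toReal h2.ne
    simp only [ENNReal.toReal_ofReal
      (mul_nonneg (Nat.cast_nonneg _) (sq_nonneg _))] at h3
    obtain ⟨c, hc⟩ := exists_coord (g := hψ.toLp ψ) (by
      simpa only [coef_congr hψ.coeFn_toLp] using h3)
    refine ⟨c, ?_⟩
    rw [coordToL2, ContinuousLinearMap.comp_apply, hc, weightedToL2_toLp]
    exact Lp.toLp_coeFn ψ _
  · rintro ⟨c, rfl⟩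
    exact (hNormSq_coordToL2_le c).trans_lt ENNReal.ofReal_lt_top

/-- Smooth functions have coordinates. -/
theorem exists_coord_smooth {χ : ℝ → ℝ} (hχ : ContDiff ℝ ∞ χ) :
    ∃ r, coordToL2 r = smoothL2 hχ := by
  obtain ⟨r, hr⟩ := exists_coord (g := (memLp_smooth hχ).toLp χ) (by
    simpa only [coef_congr (memLp_smooth hχ).coeFn_toLp, sq] using
      (hasSum_opA (memLp_smooth hχ) hχ).summable)
  exact ⟨r, by rw [coordToL2, ContinuousLinearMap.comp_apply, hr, weightedToL2_toLp]; rfl⟩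

theorem coef_of_coordToL2_eq {χ : ℝ → ℝ} (hχ : ContDiff ℝ ∞ χ) {r : Coord}
    (hr : coordToL2 r = smoothL2 hχ) (n : ℕ) : coef (coordToWeighted r) n = coef χ n := by
  rw [smoothL2, ← weightedToL2_toLp (memLp_smooth hχ)] at hr
  have h : coordToWeighted r = (memLp_smooth hχ).toLp χ := weightedToL2_injective hr
  rw [h]
  exact coef_congr (memLp_smooth hχ).coeFn_toLp n

/-- The form `⟨𝒜 φ, χ⟩ + (φ, 1) (χ, 1)` is the inner product of the coordinates. -/
theorem opA_coordToL2 (c : Coord) {χ : ℝ → ℝ} (hχ : ContDiff ℝ ∞ χ) {r : Coord}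
    (hr : coordToL2 r = smoothL2 hχ) :
    opA (coordToL2 c) χ = ⟪c, r⟫_ℝ - ⟪oneL2, coordToL2 c⟫_ℝ * ⟪oneL2, smoothL2 hχ⟫_ℝ := by
  have h1 := (Coord.inner_eq c r).sub (hasSum_ite_eq 0 (c 0 * r 0))
  rw [← hr, inner_oneL2_coordToL2, inner_oneL2_coordToL2]
  refine (hasSum_opA (memLp_coordToL2 c) hχ).unique (h1.congr_fun fun n => ?_)
  rw [coef_congr (coeFn_coordToL2 c), ← coef_of_coordToL2_eq hχ hr]
  split_ifs with hn
  · simp [hn]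
  · rw [← sqrt_mul_coef_coordToWeighted c hn, ← sqrt_mul_coef_coordToWeighted r hn, sub_zero]
    linear_combination -(coef (coordToWeighted c) n * coef (coordToWeighted r) n) *
      Real.sq_sqrt (Nat.cast_nonneg n : (0 : ℝ) ≤ n)

/-- The coordinates of smooth functions are total. -/
theorem coord_eq_zero_of_inner_smooth {z : Coord}
    (h : ∀ (χ : ℝ → ℝ) (hχ : ContDiff ℝ ∞ χ) (r : Coord), coordToL2 r = smoothL2 hχ →
      ⟪z, r⟫_ℝ = 0) : z = 0 := by
  -- Test functions with only the modes `0` and `m` reduce the pairing to two terms. Constants then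
  -- isolate `z 0`, and `chebPoly m` isolates `z m`.
  have hcoord : ∀ (χ : ℝ → ℝ) (hχ : ContDiff ℝ ∞ χ) (m : ℕ), (∀ n, n ≠ 0 → n ≠ m → coef χ n = 0) →
      m ≠ 0 → z 0 * ⟪oneL2, smoothL2 hχ⟫_ℝ + z m * (√m * coef χ m) = 0 := by
    intro χ hχ m hm hm0
    obtain ⟨r, hr⟩ := exists_coord_smooth hχ
    have h1 := h χ hχ r hr
    have h2 : HasSum (fun n => z n * r n) (∑ n ∈ {0, m}, z n * r n) := by
      refine hasSum_sum_of_ne_finset_zero fun n hn => ?_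
      simp only [Finset.mem_insert, Finset.mem_singleton, not_or] at hn
      rw [← sqrt_mul_coef_coordToWeighted r hn.1, coef_of_coordToL2_eq hχ hr, hm n hn.1 hn.2]
      simp
    have h3 := h2.unique (Coord.inner_eq z r)
    rw [h1, Finset.sum_pair hm0.symm] at h3
    rw [← hr, inner_oneL2_coordToL2, ← coef_of_coordToL2_eq hχ hr,
      sqrt_mul_coef_coordToWeighted r hm0, h3]
  have h0 : z 0 = 0 := by
    have := hcoord (fun _ => 1) contDiff_const 1 (fun n hn _ => coef_one hn) one_ne_zero
    rw [coef_one one_ne_zero] at this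
    change z 0 * ⟪oneL2, oneL2⟫_ℝ + _ = 0 at this
    rw [inner_oneL2_self] at this
    linarith
  ext n
  rcases eq_or_ne n 0 with rfl | hn
  · exact h0
  · have := hcoord (fun x => (chebPoly n).eval x) (contDiff_eval _) n
      (fun k _ hk => by rw [coef_chebPoly, if_neg hk.symm]) hn
    rw [h0, zero_mul, zero_add, coef_chebPoly, if_pos rfl, mul_one] at this
    have hs : √(n : ℝ) ≠ 0 := by positivity
    exact (mul_eq_zero.1 this).resolve_right hs

/-- A vector killed by the adjoint is orthogonal in `L²(dx)` to the range, which contains all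
polynomials. -/
theorem adjoint_coordToL2_injective :
    Function.Injective (ContinuousLinearMap.adjoint coordToL2) := by
  rw [injective_iff_map_eq_zero]
  intro v hv
  refine eq_zero_of_integral_mul_poly ((ae_restrict_mem measurableSet_Ioo).mono
    fun x hx => Ioo_subset_Icc_self hx) fun p => ?_
  obtain ⟨r, hr⟩ := exists_coord_smooth (contDiff_eval p)
  rw [← inner_smoothL2 v (contDiff_eval p), ← hr, ← ContinuousLinearMap.adjoint_inner_left, hv,
    inner_zero_left]

end EnergySpace
end Sloshing
end

noncomputable section
namespace Sloshing

/-! ### From the abstract wave equation to the weak formulation and back. -/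

section Solution

open scoped InnerProductSpace
open ContinuousLinearMap (adjoint)

variable {f : ℝ → ℝ} {K : ℝ≥0}

/-- The superposition operator `ψ ↦ f ∘ ψ` is Lipschitz on `L²(-1,1)`. -/
theorem exists_superposition (hf : LipschitzWith K f) : ∃ N : L2 → L2, LipschitzWith K N ∧
    ∀ ψ, N ψ =ᵐ[volume.restrict (Ioo (-1 : ℝ) 1)] fun x => f (ψ x) := by
  -- Superposition on `Lp` is available for functions vanishing at `0`, so `f 0` is subtracted and
  -- restored as a constant, which is square integrable on the bounded interval.
  have hg : LipschitzWith K fun y => f y - f 0 :=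
    LipschitzWith.of_dist_le_mul fun x y => by
      rw [dist_sub_right]
      exact hf.dist_le_mul x y
  have hg0 : (fun y => f y - f 0) 0 = 0 := sub_self _
  have h1 := (memLp_restrict (memLp_smooth (χ := fun _ => f 0) contDiff_const)).coeFn_toLp
  refine ⟨fun ψ => hg.compLp hg0 ψ + smoothL2 (χ := fun _ => f 0) contDiff_const,
    LipschitzWith.of_dist_le_mul fun x y => ?_, fun ψ => ?_⟩
  · rw [dist_add_right]
    exact (hg.lipschitzWith_compLp hg0).dist_le_mul x y
  · filter_upwards [Lp.coeFn_add (hg.compLp hg0 ψ) (smoothL2 (χ := fun _ => f 0) contDiff_const),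
      hg.coeFn_compLp hg0 ψ, h1] with x h2 h3 h4
    rw [h2, Pi.add_apply, h3, smoothL2, h4]
    simp

/-- The Lipschitz source of the abstract wave equation attached to `f`: the mean of the unknown is
added on both sides of the equation, to make the operator coercive. -/
theorem exists_source (hf : LipschitzWith K f) : ∃ (F : L2 → L2) (C : ℝ≥0), LipschitzWith C F ∧
    ∀ (ψ : L2) (χ : ℝ → ℝ) (hχ : ContDiff ℝ ∞ χ), ⟪F ψ, smoothL2 hχ⟫_ℝ =
      (∫ x in Ioo (-1 : ℝ) 1, f (ψ x) * χ x) + ⟪oneL2, ψ⟫_ℝ * ⟪oneL2, smoothL2 hχ⟫_ℝ := by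
  obtain ⟨N, hN, hNf⟩ := exists_superposition hf
  set P : L2 →L[ℝ] L2 := (innerSL ℝ oneL2).smulRight oneL2 with hP
  refine ⟨fun ψ => N ψ + P ψ, K + ‖P‖₊, hN.add P.lipschitz, fun ψ χ hχ => ?_⟩
  rw [inner_add_left, inner_smoothL2]
  congr 1
  · refine integral_congr_ae ?_
    filter_upwards [hNf ψ] with x hx
    rw [hx]
  · rw [hP, ContinuousLinearMap.smulRight_apply, innerSL_apply_apply, real_inner_smul_left]

theorem IsSolution.mono {I J : Set ℝ} {φ₀ φ₁ : L2} {φ v : ℝ → L2}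
    (h : IsSolution I f φ₀ φ₁ φ v) (hJ : J ⊆ I) : IsSolution J f φ₀ φ₁ φ v where
  mem_H t ht := h.mem_H t (hJ ht)
  continuous_H t ht := (h.continuous_H t (hJ ht)).mono_left (nhdsWithin_mono t hJ)
  continuous_L2 := h.continuous_L2.mono hJ
  deriv_eq t ht := (h.deriv_eq t (hJ ht)).mono hJ
  equation χ hχ t ht := (h.equation χ hχ t (hJ ht)).mono hJ
  init_pos := h.init_pos
  init_vel := h.init_vel

/-- Strong continuity of the coordinates is continuity for the norm of `H^{1/2}_{w⁻¹}`. -/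
theorem continuousOn_coord_iff {I : Set ℝ} {u : ℝ → Coord} : ContinuousOn u I ↔
    ∀ t₀ ∈ I, Tendsto (fun t => hNormSq (coordToL2 (u t) - coordToL2 (u t₀))) (𝓝[I] t₀) (𝓝 0) := by
  refine forall₂_congr fun t₀ ht₀ => ?_
  simp only [← map_sub]
  constructor
  · intro h
    have h1 : Tendsto (fun t => ENNReal.ofReal ((‖coordToWeighted‖ ^ 2 + 1) * ‖u t - u t₀‖ ^ 2))
        (𝓝[I] t₀) (𝓝 (ENNReal.ofReal ((‖coordToWeighted‖ ^ 2 + 1) * ‖u t₀ - u t₀‖ ^ 2))) :=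
      ENNReal.tendsto_ofReal (((h.sub tendsto_const_nhds).norm.pow 2).const_mul _)
    rw [sub_self, norm_zero, zero_pow two_ne_zero, mul_zero, ENNReal.ofReal_zero] at h1
    exact tendsto_of_tendsto_of_tendsto_of_le_of_le tendsto_const_nhds h1 (fun _ => zero_le)
      fun t => hNormSq_coordToL2_le _
  · intro h
    have h1 : Tendsto (fun t => ENNReal.ofReal (‖u t - u t₀‖ ^ 2)) (𝓝[I] t₀) (𝓝 0) := by
      have h2 : Tendsto (fun t => 2 * hNormSq (coordToL2 (u t - u t₀))) (𝓝[I] t₀) (𝓝 (2 * 0)) :=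
        ENNReal.Tendsto.const_mul h (Or.inr (by simp))
      rw [mul_zero] at h2
      exact tendsto_of_tendsto_of_tendsto_of_le_of_le tendsto_const_nhds h2 (fun _ => zero_le)
        fun t => norm_sq_le_hNormSq _
    have h3 : Tendsto (fun t => ‖u t - u t₀‖ ^ 2) (𝓝[I] t₀) (𝓝 0) := by
      have h4 := (ENNReal.tendsto_toReal ENNReal.zero_ne_top).comp h1
      simpa only [Function.comp_def, ENNReal.toReal_ofReal (sq_nonneg _), ENNReal.toReal_zero]
        using h4
    have h5 : Tendsto (fun t => ‖u t - u t₀‖) (𝓝[I] t₀) (𝓝 0) := by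
      have h6 := h3.sqrt
      simpa only [Real.sqrt_sq (norm_nonneg _), Real.sqrt_zero] using h6
    exact tendsto_iff_norm_sub_tendsto_zero.2 h5

/-- The weak derivatives of a solution in terms of the coordinates. -/
theorem inner_coord_source {F : L2 → L2} (hF : ∀ (ψ : L2) (χ : ℝ → ℝ) (hχ : ContDiff ℝ ∞ χ),
      ⟪F ψ, smoothL2 hχ⟫_ℝ =
      (∫ x in Ioo (-1 : ℝ) 1, f (ψ x) * χ x) + ⟪oneL2, ψ⟫_ℝ * ⟪oneL2, smoothL2 hχ⟫_ℝ)
    (c : Coord) {χ : ℝ → ℝ} (hχ : ContDiff ℝ ∞ χ) {r : Coord} (hr : coordToL2 r = smoothL2 hχ) :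
    ⟪-c + adjoint coordToL2 (F (coordToL2 c)), r⟫_ℝ =
      (∫ x in Ioo (-1 : ℝ) 1, f (coordToL2 c x) * χ x) - opA (coordToL2 c) χ := by
  rw [inner_add_left, inner_neg_left, ContinuousLinearMap.adjoint_inner_left, hr, hF,
    opA_coordToL2 c hχ hr]
  ring

theorem inner_adjoint_coord (v : L2) {χ : ℝ → ℝ} (hχ : ContDiff ℝ ∞ χ) {r : Coord}
    (hr : coordToL2 r = smoothL2 hχ) :
    ⟪adjoint coordToL2 v, r⟫_ℝ = ∫ x in Ioo (-1 : ℝ) 1, v x * χ x := by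
  rw [ContinuousLinearMap.adjoint_inner_left, hr, inner_smoothL2]

theorem exists_isSolution (hf : LipschitzWith K f) {φ₀ : L2} (φ₁ : L2) (hφ₀ : φ₀ ∈ H) :
    ∃ φ v : ℝ → L2, IsSolution (Ici 0) f φ₀ φ₁ φ v := by
  obtain ⟨F, C, hC, hF⟩ := exists_source hf
  obtain ⟨u₀, rfl⟩ := (mem_H_iff φ₀).1 hφ₀
  obtain ⟨u, v, hu0, hv0, hu, hv, h⟩ := exists_wave_solution coordToL2_injective
    adjoint_coordToL2_injective hC u₀ φ₁
  refine ⟨fun t => coordToL2 (u t), v, ⟨fun t _ => (mem_H_iff _).2 ⟨u t, rfl⟩,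
    continuousOn_coord_iff.1 hu, hv, fun t ht => (h t ht).1.hasDerivWithinAt,
    fun χ hχ t ht => ?_, congrArg coordToL2 hu0, hv0⟩⟩
  obtain ⟨r, hr⟩ := exists_coord_smooth hχ
  -- Pairing the abstract equation with the coordinates `r` of `χ` gives the weak equation: the mean
  -- added to the form and the one added to the source cancel.
  have h1 := ((h t ht).2.inner ℝ (hasDerivAt_const t r)).hasDerivWithinAt (s := Ici 0)
  rw [inner_zero_right, zero_add, inner_coord_source hF (u t) hχ hr] at h1
  exact h1.congr_of_mem (fun s _ => (inner_adjoint_coord (v s) hχ hr).symm) ht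

/-- A function whose weak derivative against a separating family is continuous is strongly
differentiable. -/
theorem hasDerivWithinAt_of_inner {V : Type*} [NormedAddCommGroup V] [InnerProductSpace ℝ V]
    [CompleteSpace V] {T : ℝ} (hT : 0 ≤ T) {S : Set V} (hS : ∀ z : V, (∀ r ∈ S, ⟪z, r⟫_ℝ = 0) → z = 0)
    {p g : ℝ → V} (hg : ContinuousOn g (Icc 0 T))
    (h : ∀ r ∈ S, ∀ t ∈ Icc 0 T, HasDerivWithinAt (fun s => ⟪p s, r⟫_ℝ) ⟪g t, r⟫_ℝ (Icc 0 T) t) :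
    ∀ t ∈ Icc 0 T, HasDerivWithinAt p (g t) (Icc 0 T) t := by
  set G : ℝ → V := IccExtend hT ((Icc 0 T).domRestrict g) with hG
  have hGc : Continuous G := (continuousOn_iff_continuous_domRestrict.1 hg).Icc_extend'
  have hGg : ∀ t ∈ Icc 0 T, G t = g t := fun t ht => IccExtend_of_mem hT _ ht
  set P : ℝ → V := fun t => p 0 + ∫ s in (0 : ℝ)..t, G s with hP
  have hPd : ∀ t, HasDerivAt P (G t) t := fun t =>
    (hGc.integral_hasStrictDerivAt 0 t).hasDerivAt.const_add _
  have hpP : ∀ t ∈ Icc 0 T, p t = P t := by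
    intro t ht
    -- Against each vector of the separating family, `p` and the primitive `P` of `g` have the same
    -- derivative and the same value at `0`, hence they coincide.
    refine sub_eq_zero.1 (hS _ fun r hr => ?_)
    have hd : ∀ s ∈ Icc 0 T, HasDerivWithinAt (fun s => ⟪p s, r⟫_ℝ - ⟪P s, r⟫_ℝ) 0 (Icc 0 T) s := by
      intro s hs
      have h1 := ((hPd s).inner ℝ (hasDerivAt_const s r)).hasDerivWithinAt (s := Icc 0 T)
      rw [inner_zero_right, zero_add, hGg s hs] at h1
      have h2 := (h r hr s hs).sub h1
      rw [sub_self] at h2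
      exact h2
    have h2 := constant_of_has_deriv_right_zero (fun s hs => (hd s hs).continuousWithinAt)
      (fun s hs => (hd s (Ico_subset_Icc_self hs)).mono_of_mem_nhdsWithin
        (Icc_mem_nhdsGE_of_mem hs)) t ht
    rw [inner_sub_left, h2, hP]
    simp
  intro t ht
  have h3 := (hPd t).hasDerivWithinAt (s := Icc 0 T)
  rw [hGg t ht] at h3
  exact h3.congr_of_mem hpP ht

/-- The coordinates of a solution solve the abstract wave equation. -/
theorem IsSolution.exists_coord {F : L2 → L2} {C : ℝ≥0} (hC : LipschitzWith C F)
    (hF : ∀ (ψ : L2) (χ : ℝ → ℝ) (hχ : ContDiff ℝ ∞ χ), ⟪F ψ, smoothL2 hχ⟫_ℝ =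
      (∫ x in Ioo (-1 : ℝ) 1, f (ψ x) * χ x) + ⟪oneL2, ψ⟫_ℝ * ⟪oneL2, smoothL2 hχ⟫_ℝ)
    {T : ℝ} (hT : 0 ≤ T) {φ₀ φ₁ : L2} {φ v : ℝ → L2}
    (h : IsSolution (Icc 0 T) f φ₀ φ₁ φ v) :
    ∃ u : ℝ → Coord, (∀ t ∈ Icc 0 T, coordToL2 (u t) = φ t) ∧ ContinuousOn u (Icc 0 T) ∧
      (∀ t ∈ Icc 0 T, HasDerivWithinAt (fun s => coordToL2 (u s)) (v t) (Icc 0 T) t) ∧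
      ∀ t ∈ Icc 0 T, HasDerivWithinAt (fun s => adjoint coordToL2 (v s))
        (-u t + adjoint coordToL2 (F (coordToL2 (u t)))) (Icc 0 T) t := by
  choose! u hu using fun t ht => (mem_H_iff (φ t)).1 (h.mem_H t ht)
  have huc : ContinuousOn u (Icc 0 T) := continuousOn_coord_iff.2 fun t₀ ht₀ => by
    refine (h.continuous_H t₀ ht₀).congr' ?_
    filter_upwards [self_mem_nhdsWithin] with t ht
    rw [hu t ht, hu t₀ ht₀]
  refine ⟨u, hu, huc, fun t ht => (h.deriv_eq t ht).congr_of_mem hu ht, ?_⟩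
  -- The equation is given only against smooth functions, whose coordinates are separating. The
  -- candidate derivative is strongly continuous, so the weak derivative is a strong one.
  refine hasDerivWithinAt_of_inner hT
    (S := {r | ∃ (χ : ℝ → ℝ) (hχ : ContDiff ℝ ∞ χ), coordToL2 r = smoothL2 hχ})
    (fun z hz => coord_eq_zero_of_inner_smooth fun χ hχ r hr => hz r ⟨χ, hχ, hr⟩) ?_ ?_
  · exact huc.neg.add ((adjoint coordToL2).continuous.comp_continuousOn
      (hC.continuous.comp_continuousOn (coordToL2.continuous.comp_continuousOn huc)))
  · rintro r ⟨χ, hχ, hr⟩ t ht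
    rw [inner_coord_source hF (u t) hχ hr, hu t ht]
    exact (h.equation χ hχ t ht).congr_of_mem (fun s _ => inner_adjoint_coord (v s) hχ hr) ht

theorem IsSolution.eqOn_Icc (hf : LipschitzWith K f) {T : ℝ} (hT : 0 ≤ T) {φ₀ φ₁ : L2}
    {φ v φ' v' : ℝ → L2} (h : IsSolution (Icc 0 T) f φ₀ φ₁ φ v)
    (h' : IsSolution (Icc 0 T) f φ₀ φ₁ φ' v') : EqOn φ' φ (Icc 0 T) ∧ EqOn v' v (Icc 0 T) := by
  obtain ⟨F, C, hC, hF⟩ := exists_source hf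
  obtain ⟨u, hu, huc, hd, hd'⟩ := h.exists_coord hC hF hT
  obtain ⟨z, hz, hzc, he, he'⟩ := h'.exists_coord hC hF hT
  have h0 : z 0 = u 0 := coordToL2_injective (by
    rw [hu 0 (left_mem_Icc.2 hT), hz 0 (left_mem_Icc.2 hT), h.init_pos, h'.init_pos])
  obtain ⟨h1, h2⟩ := wave_solution_unique coordToL2_injective adjoint_coordToL2_injective hC hT
    hzc huc h'.continuous_L2 h.continuous_L2 he hd he' hd' h0 (h'.init_vel.trans h.init_vel.symm)
  exact ⟨fun t ht => by rw [← hu t ht, ← hz t ht, h1 ht], h2⟩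

end Solution
end Sloshing
end

theorem theorem3p1 (T : ℝ) (hT : 0 < T) (f : ℝ → ℝ) (hf : ∃ K : ℝ≥0, LipschitzWith K f)
    (φ₀ φ₁ : Sloshing.L2) (hφ₀ : φ₀ ∈ Sloshing.H) :
    Sloshing.HasUniqueSolution (Set.Icc 0 T) f φ₀ φ₁ ∧
      Sloshing.HasUniqueSolution (Set.Ici 0) f φ₀ φ₁ := by
  obtain ⟨K, hK⟩ := hf
  obtain ⟨φ, v, h⟩ := Sloshing.exists_isSolution hK φ₁ hφ₀
  refine ⟨⟨φ, v, h.mono Icc_subset_Ici_self, fun φ' v' h' =>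
    (h.mono Icc_subset_Ici_self).eqOn_Icc hK hT.le h'⟩, φ, v, h, fun φ' v' h' => ?_⟩
  -- A time `t ≥ 0` is the right end point of `[0, t]`, where uniqueness on compact intervals
  -- applies, including the degenerate case `t = 0`.
  have key : ∀ t ∈ Ici (0 : ℝ), φ' t = φ t ∧ v' t = v t := fun t ht => by
    have h1 := (h.mono Icc_subset_Ici_self).eqOn_Icc hK (mem_Ici.1 ht)
      (h'.mono Icc_subset_Ici_self)
    exact ⟨h1.1 (right_mem_Icc.2 ht), h1.2 (right_mem_Icc.2 ht)⟩
  exact ⟨fun t ht => (key t ht).1, fun t ht => (key t ht).2⟩
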